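/- Corollary 2.9 (cor:harmolog). Write $\langle x\rangle=(1+|x|^2)^{1/2}$ and $g(r)=\log(e+r)$ for $r\ge 0$. Let $\rho\colon\mathbb{R}^d\to(0,+\infty)$ and $\sigma\colon\mathbb{R}^d\to(0,1]$ be functions, and let $\omega\subset\mathbb{R}^d$ be a (Lebesgue) measurable set such that $$|\omega\cap B(x,\rho(x))|\ \ge\ \sigma(x)\,|B(x,\rho(x))|\qquad\text{for all }x\in\mathbb{R}^d,$$ where $|\cdot|$ denotes Lebesgue measure and $B(x,r)$ the Euclidean ball. Suppose that $\sigma$ is constant and that, for some $L>0$ and $\alpha>2$, $$\rho(x)\ \le\ \frac{L\langle x\rangle}{\bigl(g(g(|x|))\bigr)^{\alpha}\,g(|x|)}\qquad\text{for all }x\in\mathbb{R}^d.$$ Let $H=-\Delta+|x|^2$ be the harmonic oscillator in $L^2(\mathbb{R}^d)$ with its maximal domain $\{u\in L^2(\mathbb{R}^d): -\Delta u+|x|^2u\in L^2(\mathbb{R}^d)\}$. Then for every $T>0$ the equation $$\partial_t f+Hf=h\,\mathbb{1}_\omega,\qquad f(0,\cdot)=f_0,$$ is exactly null-controllable from $\omega$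 in time $T$: for every $f_0\in L^2(\mathbb{R}^d)$ there is a control $h\in L^2((0,T)\times\mathbb{R}^d)$ such that the mild solution $$f(t)=e^{-tH}f_0+\int_0^t e^{-(t-s)H}\bigl(h(s,\cdot)\mathbb{1}_\omega\bigr)\,ds,\qquad 0\le t\le T,$$ satisfies $f(T)=0$. -/

import Mathlib

open MeasureTheory Set
open scoped SchwartzMap Laplacian ENNReal

noncomputable section

namespace HarmonicControl

/-- The space `ℝ^d` with its Euclidean norm. -/
abbrev E (d : ℕ) : Type := EuclideanSpace ℝ (Fin d)

/-- The complex Hilbert space `L²(ℝ^d)`. -/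
abbrev L2 (d : ℕ) : Type := Lp ℂ 2 (volume : Measure (E d))

/-- The embedding of `L²(ℝ^d)` into the tempered distributions, as a linear map. -/
def toDistribution (d : ℕ) : L2 d →ₗ[ℂ] 𝓢'(E d, ℂ) :=
  (Lp.toTemperedDistributionCLM ℂ (volume : Measure (E d)) 2).toLinearMap

/-- An element of `L²(ℝ^d)` is determined by the distribution that it defines. -/
theorem toDistribution_injective (d : ℕ) : Function.Injective (toDistribution d) :=
  LinearMap.ker_eq_bot.mp
    (Lp.ker_toTemperedDistributionCLM_eq_bot (F := ℂ) (μ := (volume : Measure (E d))) (p := 2))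

/-- The differential expression `-Δ + |x|²`, acting on tempered distributions. -/
def oscillatorExpr (d : ℕ) : 𝓢'(E d, ℂ) →ₗ[ℂ] 𝓢'(E d, ℂ) where
  toFun f := -Δ f + TemperedDistribution.smulLeftCLM ℂ (fun x : E d ↦ ((‖x‖ ^ 2 : ℝ) : ℂ)) f
  map_add' f g := by
    simp only [← TemperedDistribution.laplacianCLM_apply, map_add]
    abel
  map_smul' c f := by
    simp only [← TemperedDistribution.laplacianCLM_apply, map_smul, smul_add, smul_neg,
      RingHom.id_apply]

/-- The maximal domain `{u ∈ L² : (-Δ + |x|²) u ∈ L²}` of the harmonic oscillator. -/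
def oscillatorDomain (d : ℕ) : Submodule ℂ (L2 d) :=
  (LinearMap.range (toDistribution d)).comap (oscillatorExpr d ∘ₗ toDistribution d)

/-- The harmonic oscillator `H = -Δ + |x|²` as an unbounded operator in `L²(ℝ^d)` with its maximal
domain: `H u` is the element of `L²` that represents the distribution `-Δ u + |x|² u`. -/
def harmonicOscillator (d : ℕ) : L2 d →ₗ.[ℂ] L2 d where
  domain := oscillatorDomain d
  toFun := (oscillatorExpr d ∘ₗ toDistribution d ∘ₗ (oscillatorDomain d).subtype).codRestrictOfInjective
    (toDistribution d) (toDistribution_injective d) (fun u ↦ u.2)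

/-- `S` (restricted to times `t ≥ 0`) is the strongly continuous semigroup with generator `-P`,
that is, `S t = e^{-tP}`. -/
structure IsSemigroupOf {d : ℕ} (P : L2 d →ₗ.[ℂ] L2 d) (S : ℝ → L2 d →L[ℂ] L2 d) : Prop where
  zero : S 0 = ContinuousLinearMap.id ℂ (L2 d)
  add : ∀ s t : ℝ, 0 ≤ s → 0 ≤ t → S (s + t) = (S s).comp (S t)
  continuousOn : ∀ u : L2 d, ContinuousOn (fun t ↦ S t u) (Ici 0)
  generator : ∀ u v : L2 d,
    (u, v) ∈ P.graph ↔ HasDerivWithinAt (fun t ↦ S t u) (-v) (Ici 0) 0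

/-- `f : [0, T] → L²(ℝ^d)` is the mild solution of `f' + P f = F`, `f(0) = f₀`, i.e.
`f(t) = e^{-tP} f₀ + ∫₀ᵗ e^{-(t-s)P} F(s) ds` (with a convergent Bochner integral). -/
def IsMildSolution {d : ℕ} (P : L2 d →ₗ.[ℂ] L2 d) (T : ℝ) (F : ℝ → L2 d) (f₀ : L2 d)
    (f : ℝ → L2 d) : Prop :=
  ∃ S : ℝ → L2 d →L[ℂ] L2 d, IsSemigroupOf P S ∧
    ∀ t ∈ Icc 0 T,
      IntervalIntegrable (fun s ↦ S (t - s) (F s)) volume 0 t ∧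
        f t = S t f₀ + ∫ s in (0 : ℝ)..t, S (t - s) (F s)

open Classical in
/-- The source term `s ↦ h(s, ·) 1_ω` with values in `L²(ℝ^d)`. If `h ∈ L²((0,T) × ℝ^d)`, the slice
is square integrable for almost every `s ∈ (0,T)`; it is set to `0` at the exceptional times. -/
def controlSource {d : ℕ} (ω : Set (E d)) (h : ℝ × E d → ℂ) (s : ℝ) : L2 d :=
  if hs : MemLp (ω.indicator fun x ↦ h (s, x)) 2 (volume : Measure (E d)) then hs.toLp else 0

/-- Exact null-controllability of `∂ₜ f + P f = h 1_ω` from `ω` in time `T`: every initial datum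
`f₀ ∈ L²(ℝ^d)` is steered to `0` at time `T` by some control `h ∈ L²((0,T) × ℝ^d)`. -/
def ExactlyNullControllable {d : ℕ} (P : L2 d →ₗ.[ℂ] L2 d) (ω : Set (E d)) (T : ℝ) : Prop :=
  ∀ f₀ : L2 d, ∃ h : ℝ × E d → ℂ,
    MemLp h 2 ((volume.restrict (Ioo 0 T)).prod (volume : Measure (E d))) ∧
      ∃ f : ℝ → L2 d, IsMildSolution P T (controlSource ω h) f₀ f ∧ f T = 0

/-- The geometric condition `|ω ∩ B(x, ρ(x))| ≥ σ(x) |B(x, ρ(x))|` for all `x ∈ ℝ^d`. -/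
def GeometricCondition {d : ℕ} (ω : Set (E d)) (σ ρ : E d → ℝ) : Prop :=
  ∀ x : E d, ENNReal.ofReal (σ x) * volume (Metric.ball x (ρ x)) ≤
    volume (ω ∩ Metric.ball x (ρ x))

/-- The Japanese bracket `⟨x⟩ = (1 + |x|²)^{1/2}`. -/
def japaneseBracket {d : ℕ} (x : E d) : ℝ := √(1 + ‖x‖ ^ 2)

/-- The function `g(r) = log(e + r)`. -/
def logScale (r : ℝ) : ℝ := Real.log (Real.exp 1 + r)

end HarmonicControl

end

open MeasureTheory Set
open scoped SchwartzMap Laplacian ENNReal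

noncomputable section

namespace HarmonicControl

/-! The proof is the Lebeau–Robbiano method, built on a spectral inequality whose cost is slightly
sublinear in the eigenvalue. Write w_k for `weight k` and X_k = 16^k w_k. The modes of level k are
Gaussians times polynomials of degree up to about 16^k: their eigenvalues are O(16^k), their
frequencies O(4^k), and most of their mass lies in |x| ≲ 4^k. On that region g(|x|) is comparable to
k and g(g(|x|)) to log k, apart from small |x| where ρ is small anyway, so the growth hypothesis
becomes ρ ≲ 4^k w_k (`exists_le_mul_weight`).

Spectral inequality (`exists_spectral_inequality`): ‖f‖² ≤ exp(C X_k) ∫_ω |f|² at level k. The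
energy identity yields a single point x₀ with |x₀| ≲ 4^k at which |f| is at least its average size
(`exists_norm_sq_le_mul_norm_apply`). By Vitali covering, ω has a fixed density in a ball about x₀
of radius comparable to 4^k w_k (`thick_at_larger_scale`). If f were small on most of ω there, it
would be small on a large part of some radius (`exists_large_radial_slice`). A Taylor polynomial of
degree n comparable to X_k, interpolated at n + 1 separated points of that part, would then make
f(x₀) too small (`norm_apply_zero_le_of_small_on`). Bernstein bounds make the Taylor error at most
e^{-n} up to factors B^k, interpolation costs a^n, and such factors are absorbed by exp(O(X_k))
because X_k ≥ k + 1.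

Control (`exists_null_control`): during a time τ_k = B w_k the modes of level k are steered to zero
at cost exp(O(X_k)); then the equation runs freely for a time τ_k, and the remaining modes decay by
exp(-16^k τ_k) = exp(-B X_k), which wins for large B. The steps fit into any T > 0 because the w_k
are summable. This is where the iterated logarithm in the hypothesis is needed.

The operator side is diagonalization: the Hermite functions are complete
(`eq_zero_of_forall_orthogonal`), and the maximal operator is multiplication by the eigenvalues 2n +
d (`mem_graph_iff_spectral`), so the semigroup is explicit. -/

/-! ### Propagation of smallness in one variable. -/

/-- A subset of an interval of large measure contains many well separated points. -/
theorem exists_separated_points {δ : ℝ} (hδ : 0 ≤ δ) (n : ℕ) :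
    ∀ A : Set ℝ, BddBelow A → ENNReal.ofReal (n * δ) < volume A →
      ∃ x : ℕ → ℝ, (∀ i ≤ n, x i ∈ A) ∧ ∀ i < n, x i + δ ≤ x (i + 1) := by
  induction n with
  | zero =>
    intro A _ hA
    obtain ⟨a, ha⟩ : A.Nonempty := by
      by_contra h
      simp [not_nonempty_iff_eq_empty.mp h] at hA
    exact ⟨fun _ ↦ a, fun _ _ ↦ ha, fun i hi ↦ absurd hi (by omega)⟩
  | succ n ih =>
    intro A hb hA
    -- η is slack in the strict inequality. With x₀ within η of the infimum, discarding everything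
    -- below x₀ + δ loses measure less than δ + η, and the induction goes on with the rest.
    obtain ⟨η, hη, hAη⟩ : ∃ η : ℝ, 0 < η ∧ ENNReal.ofReal (((n + 1 : ℕ) : ℝ) * δ + η) < volume A := by
      obtain ⟨c, hc1, hc2⟩ := ENNReal.lt_iff_exists_real_btwn.mp hA
      refine ⟨c - ((n + 1 : ℕ) : ℝ) * δ, ?_, by simpa using hc2.2⟩
      have := (ENNReal.ofReal_lt_ofReal_iff_of_nonneg (by positivity)).mp hc2.1
      linarith
    have hne : A.Nonempty := by
      by_contra h
      simp [not_nonempty_iff_eq_empty.mp h] at hA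
    obtain ⟨x₀, hx₀, hx₀'⟩ := exists_lt_of_csInf_lt hne (lt_add_of_pos_right (sInf A) hη)
    have hsub : A ⊆ Icc (sInf A) (x₀ + δ) ∪ (A ∩ Ici (x₀ + δ)) := by
      intro y hy
      rcases le_total y (x₀ + δ) with h | h
      · exact Or.inl ⟨csInf_le hb hy, h⟩
      · exact Or.inr ⟨hy, h⟩
    have hvol : ENNReal.ofReal (n * δ) < volume (A ∩ Ici (x₀ + δ)) := by
      by_contra hcon
      push Not at hcon
      have h1 : volume A ≤ ENNReal.ofReal (x₀ + δ - sInf A) + ENNReal.ofReal (n * δ) := by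
        refine (measure_mono hsub).trans ((measure_union_le _ _).trans ?_)
        rw [Real.volume_Icc]
        gcongr
      have hs := csInf_le hb hx₀
      rw [← ENNReal.ofReal_add (by linarith) (by positivity)] at h1
      refine absurd (hAη.trans_le h1) (not_lt.mpr (ENNReal.ofReal_le_ofReal ?_))
      push_cast
      linarith
    obtain ⟨x, hxA, hx⟩ := ih _ (hb.mono inter_subset_left) hvol
    refine ⟨fun i ↦ if i = 0 then x₀ else x (i - 1), fun i hi ↦ ?_, fun i hi ↦ ?_⟩
    · rcases i with _ | i
      · simpa using hx₀
      · simpa using (hxA i (by omega)).1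
    · rcases i with _ | i
      · simpa using (hxA 0 (by omega)).2
      · simpa using hx i (by omega)

/-- Denominators of the Lagrange basis for equally spaced nodes, the worst case among nodes with a
given minimal gap. -/
theorem prod_erase_abs_sub (n i : ℕ) (hi : i ≤ n) :
    ∏ j ∈ (Finset.range (n + 1)).erase i, |(i : ℝ) - j| = (i.factorial : ℝ) * (n - i).factorial := by
  induction n, hi using Nat.le_induction with
  | base =>
    rw [Finset.range_add_one, Finset.erase_insert (by simp)]
    have : ∀ k : ℕ, ∏ j ∈ Finset.range k, |(k : ℝ) - j| = k.factorial := by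
      intro k
      rw [← Finset.prod_range_add_one_eq_factorial, Nat.cast_prod,
        ← Finset.prod_range_reflect (fun j ↦ ((j + 1 : ℕ) : ℝ))]
      refine Finset.prod_congr rfl fun j hj ↦ ?_
      have hj' := Finset.mem_range.mp hj
      rw [abs_of_nonneg (by simpa using hj'.le)]
      have : ((k - 1 - j + 1 : ℕ) : ℝ) = ((k - j : ℕ) : ℝ) := by congr 1; omega
      rw [this, Nat.cast_sub hj'.le]
    simp [this]
  | succ n hn ih =>
    rw [Finset.range_add_one, Finset.erase_insert_of_ne (by omega), Finset.prod_insert (by simp), ih,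
      Nat.succ_sub hn, Nat.factorial_succ, abs_sub_comm, abs_of_nonneg (by simp; norm_cast; omega)]
    push_cast [Nat.cast_sub hn]
    ring

theorem abs_sub_ge_of_separated {δ : ℝ} {n : ℕ} {x : ℕ → ℝ}
    (hx : ∀ i < n, x i + δ ≤ x (i + 1)) {i j : ℕ} (hi : i ≤ n) (hj : j ≤ n) :
    δ * |(i : ℝ) - j| ≤ |x i - x j| := by
  have key : ∀ i j : ℕ, i ≤ j → j ≤ n → δ * ((j : ℝ) - i) ≤ x j - x i := by
    intro i j hij
    induction j, hij using Nat.le_induction with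
    | base => simp
    | succ j hj ih =>
      intro hjn
      have h1 := ih (by omega)
      have h2 := hx j (by omega)
      push_cast
      linarith
  rcases le_total i j with h | h
  · rw [abs_sub_comm, abs_sub_comm (x i), abs_of_nonneg (by simpa using h)]
    exact (key i j h hj).trans (le_abs_self _)
  · rw [abs_of_nonneg (by simpa using h)]
    exact (key j i h hi).trans (le_abs_self _)

/-- Lagrange interpolation at separated points, evaluated at the endpoint of the interval. -/
theorem norm_eval_zero_le_of_separated {δ l ε : ℝ} (hδ : 0 < δ) (hl : 0 ≤ l) {n : ℕ}
    {x : ℕ → ℝ} (hx : ∀ i < n, x i + δ ≤ x (i + 1)) (hxl : ∀ i ≤ n, x i ∈ Icc 0 l)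
    (p : Polynomial ℂ) (hp : p.degree < (n + 1 : ℕ)) (hε : ∀ i ≤ n, ‖p.eval (x i : ℂ)‖ ≤ ε) :
    ‖p.eval 0‖ ≤ (2 * l / δ) ^ n / n.factorial * ε := by
  have hinj : Set.InjOn (fun i ↦ (x i : ℂ)) (Finset.range (n + 1) : Set ℕ) := by
    intro i hi j hj hij
    have hi' : i ≤ n := by simpa [Nat.lt_succ_iff] using hi
    have hj' : j ≤ n := by simpa [Nat.lt_succ_iff] using hj
    have h1 := abs_sub_ge_of_separated (δ := δ) hx hi' hj'
    have h2 : x i = x j := Complex.ofReal_injective hij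
    rw [h2, sub_self, abs_zero] at h1
    have h3 : |(i : ℝ) - j| = 0 :=
      le_antisymm (nonpos_of_mul_nonpos_right h1 hδ) (abs_nonneg _)
    rw [abs_eq_zero, sub_eq_zero] at h3
    exact_mod_cast h3
  have hint := Lagrange.eq_interpolate (s := Finset.range (n + 1)) (v := fun i ↦ (x i : ℂ)) hinj
    (f := p) (by simpa using hp)
  have hε0 : 0 ≤ ε := (norm_nonneg _).trans (hε 0 (by omega))
  rw [hint, Lagrange.interpolate_apply, Polynomial.eval_finsetSum]
  have hterm : ∀ i ∈ Finset.range (n + 1),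
      ‖(Polynomial.C (p.eval (x i : ℂ)) *
        Lagrange.basis (Finset.range (n + 1)) (fun i ↦ (x i : ℂ)) i).eval 0‖ ≤
      ε * ((l / δ) ^ n * ((i.factorial : ℝ) * (n - i).factorial)⁻¹) := by
    intro i hi
    have hi' : i ≤ n := by simpa [Nat.lt_succ_iff] using hi
    rw [Polynomial.eval_mul, Polynomial.eval_C, norm_mul]
    gcongr
    · exact hε i hi'
    rw [Lagrange.basis, Polynomial.eval_prod, norm_prod, ← prod_erase_abs_sub n i hi',
      ← Finset.prod_inv_distrib]
    have hcard : ((Finset.range (n + 1)).erase i).card = n := by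
      rw [Finset.card_erase_of_mem hi]; simp
    rw [show (l / δ) ^ n = ∏ _j ∈ (Finset.range (n + 1)).erase i, (l / δ) by
      rw [Finset.prod_const, hcard], ← Finset.prod_mul_distrib]
    refine Finset.prod_le_prod (fun _ _ ↦ norm_nonneg _) fun j hj ↦ ?_
    obtain ⟨hji, hj⟩ := Finset.mem_erase.mp hj
    have hj' : j ≤ n := by simpa [Nat.lt_succ_iff] using hj
    have hpos : 0 < |(i : ℝ) - j| := by
      rw [abs_pos, sub_ne_zero]
      exact_mod_cast hji.symm
    rw [Lagrange.basisDivisor, Polynomial.eval_mul, Polynomial.eval_C, Polynomial.eval_sub,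
      Polynomial.eval_X, Polynomial.eval_C, norm_mul, norm_inv, zero_sub, norm_neg,
      ← Complex.ofReal_sub, Complex.norm_real, Complex.norm_real, Real.norm_eq_abs,
      Real.norm_eq_abs, abs_of_nonneg (hxl j hj').1, ← div_eq_inv_mul]
    calc x j / |x i - x j| ≤ l / (δ * |(i : ℝ) - j|) := by
          gcongr
          · exact (hxl j hj').2
          · exact abs_sub_ge_of_separated (δ := δ) hx hi' hj'
      _ = _ := by field_simp
  refine (norm_sum_le _ _).trans ((Finset.sum_le_sum hterm).trans (le_of_eq ?_))
  rw [← Finset.mul_sum, ← Finset.mul_sum]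
  -- The reciprocal denominators are binomial coefficients over n!; their sum is the source of the
  -- factor 2 ^ n.
  have hsum : ∑ i ∈ Finset.range (n + 1), ((i.factorial : ℝ) * (n - i).factorial)⁻¹ =
      2 ^ n / n.factorial := by
    have h1 := Nat.sum_range_choose n
    have h2 : (∑ i ∈ Finset.range (n + 1), (n.choose i : ℝ)) = 2 ^ n := by exact_mod_cast h1
    rw [← h2, Finset.sum_div]
    refine Finset.sum_congr rfl fun i hi ↦ ?_
    have hi' : i ≤ n := by simpa [Nat.lt_succ_iff] using hi
    rw [Nat.cast_choose ℝ hi']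
    field_simp
  rw [hsum, mul_div_assoc 2 l δ, mul_pow]
  ring

/-- Lets the interpolation estimate, which concerns complex polynomials, act on Taylor polynomials
of complex functions of a real variable. -/
theorem taylorWithinEval_eq_eval (g : ℝ → ℂ) (n : ℕ) (s : Set ℝ) :
    ∃ p : Polynomial ℂ, p.degree < (n + 1 : ℕ) ∧ ∀ t : ℝ, taylorWithinEval g n s 0 t = p.eval (t : ℂ) := by
  induction n with
  | zero =>
    refine ⟨Polynomial.C (g 0), ?_, by simp⟩
    exact Polynomial.degree_C_le.trans_lt (by norm_num)
  | succ n ih =>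
    obtain ⟨p, hp, hpt⟩ := ih
    refine ⟨p + Polynomial.C ((((n + 1 : ℝ) * n.factorial)⁻¹ : ℝ) *
      iteratedDerivWithin (n + 1) g s 0) * Polynomial.X ^ (n + 1), ?_, fun t ↦ ?_⟩
    · refine (Polynomial.degree_add_le _ _).trans_lt (max_lt (hp.trans ?_) ?_)
      · exact_mod_cast Nat.lt_succ_self _
      · refine (Polynomial.degree_C_mul_X_pow_le _ _).trans_lt ?_
        exact_mod_cast Nat.lt_succ_self _
    · rw [taylorWithinEval_succ, hpt, Polynomial.eval_add, Polynomial.eval_mul, Polynomial.eval_C,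
        Polynomial.eval_pow, Polynomial.eval_X, sub_zero, Complex.real_smul]
      push_cast
      ring

/-- Propagation of smallness from a set of positive measure to the endpoint of an interval, for
functions with controlled derivatives. -/
theorem norm_apply_zero_le_of_small_on {g : ℝ → ℂ} (hg : ∀ k : ℕ, ContDiff ℝ k g) {n : ℕ} (hn : 1 ≤ n)
    {l γ ε M : ℝ} (hl : 0 < l) (hγ : 0 < γ)
    (hM : ∀ t ∈ Icc 0 l, ‖iteratedDeriv (n + 1) g t‖ ≤ M) {A : Set ℝ} (hA : A ⊆ Icc 0 l)
    (hvol : ENNReal.ofReal (γ * l) < volume A) (hε : ∀ t ∈ A, ‖g t‖ ≤ ε) :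
    ‖g 0‖ ≤ (2 * Real.exp 1 / γ) ^ n * (ε + M * l ^ (n + 1) / n.factorial) := by
  have hn0 : (0 : ℝ) < n := by exact_mod_cast hn
  -- The gap γ l / n is the largest for which n gaps fit into the measure γ l.
  obtain ⟨x, hxA, hx⟩ := exists_separated_points (δ := γ * l / n) (by positivity) n A
    (bddBelow_Icc.mono hA) (by rwa [mul_div_cancel₀ _ hn0.ne'])
  obtain ⟨p, hp, hpt⟩ := taylorWithinEval_eq_eval g n (Icc 0 l)
  have hM0 : 0 ≤ M := (norm_nonneg _).trans (hM 0 ⟨le_rfl, hl.le⟩)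
  have hrem : ∀ t ∈ Icc 0 l, ‖g t - p.eval (t : ℂ)‖ ≤ M * l ^ (n + 1) / n.factorial := by
    intro t ht
    have h := taylor_mean_remainder_bound (f := g) (n := n) (C := M) hl.le
      (by exact_mod_cast (hg (n + 1)).contDiffOn) ht (fun y hy ↦ by
        rw [iteratedDerivWithin_eq_iteratedDeriv (uniqueDiffOn_Icc hl)
          (hg (n + 1)).contDiffAt hy]
        exact hM y hy)
    rw [hpt] at h
    refine h.trans ?_
    have ht' : t - 0 ≤ l := by linarith [ht.2]
    have ht0 : 0 ≤ t - 0 := by linarith [ht.1]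
    gcongr
  -- The expansion is centred at 0, so there is no Taylor error at the point of interest.
  have h0 : g 0 = p.eval 0 := by
    have h := hpt 0
    simpa using h
  have hle := norm_eval_zero_le_of_separated (δ := γ * l / n) (l := l)
    (ε := ε + M * l ^ (n + 1) / n.factorial) (by positivity) hl.le hx (fun i hi ↦ hA (hxA i hi)) p hp
    (fun i hi ↦ by
      have h1 := hε _ (hxA i hi)
      have h2 := hrem _ (hA (hxA i hi))
      calc ‖p.eval (x i : ℂ)‖ = ‖g (x i) - (g (x i) - p.eval (x i : ℂ))‖ := by congr 1; ring
        _ ≤ ‖g (x i)‖ + ‖g (x i) - p.eval (x i : ℂ)‖ := norm_sub_le _ _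
        _ ≤ _ := add_le_add h1 h2)
  have hεnn : 0 ≤ ε + M * l ^ (n + 1) / n.factorial := by
    have := (norm_nonneg _).trans (hε _ (hxA 0 (by omega)))
    positivity
  rw [h0]
  refine hle.trans ?_
  gcongr
  -- The interpolation factor is (2 / γ) ^ n times n ^ n / n!, and the latter is at most e ^ n.
  have h1 : (2 * l / (γ * l / n)) = (2 / γ) * n := by field_simp
  rw [h1, mul_pow, mul_div_assoc, mul_div_right_comm, mul_pow, Real.exp_one_pow]
  gcongr
  exact Real.pow_div_factorial_le_exp n hn0.le n

/-! ### Density of ω in larger balls and along radii. -/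

/-- A set that is thick at variable scales at most `r` is thick at the scale `2 * r`. -/
theorem thick_at_larger_scale {d : ℕ} {ω : Set (E d)} (hω : NullMeasurableSet ω volume)
    {ρ : E d → ℝ} {σ r : ℝ} (hσ : 0 < σ) {x₀ : E d}
    (hρ : ∀ x ∈ Metric.ball x₀ r, 0 < ρ x ∧ ρ x ≤ r)
    (h : ∀ x ∈ Metric.ball x₀ r, ENNReal.ofReal σ * volume (Metric.ball x (ρ x)) ≤
      volume (ω ∩ Metric.ball x (ρ x))) :
    ENNReal.ofReal (σ / 10 ^ d) * volume (Metric.ball x₀ (2 * r)) ≤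
      volume (ω ∩ Metric.ball x₀ (2 * r)) := by
  -- The disjoint Vitali balls lie in the ball of radius 2 * r, and their fivefold enlargements
  -- cover the ball of radius r. The loss 10 ^ d is 5 ^ d from the enlargement times 2 ^ d from
  -- doubling r.
  obtain ⟨u, hut, hdisj, hcov⟩ := Vitali.exists_disjoint_subfamily_covering_enlargement_closedBall
    (Metric.ball x₀ r) (fun x : E d ↦ x) ρ r (fun a ha ↦ (hρ a ha).2) 5 (by norm_num)
  have hu : u.Countable := hdisj.countable_of_nonempty_interior fun a ha ↦ by
    refine ⟨a, ?_⟩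
    exact Metric.ball_subset_interior_closedBall (Metric.mem_ball_self (hρ a (hut ha)).1)
  have hfin : Module.finrank ℝ (E d) = d := by simp
  have hdisj' : u.Pairwise (Function.onFun (AEDisjoint volume) fun a ↦ ω ∩ Metric.ball a (ρ a)) := by
    intro a ha b hb hab
    refine Disjoint.aedisjoint ((hdisj ha hb hab).mono ?_ ?_)
    · exact inter_subset_right.trans Metric.ball_subset_closedBall
    · exact inter_subset_right.trans Metric.ball_subset_closedBall
  have h1 : volume (Metric.ball x₀ r) ≤
      ∑' a : u, ENNReal.ofReal (5 ^ d) * volume (Metric.ball (a : E d) (ρ a)) := by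
    have hsub : Metric.ball x₀ r ⊆ ⋃ a ∈ u, Metric.closedBall (a : E d) (5 * ρ a) := by
      intro x hx
      obtain ⟨b, hb, hxb⟩ := hcov x hx
      exact mem_biUnion hb (hxb (Metric.mem_closedBall_self (hρ x hx).1.le))
    refine (measure_mono hsub).trans ((measure_biUnion_le _ hu _).trans ?_)
    refine ENNReal.tsum_le_tsum fun a ↦ le_of_eq ?_
    have hpos := (hρ a (hut a.2)).1
    rw [Measure.addHaar_closedBall _ _ (by positivity), Measure.addHaar_ball_of_pos _ _ hpos, hfin,
      mul_pow, ENNReal.ofReal_mul (by positivity), mul_assoc]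
  have h2 : ENNReal.ofReal σ * volume (Metric.ball x₀ r) ≤
      ENNReal.ofReal (5 ^ d) * volume (ω ∩ Metric.ball x₀ (2 * r)) := by
    calc ENNReal.ofReal σ * volume (Metric.ball x₀ r)
        ≤ ENNReal.ofReal σ *
          ∑' a : u, ENNReal.ofReal (5 ^ d) * volume (Metric.ball (a : E d) (ρ a)) := by gcongr
      _ = ENNReal.ofReal (5 ^ d) *
          ∑' a : u, ENNReal.ofReal σ * volume (Metric.ball (a : E d) (ρ a)) := by
        rw [ENNReal.tsum_mul_left, ENNReal.tsum_mul_left, mul_left_comm]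
      _ ≤ ENNReal.ofReal (5 ^ d) * ∑' a : u, volume (ω ∩ Metric.ball (a : E d) (ρ a)) := by
        gcongr with a
        exact h a (hut a.2)
      _ = ENNReal.ofReal (5 ^ d) * volume (⋃ a ∈ u, ω ∩ Metric.ball (a : E d) (ρ a)) := by
        rw [measure_biUnion₀ hu hdisj' fun a _ ↦ hω.inter measurableSet_ball.nullMeasurableSet]
      _ ≤ _ := by
        gcongr
        refine iUnion₂_subset fun a ha ↦ inter_subset_inter_right _ ?_
        refine Metric.ball_subset_ball' ?_
        have h3 := Metric.mem_ball.mp (hut ha)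
        have h4 := (hρ a (hut ha)).2
        linarith
  rw [Measure.addHaar_ball_mul_of_pos _ _ (by norm_num), hfin,
    ← Measure.addHaar_ball_center volume x₀, ← mul_assoc, ← ENNReal.ofReal_mul (by positivity)]
  have h3 : ENNReal.ofReal (σ / 10 ^ d * 2 ^ d) =
      ENNReal.ofReal ((5 ^ d)⁻¹) * ENNReal.ofReal σ := by
    rw [← ENNReal.ofReal_mul (by positivity)]
    congr 1
    rw [show (10 : ℝ) = 5 * 2 by norm_num, mul_pow]
    field_simp
  rw [h3, mul_assoc]
  calc _ ≤ ENNReal.ofReal ((5 ^ d)⁻¹) *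
        (ENNReal.ofReal (5 ^ d) * volume (ω ∩ Metric.ball x₀ (2 * r))) := by gcongr
    _ = _ := by
      rw [← mul_assoc, ← ENNReal.ofReal_mul (by positivity), inv_mul_cancel₀ (by positivity),
        ENNReal.ofReal_one, one_mul]

/-- A subset of a ball of large measure has a large slice along some radius. -/
theorem exists_large_radial_slice {d : ℕ} (hd : 1 ≤ d) {x₀ : E d} {l γ : ℝ} (hl : 0 < l)
    (hγ : 0 < γ) {A : Set (E d)} (hA : MeasurableSet A) (hsub : A ⊆ Metric.ball x₀ l)
    (hvol : ENNReal.ofReal γ * volume (Metric.ball x₀ l) ≤ volume A) :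
    ∃ θ : E d, ‖θ‖ = 1 ∧
      ENNReal.ofReal (γ / (2 * d) * l) < volume {t : ℝ | t ∈ Ioo 0 l ∧ x₀ + t • θ ∈ A} := by
  -- If all slices were short, polar coordinates with t ^ (d - 1) ≤ l ^ (d - 1) and sphere area d
  -- |B₁| would give |A| ≤ (γ / 2) |B_l|, contradicting the density γ.
  by_contra! hcon
  have hd0 : (0 : ℝ) < d := by exact_mod_cast hd
  have : Nontrivial (E d) := by
    have : Nonempty (Fin d) := ⟨⟨0, hd⟩⟩
    infer_instance
  have hfin : Module.finrank ℝ (E d) = d := by simp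
  set B : Set (E d) := (fun y ↦ x₀ + y) ⁻¹' A with hB
  have hBm : MeasurableSet B := hA.preimage (measurable_const_add x₀)
  have hBvol : volume B = volume A := measure_preimage_add volume x₀ A
  have hmp := (volume : Measure (E d)).measurePreserving_homeomorphUnitSphereProd
  set Φ := homeomorphUnitSphereProd (E d)
  set C : Set (({0}ᶜ : Set (E d))) := (↑) ⁻¹' B
  have hCm : MeasurableSet C := hBm.preimage measurable_subtype_coe
  have hCvol : (volume : Measure (E d)).comap (Subtype.val : ({0}ᶜ : Set (E d)) → E d) C = volume A := by
    rw [(MeasurableEmbedding.subtype_coe (measurableSet_singleton _).compl).comap_apply,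
      Subtype.image_preimage_coe, inter_comm, ← sdiff_eq, measure_sdiff_null (measure_singleton _), hBvol]
  have hDm : MeasurableSet (Φ.symm ⁻¹' C) := hCm.preimage Φ.symm.measurable
  have h1 : volume A = ((volume : Measure (E d)).toSphere.prod
      (Measure.volumeIoiPow (Module.finrank ℝ (E d) - 1))) (Φ.symm ⁻¹' C) := by
    rw [← hCvol, ← hmp.measure_preimage hDm.nullMeasurableSet]
    congr 1
    ext y
    simp [Φ]
  rw [Measure.prod_apply hDm, hfin] at h1
  have hslice : ∀ θ : Metric.sphere (0 : E d) 1,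
      (Measure.volumeIoiPow (d - 1)) (Prod.mk θ ⁻¹' (Φ.symm ⁻¹' C)) ≤
        ENNReal.ofReal (l ^ (d - 1)) * ENNReal.ofReal (γ / (2 * d) * l) := by
    intro θ
    have hm : MeasurableSet (Prod.mk θ ⁻¹' (Φ.symm ⁻¹' C)) := hDm.preimage measurable_prodMk_left
    have hmem : ∀ t ∈ Prod.mk θ ⁻¹' (Φ.symm ⁻¹' C), (t : ℝ) < l ∧ x₀ + (t : ℝ) • (θ : E d) ∈ A := by
      intro t ht
      have h2 : x₀ + (t : ℝ) • (θ : E d) ∈ A := by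
        simpa [C, B, Φ] using ht
      refine ⟨?_, h2⟩
      have h3 := hsub h2
      rw [Metric.mem_ball, dist_eq_norm, add_sub_cancel_left, norm_smul,
        norm_eq_of_mem_sphere θ, mul_one, Real.norm_eq_abs, abs_of_pos t.2] at h3
      exact h3
    rw [Measure.volumeIoiPow, withDensity_apply _ hm]
    calc ∫⁻ r in Prod.mk θ ⁻¹' (Φ.symm ⁻¹' C), ENNReal.ofReal ((r : ℝ) ^ (d - 1))
          ∂(Measure.comap Subtype.val volume)
        ≤ ∫⁻ _ in Prod.mk θ ⁻¹' (Φ.symm ⁻¹' C), ENNReal.ofReal (l ^ (d - 1))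
          ∂(Measure.comap Subtype.val volume) := by
          refine setLIntegral_mono measurable_const fun t ht ↦ ENNReal.ofReal_le_ofReal ?_
          exact pow_le_pow_left₀ (le_of_lt t.2) (hmem t ht).1.le _
      _ = ENNReal.ofReal (l ^ (d - 1)) *
          volume (Subtype.val '' (Prod.mk θ ⁻¹' (Φ.symm ⁻¹' C))) := by
          rw [setLIntegral_const, (MeasurableEmbedding.subtype_coe measurableSet_Ioi).comap_apply]
      _ ≤ _ := by
          gcongr
          refine (measure_mono ?_).trans (hcon θ (norm_eq_of_mem_sphere θ))
          rintro _ ⟨t, ht, rfl⟩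
          exact ⟨⟨t.2, (hmem t ht).1⟩, (hmem t ht).2⟩
  have h2 : volume A ≤ ENNReal.ofReal (l ^ (d - 1)) * ENNReal.ofReal (γ / (2 * d) * l) *
      (volume : Measure (E d)).toSphere univ := by
    rw [h1]
    refine (lintegral_mono hslice).trans ?_
    rw [lintegral_const]
  rw [Measure.toSphere_apply_univ, hfin, ← ENNReal.ofReal_mul (by positivity),
    ← ENNReal.ofReal_natCast, ← mul_assoc, ← ENNReal.ofReal_mul (by positivity)] at h2
  have hball : volume (Metric.ball x₀ l) =
      ENNReal.ofReal (l ^ d) * volume (Metric.ball (0 : E d) 1) := by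
    rw [Measure.addHaar_ball _ _ hl.le, hfin]
  rw [hball, ← mul_assoc, ← ENNReal.ofReal_mul hγ.le] at hvol
  have h3 := hvol.trans h2
  have h4 : volume (Metric.ball (0 : E d) 1) ≠ 0 := (Metric.measure_ball_pos _ _ one_pos).ne'
  have h5 : volume (Metric.ball (0 : E d) 1) ≠ ∞ := measure_ball_lt_top.ne
  rw [ENNReal.mul_le_mul_iff_left h4 h5] at h3
  have h6 : l ^ (d - 1) * (γ / (2 * d) * l) * d = γ * l ^ d / 2 := by
    obtain ⟨k, rfl⟩ : ∃ k, d = k + 1 := ⟨d - 1, by omega⟩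
    rw [Nat.add_sub_cancel, pow_succ]
    field_simp
  rw [h6, ENNReal.ofReal_le_ofReal_iff (by positivity)] at h3
  have : 0 < γ * l ^ d := by positivity
  linarith

/-! ### Ladder operators and the oscillator on Schwartz functions. -/

section

open scoped LineDeriv

theorem iteratedFDeriv_exp_neg_norm (i : ℕ) (s : ℝ) :
    ‖iteratedFDeriv ℝ i (fun s : ℝ ↦ Complex.exp (-(s : ℂ))) s‖ ≤ Real.exp (-s) := by
  rw [norm_iteratedFDeriv_eq_norm_iteratedDeriv]
  have : ∀ i : ℕ, iteratedDeriv i (fun s : ℝ ↦ Complex.exp (-(s : ℂ))) =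
      fun s : ℝ ↦ (-1) ^ i * Complex.exp (-(s : ℂ)) := by
    intro i
    induction i with
    | zero => simp
    | succ i ih =>
      rw [iteratedDeriv_succ, ih]
      funext s
      have h : HasDerivAt (fun s : ℝ ↦ Complex.exp (-(s : ℂ))) (Complex.exp (-(s : ℂ)) * -1) s :=
        (Complex.ofRealCLM.hasDerivAt (x := s)).neg.cexp
      rw [(h.const_mul _).deriv, pow_succ]
      ring
  rw [this, norm_mul, Complex.norm_exp]
  simp

theorem hasFDerivAt_half_norm_sq {d : ℕ} (x : E d) :
    HasFDerivAt (fun x : E d ↦ ‖x‖ ^ 2 / 2) (innerSL ℝ x) x := by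
  have h := (hasStrictFDerivAt_norm_sq x).hasFDerivAt.mul_const (1 / 2 : ℝ)
  have h2 : (fun x : E d ↦ ‖x‖ ^ 2 / 2) = fun x ↦ ‖x‖ ^ 2 * (1 / 2) := by funext; ring
  have h3 : (1 / 2 : ℝ) • 2 • innerSL ℝ x = innerSL ℝ x := by
    rw [← Nat.cast_smul_eq_nsmul ℝ, smul_smul]
    norm_num
  rw [h2, ← h3]
  exact h

/-- Bounds of the form D ^ i are what the estimate for derivatives of a composition requires; only
the orders one and two are nonzero. -/
theorem iteratedFDeriv_half_norm_sq_le {d : ℕ} (x : E d) (i : ℕ) (hi : 1 ≤ i) :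
    ‖iteratedFDeriv ℝ i (fun x : E d ↦ ‖x‖ ^ 2 / 2) x‖ ≤ (1 + ‖x‖) ^ i := by
  have hfd : fderiv ℝ (fun x : E d ↦ ‖x‖ ^ 2 / 2) = innerSL ℝ := by
    funext y
    exact (hasFDerivAt_half_norm_sq y).fderiv
  have hL : ∀ y : E d, ‖innerSL ℝ y‖ = ‖y‖ := fun y ↦ innerSL_apply_norm (𝕜 := ℝ) y
  have h0 : 0 ≤ ‖x‖ := norm_nonneg x
  obtain ⟨k, rfl⟩ : ∃ k, i = k + 1 := ⟨i - 1, by omega⟩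
  rw [← norm_iteratedFDeriv_fderiv, hfd]
  rcases k with _ | k
  · rw [norm_iteratedFDeriv_zero, hL]
    rw [zero_add, pow_one]
    linarith
  · rw [← norm_iteratedFDeriv_fderiv]
    have h1 : fderiv ℝ (fun y : E d ↦ innerSL ℝ y) = fun _ ↦ innerSL ℝ := by
      funext y
      exact (innerSL ℝ : E d →L[ℝ] E d →L[ℝ] ℝ).fderiv
    change ‖iteratedFDeriv ℝ k (fderiv ℝ (fun y : E d ↦ innerSL ℝ y)) x‖ ≤ _
    rw [h1]
    have hone : (1 : ℝ) ≤ (1 + ‖x‖) ^ (k + 1 + 1) := one_le_pow₀ (by linarith)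
    rcases k with _ | k
    · rw [norm_iteratedFDeriv_zero]
      refine le_trans ?_ hone
      refine ContinuousLinearMap.opNorm_le_bound _ zero_le_one fun y ↦ ?_
      rw [hL, one_mul]
    · rw [iteratedFDeriv_const_of_ne (by omega)]
      simp only [Pi.zero_apply, norm_zero]
      positivity

/-- The Gaussian `exp (-|x|² / 2)`, the ground state of the harmonic oscillator. -/
def gaussian (d : ℕ) : 𝓢(E d, ℂ) where
  toFun x := Complex.exp (-((‖x‖ ^ 2 / 2 : ℝ) : ℂ))
  smooth' := by
    have h : ContDiff ℝ (⊤ : ℕ∞) (fun x : E d ↦ (‖x‖ ^ 2 / 2 : ℝ)) :=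
      (contDiff_norm_sq ℝ).div_const 2
    exact (Complex.contDiff_exp (𝕜 := ℝ)).comp (Complex.ofRealCLM.contDiff.comp h).neg
  decay' := by
    intro k n
    -- The power is dominated by (k + n)! e^{1 + r}, and 1 + r - r²/2 ≤ 2, whence the constant (k +
    -- n)! e².
    have hbd : ∃ C, ∀ r : ℝ, 0 ≤ r → (1 + r) ^ (k + n) * Real.exp (-(r ^ 2 / 2)) ≤ C := by
      refine ⟨(k + n).factorial * Real.exp 1 * Real.exp 1, fun r hr ↦ ?_⟩
      have h1 := Real.pow_div_factorial_le_exp (1 + r) (by positivity) (k + n)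
      rw [div_le_iff₀ (by positivity)] at h1
      calc (1 + r) ^ (k + n) * Real.exp (-(r ^ 2 / 2))
          ≤ (Real.exp (1 + r) * (k + n).factorial) * Real.exp (-(r ^ 2 / 2)) := by gcongr
        _ = (k + n).factorial * Real.exp (1 + r + -(r ^ 2 / 2)) := by rw [Real.exp_add (1 + r)]; ring
        _ ≤ (k + n).factorial * Real.exp (1 + 1) := by
          refine mul_le_mul_of_nonneg_left (Real.exp_le_exp.mpr ?_) (by positivity)
          nlinarith [sq_nonneg (r - 1)]
        _ = _ := by rw [Real.exp_add]; ring
    obtain ⟨C, hC⟩ := hbd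
    refine ⟨n.factorial * C, fun x ↦ ?_⟩
    have hx := norm_nonneg x
    have h1 := norm_iteratedFDeriv_comp_le (𝕜 := ℝ) (n := n) (N := (⊤ : ℕ∞))
      (g := fun s : ℝ ↦ Complex.exp (-(s : ℂ))) (f := fun x : E d ↦ ‖x‖ ^ 2 / 2)
      ((Complex.contDiff_exp (𝕜 := ℝ)).comp Complex.ofRealCLM.contDiff.neg)
      ((contDiff_norm_sq ℝ).div_const 2) (by exact_mod_cast le_top) x
      (fun i _ ↦ iteratedFDeriv_exp_neg_norm i _)
      (fun i hi _ ↦ iteratedFDeriv_half_norm_sq_le x i hi)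
    calc ‖x‖ ^ k * ‖iteratedFDeriv ℝ n (fun x : E d ↦ Complex.exp (-((‖x‖ ^ 2 / 2 : ℝ) : ℂ))) x‖
        ≤ (1 + ‖x‖) ^ k * (n.factorial * Real.exp (-(‖x‖ ^ 2 / 2)) * (1 + ‖x‖) ^ n) := by
          gcongr
          · linarith
          · exact h1
      _ = n.factorial * ((1 + ‖x‖) ^ (k + n) * Real.exp (-(‖x‖ ^ 2 / 2))) := by
          rw [pow_add]; ring
      _ ≤ _ := by gcongr; exact hC _ hx

theorem gaussian_apply {d : ℕ} (x : E d) :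
    gaussian d x = Complex.exp (-((‖x‖ ^ 2 / 2 : ℝ) : ℂ)) := rfl

/-- Multiplication of Schwartz functions by a coordinate. -/
def coordMul {d : ℕ} (j : Fin d) : 𝓢(E d, ℂ) →ₗ[ℂ] 𝓢(E d, ℂ) :=
  (SchwartzMap.smulLeftCLM ℂ (fun x : E d ↦ ((x j : ℝ) : ℂ))).toLinearMap

theorem hasTemperateGrowth_coord {d : ℕ} (j : Fin d) :
    (fun x : E d ↦ ((x j : ℝ) : ℂ)).HasTemperateGrowth :=
  (Complex.ofRealCLM ∘L (EuclideanSpace.proj j : E d →L[ℝ] ℝ)).hasTemperateGrowth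

theorem coordMul_apply {d : ℕ} (j : Fin d) (f : 𝓢(E d, ℂ)) (x : E d) :
    coordMul j f x = (x j : ℂ) * f x := by
  change SchwartzMap.smulLeftCLM ℂ (fun x : E d ↦ ((x j : ℝ) : ℂ)) f x = _
  rw [SchwartzMap.smulLeftCLM_apply_apply (hasTemperateGrowth_coord j), smul_eq_mul]

/-- The directional derivative on Schwartz functions. -/
def dirDeriv {d : ℕ} (v : E d) : 𝓢(E d, ℂ) →ₗ[ℂ] 𝓢(E d, ℂ) :=
  (LineDeriv.lineDerivOpCLM ℂ 𝓢(E d, ℂ) v).toLinearMap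

theorem dirDeriv_apply {d : ℕ} (v : E d) (f : 𝓢(E d, ℂ)) (x : E d) :
    dirDeriv v f x = fderiv ℝ f x v := rfl

/-- The partial derivative on Schwartz functions. -/
def partialDeriv {d : ℕ} (j : Fin d) : 𝓢(E d, ℂ) →ₗ[ℂ] 𝓢(E d, ℂ) :=
  dirDeriv (EuclideanSpace.basisFun (Fin d) ℝ j)

theorem dirDeriv_eq_sum {d : ℕ} (v : E d) (f : 𝓢(E d, ℂ)) :
    dirDeriv v f = ∑ j, (v j : ℂ) • partialDeriv j f := by
  ext x
  have h : v = ∑ j, v j • EuclideanSpace.basisFun (Fin d) ℝ j := by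
    conv_lhs => rw [← (EuclideanSpace.basisFun (Fin d) ℝ).sum_repr v]
    simp
  rw [_root_.sum_apply, dirDeriv_apply]
  conv_lhs => rw [h]
  rw [map_sum]
  refine Finset.sum_congr rfl fun j _ ↦ ?_
  rw [map_smul, _root_.smul_apply, partialDeriv, dirDeriv_apply]
  simp

theorem partialDeriv_coordMul {d : ℕ} (j k : Fin d) (f : 𝓢(E d, ℂ)) :
    partialDeriv j (coordMul k f) = coordMul k (partialDeriv j f) + if j = k then f else 0 := by
  ext x
  have hc : HasFDerivAt (fun x : E d ↦ ((x k : ℝ) : ℂ))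
      (Complex.ofRealCLM ∘L (EuclideanSpace.proj k : E d →L[ℝ] ℝ)) x :=
    (Complex.ofRealCLM ∘L (EuclideanSpace.proj k : E d →L[ℝ] ℝ)).hasFDerivAt
  have hf : HasFDerivAt f (fderiv ℝ f x) x := f.differentiableAt.hasFDerivAt
  have hfun : (coordMul k f : E d → ℂ) = fun x ↦ (x k : ℂ) * f x := funext fun x ↦ coordMul_apply k f x
  have h : fderiv ℝ (fun x : E d ↦ (x k : ℂ) * f x) x = _ := (hc.mul hf).fderiv
  rw [partialDeriv, dirDeriv_apply, hfun, h, _root_.add_apply, _root_.add_apply, coordMul_apply,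
    dirDeriv_apply]
  by_cases hjk : j = k
  · subst hjk
    simp
  · simp [hjk, Ne.symm hjk]

theorem coordMul_comm {d : ℕ} (j k : Fin d) (f : 𝓢(E d, ℂ)) :
    coordMul j (coordMul k f) = coordMul k (coordMul j f) := by
  ext x
  simp only [coordMul_apply]
  ring

/-- The annihilation operator `∂_j + x_j`. -/
def annihilation {d : ℕ} (j : Fin d) : 𝓢(E d, ℂ) →ₗ[ℂ] 𝓢(E d, ℂ) := partialDeriv j + coordMul j

theorem annihilation_apply {d : ℕ} (j : Fin d) (f : 𝓢(E d, ℂ)) :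
    annihilation j f = partialDeriv j f + coordMul j f := rfl

theorem annihilation_coordMul {d : ℕ} (j k : Fin d) (f : 𝓢(E d, ℂ)) :
    annihilation j (coordMul k f) = coordMul k (annihilation j f) + if j = k then f else 0 := by
  rw [annihilation_apply, annihilation_apply, partialDeriv_coordMul, coordMul_comm, map_add]
  abel

theorem annihilation_gaussian {d : ℕ} (j : Fin d) : annihilation j (gaussian d) = 0 := by
  ext x
  have h3 : HasFDerivAt (gaussian d) _ x :=
    ((Complex.ofRealCLM.hasFDerivAt.comp x (hasFDerivAt_half_norm_sq x)).neg).cexp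
  rw [annihilation_apply, _root_.add_apply, partialDeriv, dirDeriv_apply, h3.fderiv,
    coordMul_apply, gaussian_apply]
  have h4 : inner ℝ x (EuclideanSpace.basisFun (Fin d) ℝ j) = x j := by
    rw [real_inner_comm, ← (EuclideanSpace.basisFun (Fin d) ℝ).repr_apply_apply]
    simp
  simp only [_root_.smul_apply, _root_.neg_apply,
    ContinuousLinearMap.comp_apply, innerSL_apply_apply, h4, Complex.ofRealCLM_apply, smul_eq_mul,
    Pi.neg_apply, Function.comp_apply, zero_apply]
  ring

/-- The harmonic oscillator on Schwartz functions. -/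
def schwartzOscillator (d : ℕ) : 𝓢(E d, ℂ) →ₗ[ℂ] 𝓢(E d, ℂ) where
  toFun f := -Δ f + SchwartzMap.smulLeftCLM ℂ (fun x : E d ↦ ((‖x‖ ^ 2 : ℝ) : ℂ)) f
  map_add' f g := by
    simp only [← SchwartzMap.laplacianCLM_eq ℂ, map_add]
    abel
  map_smul' c f := by
    simp only [← SchwartzMap.laplacianCLM_eq ℂ, map_smul, smul_add, smul_neg, RingHom.id_apply]

theorem hasTemperateGrowth_norm_sq (d : ℕ) :
    (fun x : E d ↦ ((‖x‖ ^ 2 : ℝ) : ℂ)).HasTemperateGrowth := by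
  fun_prop

theorem schwartzOscillator_eq_sum {d : ℕ} (f : 𝓢(E d, ℂ)) :
    schwartzOscillator d f =
      ∑ j, (coordMul j (coordMul j f) - partialDeriv j (partialDeriv j f)) := by
  change -Δ f + SchwartzMap.smulLeftCLM ℂ (fun x : E d ↦ ((‖x‖ ^ 2 : ℝ) : ℂ)) f = _
  rw [Finset.sum_sub_distrib, SchwartzMap.laplacian_eq_sum (EuclideanSpace.basisFun (Fin d) ℝ),
    neg_add_eq_sub]
  congr 1
  ext x
  rw [SchwartzMap.smulLeftCLM_apply_apply (hasTemperateGrowth_norm_sq d), _root_.sum_apply]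
  simp only [coordMul_apply, smul_eq_mul]
  rw [EuclideanSpace.norm_sq_eq]
  push_cast
  rw [Finset.sum_mul]
  refine Finset.sum_congr rfl fun j _ ↦ ?_
  rw [Real.norm_eq_abs, ← Complex.ofReal_pow, sq_abs]
  push_cast
  ring

/-- The commutator of H with x_k is -2 ∂_k, written as 2 x_k minus twice the annihilation operator.
In this form it shows that multiplication by x_k raises the eigenvalue by 2, up to a term of lower
degree. -/
theorem schwartzOscillator_coordMul {d : ℕ} (k : Fin d) (f : 𝓢(E d, ℂ)) :
    schwartzOscillator d (coordMul k f) =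
      coordMul k (schwartzOscillator d f) + (2 : ℂ) • coordMul k f - (2 : ℂ) • annihilation k f := by
  have h : ∀ j, coordMul j (coordMul j (coordMul k f)) -
      partialDeriv j (partialDeriv j (coordMul k f)) =
      coordMul k (coordMul j (coordMul j f) - partialDeriv j (partialDeriv j f)) +
        if j = k then -(2 : ℂ) • partialDeriv k f else 0 := by
    intro j
    rw [coordMul_comm j k f, coordMul_comm j k, partialDeriv_coordMul, map_add,
      partialDeriv_coordMul, map_sub]
    by_cases hjk : j = k
    · subst hjk
      simp only [if_true]
      module
    · simp [hjk]
  rw [schwartzOscillator_eq_sum, Finset.sum_congr rfl fun j _ ↦ h j, Finset.sum_add_distrib,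
    ← map_sum, ← schwartzOscillator_eq_sum, Finset.sum_ite_eq' Finset.univ k, annihilation_apply]
  simp only [Finset.mem_univ, if_true]
  module

/-- The factorization of H into creation and annihilation operators, with zero-point energy d. It
gives the ground state at once. -/
theorem schwartzOscillator_eq_sum_annihilation {d : ℕ} (f : 𝓢(E d, ℂ)) :
    schwartzOscillator d f = (d : ℂ) • f +
      ∑ j, (coordMul j (annihilation j f) - partialDeriv j (annihilation j f)) := by
  have h : ∀ j : Fin d, coordMul j (annihilation j f) - partialDeriv j (annihilation j f) =
      (coordMul j (coordMul j f) - partialDeriv j (partialDeriv j f)) - f := by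
    intro j
    rw [annihilation_apply, map_add, map_add, partialDeriv_coordMul, if_pos rfl]
    module
  rw [Finset.sum_congr rfl fun j _ ↦ h j, Finset.sum_sub_distrib, ← schwartzOscillator_eq_sum]
  simp only [Finset.sum_const, Finset.card_univ, Fintype.card_fin]
  rw [← Nat.cast_smul_eq_nsmul ℂ]
  module

end

/-! ### Hermite spaces, eigenfunctions and Bernstein inequalities. -/

section

open scoped LineDeriv

/-- The space of products of the Gaussian with polynomials of degree less than `n`. -/
def hermiteSpace (d : ℕ) : ℕ → Submodule ℂ 𝓢(E d, ℂ)
  | 0 => ⊥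
  | n + 1 => (Submodule.span ℂ {gaussian d} ⊔ hermiteSpace d n) ⊔
      ⨆ j, (hermiteSpace d n).map (coordMul j)

/-- Serves as the induction principle: taking for K the preimage of a subspace under a linear
operator reduces mapping properties to the Gaussian and to commutation with the coordinates. -/
theorem hermiteSpace_succ_le_iff {d n : ℕ} {K : Submodule ℂ 𝓢(E d, ℂ)} :
    hermiteSpace d (n + 1) ≤ K ↔ gaussian d ∈ K ∧ hermiteSpace d n ≤ K ∧
      ∀ j, ∀ f ∈ hermiteSpace d n, coordMul j f ∈ K := by
  rw [hermiteSpace, sup_le_iff, sup_le_iff, Submodule.span_singleton_le_iff_mem, iSup_le_iff, and_assoc]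
  simp only [Submodule.map_le_iff_le_comap]
  rfl

theorem gaussian_mem_hermiteSpace (d n : ℕ) : gaussian d ∈ hermiteSpace d (n + 1) :=
  (hermiteSpace_succ_le_iff.mp le_rfl).1

theorem hermiteSpace_mono (d : ℕ) : Monotone (hermiteSpace d) :=
  monotone_nat_of_le_succ fun _ ↦ (hermiteSpace_succ_le_iff.mp le_rfl).2.1

theorem coordMul_mem_hermiteSpace {d n : ℕ} (j : Fin d) {f : 𝓢(E d, ℂ)} (hf : f ∈ hermiteSpace d n) :
    coordMul j f ∈ hermiteSpace d (n + 1) :=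
  (hermiteSpace_succ_le_iff.mp le_rfl).2.2 j f hf

instance finiteDimensional_hermiteSpace (d n : ℕ) : FiniteDimensional ℂ (hermiteSpace d n) := by
  induction n with
  | zero => rw [hermiteSpace]; infer_instance
  | succ n ih => rw [hermiteSpace]; infer_instance

/-- The annihilation operator kills the Gaussian and differentiates the polynomial factor, hence
lowers the degree. Truncated subtraction is harmless since the space of index 0 is trivial. -/
theorem annihilation_mem_hermiteSpace {d n : ℕ} (j : Fin d) {f : 𝓢(E d, ℂ)}
    (hf : f ∈ hermiteSpace d n) : annihilation j f ∈ hermiteSpace d (n - 1) := by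
  induction n generalizing f with
  | zero =>
    rw [hermiteSpace, Submodule.mem_bot] at hf
    simp [hf]
  | succ n ih =>
    suffices h : hermiteSpace d (n + 1) ≤ (hermiteSpace d n).comap (annihilation j) from h hf
    rw [hermiteSpace_succ_le_iff]
    refine ⟨by simp [annihilation_gaussian], fun g hg ↦ ?_, fun k g hg ↦ ?_⟩
    · exact hermiteSpace_mono d (Nat.sub_le _ _) (ih hg)
    · rw [Submodule.mem_comap, annihilation_coordMul]
      refine add_mem ?_ (by split_ifs <;> simp [hg])
      rcases n with _ | n
      · rw [hermiteSpace, Submodule.mem_bot] at hg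
        simp [hg]
      · exact coordMul_mem_hermiteSpace k (ih hg)

theorem partialDeriv_mem_hermiteSpace {d n : ℕ} (j : Fin d) {f : 𝓢(E d, ℂ)}
    (hf : f ∈ hermiteSpace d n) : partialDeriv j f ∈ hermiteSpace d (n + 1) := by
  have h : partialDeriv j f = annihilation j f - coordMul j f := by
    rw [annihilation_apply, add_sub_cancel_right]
  rw [h]
  exact sub_mem (hermiteSpace_mono d (by omega) (annihilation_mem_hermiteSpace j hf))
    (coordMul_mem_hermiteSpace j hf)

theorem dirDeriv_mem_hermiteSpace {d n : ℕ} (v : E d) {f : 𝓢(E d, ℂ)}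
    (hf : f ∈ hermiteSpace d n) : dirDeriv v f ∈ hermiteSpace d (n + 1) := by
  rw [dirDeriv_eq_sum]
  exact sum_mem fun j _ ↦ Submodule.smul_mem _ _ (partialDeriv_mem_hermiteSpace j hf)

theorem schwartzOscillator_gaussian (d : ℕ) :
    schwartzOscillator d (gaussian d) = (d : ℂ) • gaussian d := by
  rw [schwartzOscillator_eq_sum_annihilation]
  simp [annihilation_gaussian]

/-- H is triangular with respect to the degree: index n + 1 means degree at most n, and the diagonal
entry in degree n is 2 n + d. Each factor x_k adds 2 by `schwartzOscillator_coordMul`. -/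
theorem schwartzOscillator_sub_mem {d n : ℕ} {f : 𝓢(E d, ℂ)} (hf : f ∈ hermiteSpace d (n + 1)) :
    schwartzOscillator d f - (2 * n + d : ℂ) • f ∈ hermiteSpace d n := by
  induction n generalizing f with
  | zero =>
    suffices h : hermiteSpace d (0 + 1) ≤ (hermiteSpace d 0).comap
      (schwartzOscillator d - (2 * (0 : ℕ) + d : ℂ) • LinearMap.id) from h hf
    rw [hermiteSpace_succ_le_iff]
    refine ⟨by simp [schwartzOscillator_gaussian], fun g hg ↦ ?_, fun k g hg ↦ ?_⟩ <;>
    · rw [hermiteSpace, Submodule.mem_bot] at hg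
      simp [hg]
  | succ n ih =>
    suffices h : hermiteSpace d (n + 1 + 1) ≤ (hermiteSpace d (n + 1)).comap
      (schwartzOscillator d - (2 * (n + 1 : ℕ) + d : ℂ) • LinearMap.id) from h hf
    rw [hermiteSpace_succ_le_iff]
    refine ⟨?_, fun g hg ↦ ?_, fun k g hg ↦ ?_⟩
    · have h : schwartzOscillator d (gaussian d) - (2 * (n + 1 : ℕ) + d : ℂ) • gaussian d =
          (-(2 * (n + 1 : ℕ)) : ℂ) • gaussian d := by
        rw [schwartzOscillator_gaussian]; module
      change schwartzOscillator d (gaussian d) - (2 * (n + 1 : ℕ) + d : ℂ) • gaussian d ∈ hermiteSpace d (n + 1)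
      rw [h]
      exact Submodule.smul_mem _ _ (gaussian_mem_hermiteSpace d n)
    · have h : schwartzOscillator d g - (2 * (n + 1 : ℕ) + d : ℂ) • g =
          (schwartzOscillator d g - (2 * n + d : ℂ) • g) - (2 : ℂ) • g := by
        push_cast; module
      change schwartzOscillator d g - (2 * (n + 1 : ℕ) + d : ℂ) • g ∈ hermiteSpace d (n + 1)
      rw [h]
      exact sub_mem (hermiteSpace_mono d (Nat.le_succ n) (ih hg)) (Submodule.smul_mem _ _ hg)
    · have h : schwartzOscillator d (coordMul k g) - (2 * (n + 1 : ℕ) + d : ℂ) • coordMul k g =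
          coordMul k (schwartzOscillator d g - (2 * n + d : ℂ) • g) -
            (2 : ℂ) • annihilation k g := by
        rw [schwartzOscillator_coordMul, map_sub, map_smul]
        push_cast
        module
      change schwartzOscillator d (coordMul k g) - (2 * (n + 1 : ℕ) + d : ℂ) • coordMul k g ∈ hermiteSpace d (n + 1)
      rw [h]
      refine sub_mem (coordMul_mem_hermiteSpace k (ih hg)) (Submodule.smul_mem _ _ ?_)
      exact hermiteSpace_mono d (Nat.le_succ n) (annihilation_mem_hermiteSpace k hg)

theorem schwartzOscillator_mem_hermiteSpace {d n : ℕ} {f : 𝓢(E d, ℂ)} (hf : f ∈ hermiteSpace d n) :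
    schwartzOscillator d f ∈ hermiteSpace d n := by
  rcases n with _ | n
  · rw [hermiteSpace, Submodule.mem_bot] at hf
    simp [hf]
  · have h := hermiteSpace_mono d (Nat.le_succ n) (schwartzOscillator_sub_mem hf)
    simpa using add_mem h (Submodule.smul_mem _ (2 * n + d : ℂ) hf)

/-- The inclusion of Schwartz functions into `L²`. -/
def toL2 (d : ℕ) : 𝓢(E d, ℂ) →ₗ[ℂ] L2 d :=
  (SchwartzMap.toLpCLM ℂ ℂ 2 (volume : Measure (E d))).toLinearMap

theorem toL2_eq {d : ℕ} (f : 𝓢(E d, ℂ)) : toL2 d f = f.toLp 2 := rfl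

theorem toL2_injective (d : ℕ) : Function.Injective (toL2 d) :=
  SchwartzMap.injective_toLp 2 volume

theorem inner_toL2 {d : ℕ} (f g : 𝓢(E d, ℂ)) :
    inner ℂ (toL2 d f) (toL2 d g) = ∫ x, inner ℂ (f x) (g x) :=
  SchwartzMap.inner_toL2_toL2_eq f g

theorem inner_coordMul_left {d : ℕ} (j : Fin d) (f g : 𝓢(E d, ℂ)) :
    inner ℂ (toL2 d (coordMul j f)) (toL2 d g) = inner ℂ (toL2 d f) (toL2 d (coordMul j g)) := by
  rw [inner_toL2, inner_toL2]
  congr 1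
  funext x
  simp only [coordMul_apply, RCLike.inner_apply, map_mul, Complex.conj_ofReal]
  ring

theorem inner_dirDeriv_left {d : ℕ} (v : E d) (f g : 𝓢(E d, ℂ)) :
    inner ℂ (toL2 d (dirDeriv v f)) (toL2 d g) = -inner ℂ (toL2 d f) (toL2 d (dirDeriv v g)) := by
  rw [inner_toL2, inner_toL2]
  have h := SchwartzMap.integral_bilinear_lineDerivOp_right_eq_neg_left (μ := volume) f g
    ((ContinuousLinearMap.mul ℝ ℂ).comp (Complex.conjCLE : ℂ →L[ℝ] ℂ)) v
  simp only [RCLike.inner_apply']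
  rw [eq_neg_iff_add_eq_zero, add_comm, ← eq_neg_iff_add_eq_zero]
  exact h

theorem inner_partialDeriv_left {d : ℕ} (j : Fin d) (f g : 𝓢(E d, ℂ)) :
    inner ℂ (toL2 d (partialDeriv j f)) (toL2 d g) =
      -inner ℂ (toL2 d f) (toL2 d (partialDeriv j g)) :=
  inner_dirDeriv_left _ f g

theorem inner_schwartzOscillator_left {d : ℕ} (f g : 𝓢(E d, ℂ)) :
    inner ℂ (toL2 d (schwartzOscillator d f)) (toL2 d g) =
      inner ℂ (toL2 d f) (toL2 d (schwartzOscillator d g)) := by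
  simp only [schwartzOscillator_eq_sum, map_sum, map_sub, sum_inner, inner_sum, inner_sub_left,
    inner_sub_right, inner_coordMul_left, inner_partialDeriv_left, neg_neg]

/-- The energy identity. It is the source of both the derivative bounds and the spatial
localization. -/
theorem re_inner_schwartzOscillator {d : ℕ} (f : 𝓢(E d, ℂ)) :
    (inner ℂ (toL2 d f) (toL2 d (schwartzOscillator d f))).re =
      ∑ j, (‖toL2 d (coordMul j f)‖ ^ 2 + ‖toL2 d (partialDeriv j f)‖ ^ 2) := by
  have h : inner ℂ (toL2 d f) (toL2 d (schwartzOscillator d f)) =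
      ∑ j, (inner ℂ (toL2 d (coordMul j f)) (toL2 d (coordMul j f)) +
        inner ℂ (toL2 d (partialDeriv j f)) (toL2 d (partialDeriv j f))) := by
    simp only [schwartzOscillator_eq_sum, map_sum, map_sub, inner_sum,
      inner_sub_right, inner_coordMul_left, inner_partialDeriv_left]
    simp only [sub_eq_add_neg]
  rw [h, Complex.re_sum]
  refine Finset.sum_congr rfl fun j _ ↦ ?_
  rw [inner_self_eq_norm_sq_to_K, inner_self_eq_norm_sq_to_K, Complex.add_re]
  norm_cast

/-- The image of `hermiteSpace` in `L²`. -/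
def hermiteL2 (d n : ℕ) : Submodule ℂ (L2 d) := (hermiteSpace d n).map (toL2 d)

instance finiteDimensional_hermiteL2 (d n : ℕ) : FiniteDimensional ℂ (hermiteL2 d n) := by
  rw [hermiteL2]; infer_instance

theorem hermiteL2_mono (d : ℕ) : Monotone (hermiteL2 d) :=
  fun _ _ h ↦ Submodule.map_mono (hermiteSpace_mono d h)

/-- A function of degree at most `n` that is orthogonal to all functions of lower degree is an
eigenfunction. -/
theorem schwartzOscillator_eq_of_orthogonal {d n : ℕ} {f : 𝓢(E d, ℂ)}
    (hf : f ∈ hermiteSpace d (n + 1)) (horth : toL2 d f ∈ (hermiteL2 d n)ᗮ) :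
    schwartzOscillator d f = (2 * n + d : ℂ) • f := by
  rw [← sub_eq_zero]
  apply toL2_injective d
  rw [map_zero, ← inner_self_eq_zero (𝕜 := ℂ)]
  set r := schwartzOscillator d f - (2 * n + d : ℂ) • f with hr
  have hrm : r ∈ hermiteSpace d n := schwartzOscillator_sub_mem hf
  have h0 : ∀ v ∈ hermiteSpace d n, inner ℂ (toL2 d v) (toL2 d f) = 0 := fun v hv ↦
    (Submodule.mem_orthogonal _ _).mp horth _ (Submodule.mem_map_of_mem hv)
  -- H is symmetric and preserves the lower space containing the remainder r. Hence H f, like f, is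
  -- orthogonal to r, and so is r itself.
  have h1 : inner ℂ (toL2 d r) (toL2 d (schwartzOscillator d f)) = 0 := by
    rw [← inner_schwartzOscillator_left]
    exact h0 _ (schwartzOscillator_mem_hermiteSpace hrm)
  have h2 : toL2 d r = toL2 d (schwartzOscillator d f) - (2 * n + d : ℂ) • toL2 d f := by
    rw [hr, map_sub, map_smul]
  conv_lhs => rw [show inner ℂ (toL2 d r) (toL2 d r) = inner ℂ (toL2 d r)
    (toL2 d (schwartzOscillator d f) - (2 * n + d : ℂ) • toL2 d f) by rw [← h2]]
  rw [inner_sub_right, inner_smul_right, h1, h0 r hrm]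
  simp

/-- Every function of degree at most `n` is the sum of a function of lower degree and of an
eigenfunction orthogonal to it. -/
theorem exists_hermite_decomposition {d n : ℕ} {f : 𝓢(E d, ℂ)} (hf : f ∈ hermiteSpace d (n + 1)) :
    ∃ g ∈ hermiteSpace d n, ∃ w ∈ hermiteSpace d (n + 1), f = g + w ∧
      toL2 d w ∈ (hermiteL2 d n)ᗮ ∧ schwartzOscillator d w = (2 * n + d : ℂ) • w := by
  obtain ⟨g, hg, hgf⟩ := (hermiteL2 d n).starProjection_apply_mem (toL2 d f)
  have hw : f - g ∈ hermiteSpace d (n + 1) := sub_mem hf (hermiteSpace_mono d (Nat.le_succ n) hg)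
  have horth : toL2 d (f - g) ∈ (hermiteL2 d n)ᗮ := by
    rw [map_sub, hgf]
    exact Submodule.sub_starProjection_mem_orthogonal _
  exact ⟨g, hg, f - g, hw, by abel, horth, schwartzOscillator_eq_of_orthogonal hw horth⟩

/-- Peel off the component of top degree: it is an eigenfunction with eigenvalue 2 n + d, the cross
terms vanish, and the rest has smaller eigenvalues by induction. -/
theorem re_inner_schwartzOscillator_le {d n : ℕ} {f : 𝓢(E d, ℂ)} (hf : f ∈ hermiteSpace d (n + 1)) :
    (inner ℂ (toL2 d f) (toL2 d (schwartzOscillator d f))).re ≤ (2 * n + d) * ‖toL2 d f‖ ^ 2 := by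
  induction n generalizing f with
  | zero =>
    obtain ⟨g, hg, w, hw, rfl, horth, hHw⟩ := exists_hermite_decomposition hf
    rw [hermiteSpace, Submodule.mem_bot] at hg
    subst hg
    rw [zero_add, hHw, map_smul, inner_smul_right, inner_self_eq_norm_sq_to_K]
    have h5 : (2 * (0 : ℕ) + d : ℂ) * (‖toL2 d w‖ : ℂ) ^ 2 =
        (((2 * (0 : ℕ) + d) * ‖toL2 d w‖ ^ 2 : ℝ) : ℂ) := by
      push_cast
      rfl
    exact (congrArg Complex.re h5).le
  | succ n ih =>
    obtain ⟨g, hg, w, hw, rfl, horth, hHw⟩ := exists_hermite_decomposition hf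
    have h0 : ∀ v ∈ hermiteSpace d (n + 1), inner ℂ (toL2 d v) (toL2 d w) = 0 := fun v hv ↦
      (Submodule.mem_orthogonal _ _).mp horth _ (Submodule.mem_map_of_mem hv)
    have h1 : inner ℂ (toL2 d w) (toL2 d (schwartzOscillator d g)) = 0 := by
      rw [← inner_conj_symm, h0 _ (schwartzOscillator_mem_hermiteSpace hg), map_zero]
    have h2 := ih hg
    have hnorm : ‖toL2 d (g + w)‖ ^ 2 = ‖toL2 d g‖ ^ 2 + ‖toL2 d w‖ ^ 2 := by
      rw [map_add, sq, sq, sq]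
      exact norm_add_sq_eq_norm_sq_add_norm_sq_of_inner_eq_zero _ _ (h0 g hg)
    have h3 : (inner ℂ (toL2 d (g + w)) (toL2 d (schwartzOscillator d (g + w)))).re =
        (inner ℂ (toL2 d g) (toL2 d (schwartzOscillator d g))).re +
          (2 * (n + 1 : ℕ) + d) * ‖toL2 d w‖ ^ 2 := by
      have h4 : inner ℂ (toL2 d (g + w)) (toL2 d (schwartzOscillator d (g + w))) =
          inner ℂ (toL2 d g) (toL2 d (schwartzOscillator d g)) +
          (((2 * (n + 1 : ℕ) + d) * ‖toL2 d w‖ ^ 2 : ℝ) : ℂ) := by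
        rw [map_add, map_add, map_add, inner_add_left, inner_add_right, inner_add_right, h1, hHw,
          map_smul, inner_smul_right, inner_smul_right, h0 g hg, inner_self_eq_norm_sq_to_K]
        push_cast
        simp
      rw [h4, Complex.add_re, Complex.ofReal_re]
    rw [h3, hnorm]
    push_cast
    nlinarith [sq_nonneg ‖toL2 d g‖]

theorem sum_norm_sq_le {d n : ℕ} {f : 𝓢(E d, ℂ)} (hf : f ∈ hermiteSpace d (n + 1)) :
    ∑ j, (‖toL2 d (coordMul j f)‖ ^ 2 + ‖toL2 d (partialDeriv j f)‖ ^ 2) ≤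
      (2 * n + d) * ‖toL2 d f‖ ^ 2 := by
  rw [← re_inner_schwartzOscillator]
  exact re_inner_schwartzOscillator_le hf

theorem norm_partialDeriv_le {d n : ℕ} {f : 𝓢(E d, ℂ)} (hf : f ∈ hermiteSpace d (n + 1)) (j : Fin d) :
    ‖toL2 d (partialDeriv j f)‖ ≤ √(2 * n + d) * ‖toL2 d f‖ := by
  refine abs_le_of_sq_le_sq' ?_ (by positivity) |>.2
  rw [mul_pow, Real.sq_sqrt (by positivity)]
  refine le_trans ?_ (sum_norm_sq_le hf)
  refine le_trans ?_ (Finset.single_le_sum (fun i _ ↦ by positivity) (Finset.mem_univ j))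
  nlinarith [sq_nonneg ‖toL2 d (coordMul j f)‖]

theorem norm_dirDeriv_le {d n : ℕ} {f : 𝓢(E d, ℂ)} (hf : f ∈ hermiteSpace d (n + 1)) {v : E d}
    (hv : ‖v‖ ≤ 1) : ‖toL2 d (dirDeriv v f)‖ ≤ d * √(2 * n + d) * ‖toL2 d f‖ := by
  rw [dirDeriv_eq_sum, map_sum]
  refine (norm_sum_le _ _).trans ?_
  have h : ∀ j ∈ Finset.univ, ‖toL2 d ((v j : ℂ) • partialDeriv j f)‖ ≤
      √(2 * n + d) * ‖toL2 d f‖ := by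
    intro j _
    rw [map_smul, norm_smul, Complex.norm_real]
    calc ‖v j‖ * ‖toL2 d (partialDeriv j f)‖ ≤ 1 * (√(2 * n + d) * ‖toL2 d f‖) := by
          gcongr
          · exact (PiLp.norm_apply_le v j).trans hv
          · exact norm_partialDeriv_le hf j
      _ = _ := one_mul _
  refine (Finset.sum_le_sum h).trans (le_of_eq ?_)
  simp
  ring

/-- Bernstein inequality for iterated directional derivatives. -/
theorem norm_iterate_dirDeriv_le {d n : ℕ} {f : 𝓢(E d, ℂ)} (hf : f ∈ hermiteSpace d (n + 1))
    {v : E d} (hv : ‖v‖ ≤ 1) (m : ℕ) :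
    (dirDeriv v)^[m] f ∈ hermiteSpace d (n + m + 1) ∧
      ‖toL2 d ((dirDeriv v)^[m] f)‖ ≤ (d * √(2 * (n + m) + d)) ^ m * ‖toL2 d f‖ := by
  -- Each derivative raises the degree by one. With m fixed, every factor is bounded by the one for
  -- the final degree.
  have key : ∀ k ≤ m, (dirDeriv v)^[k] f ∈ hermiteSpace d (n + k + 1) ∧
      ‖toL2 d ((dirDeriv v)^[k] f)‖ ≤ (d * √(2 * (n + m) + d)) ^ k * ‖toL2 d f‖ := by
    intro k
    induction k with
    | zero => intro _; simpa using hf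
    | succ k ih =>
      intro hk
      obtain ⟨h1, h2⟩ := ih (by omega)
      rw [Function.iterate_succ_apply']
      refine ⟨dirDeriv_mem_hermiteSpace v h1, (norm_dirDeriv_le h1 hv).trans ?_⟩
      have hk' : (k : ℝ) ≤ m := by exact_mod_cast (by omega : k ≤ m)
      rw [pow_succ']
      push_cast
      calc d * √(2 * (n + k) + d) * ‖toL2 d ((dirDeriv v)^[k] f)‖
          ≤ d * √(2 * (n + m) + d) * ((d * √(2 * (n + m) + d)) ^ k * ‖toL2 d f‖) := by gcongr
        _ = _ := by ring
  exact key m le_rfl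

end

/-! ### Completeness of the Hermite functions. -/

section

open scoped LineDeriv FourierTransform

/-- Multiplication of Schwartz functions by `⟨ξ, x⟩`. -/
def linearMul {d : ℕ} (ξ : E d) : 𝓢(E d, ℂ) →ₗ[ℂ] 𝓢(E d, ℂ) := ∑ j, (ξ j : ℂ) • coordMul j

theorem linearMul_apply {d : ℕ} (ξ : E d) (f : 𝓢(E d, ℂ)) (x : E d) :
    linearMul ξ f x = (inner ℝ x ξ : ℝ) * f x := by
  rw [linearMul, LinearMap.sum_apply, _root_.sum_apply, PiLp.inner_apply]
  push_cast
  rw [Finset.sum_mul]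
  refine Finset.sum_congr rfl fun j _ ↦ ?_
  rw [LinearMap.smul_apply, _root_.smul_apply, coordMul_apply]
  simp
  ring

theorem linearMul_mem_hermiteSpace {d n : ℕ} (ξ : E d) {f : 𝓢(E d, ℂ)} (hf : f ∈ hermiteSpace d n) :
    linearMul ξ f ∈ hermiteSpace d (n + 1) := by
  rw [linearMul, LinearMap.sum_apply]
  exact sum_mem fun j _ ↦ Submodule.smul_mem _ _ (coordMul_mem_hermiteSpace j hf)

theorem iterate_linearMul_gaussian_mem {d : ℕ} (ξ : E d) (k : ℕ) :
    (linearMul ξ)^[k] (gaussian d) ∈ hermiteSpace d (k + 1) := by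
  induction k with
  | zero => exact gaussian_mem_hermiteSpace d 0
  | succ k ih =>
    rw [Function.iterate_succ_apply']
    exact linearMul_mem_hermiteSpace ξ ih

theorem iterate_linearMul_gaussian_apply {d : ℕ} (ξ : E d) (k : ℕ) (x : E d) :
    (linearMul ξ)^[k] (gaussian d) x = (inner ℝ x ξ : ℝ) ^ k * gaussian d x := by
  induction k with
  | zero => simp
  | succ k ih =>
    rw [Function.iterate_succ_apply', linearMul_apply, ih]
    ring

theorem gaussian_eq_ofReal {d : ℕ} (x : E d) :
    gaussian d x = ((Real.exp (-(‖x‖ ^ 2 / 2)) : ℝ) : ℂ) := by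
  rw [gaussian_apply]
  push_cast
  rfl

theorem inner_toL2_left {d : ℕ} (f : 𝓢(E d, ℂ)) (u : L2 d) :
    inner ℂ (toL2 d f) u = ∫ x, (starRingEnd ℂ) (f x) * u x := by
  rw [L2.inner_def]
  refine integral_congr_ae ?_
  filter_upwards [f.coeFn_toLp 2 volume] with x hx
  rw [RCLike.inner_apply', toL2_eq, hx]

/-- Complete the square: a|x| - |x|²/2 ≤ a² - |x|²/4, and the square of exp(-|x|²/4) is the Gaussian
again. -/
theorem memLp_exp_mul_gaussian {d : ℕ} (a : ℝ) :
    MemLp (fun x : E d ↦ Real.exp (a * ‖x‖) * Real.exp (-(‖x‖ ^ 2 / 2))) 2 volume := by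
  have hc : Continuous fun x : E d ↦ Real.exp (a * ‖x‖) * Real.exp (-(‖x‖ ^ 2 / 2)) := by fun_prop
  have hg : MemLp (fun x : E d ↦ Real.exp (a ^ 2) * Real.exp (-(‖x‖ ^ 2 / 4))) 2 volume := by
    rw [memLp_two_iff_integrable_sq (by fun_prop)]
    have h := ((gaussian d).integrable (μ := volume)).norm.const_mul (Real.exp (a ^ 2) ^ 2)
    refine h.congr (Filter.Eventually.of_forall fun x ↦ ?_)
    simp only [gaussian_eq_ofReal, Complex.norm_real, Real.norm_eq_abs, Real.abs_exp, mul_pow]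
    rw [← Real.exp_nat_mul (-(‖x‖ ^ 2 / 4)) 2]
    congr 2
    push_cast
    ring
  refine hg.mono hc.aestronglyMeasurable (Filter.Eventually.of_forall fun x ↦ ?_)
  rw [← Real.exp_add, ← Real.exp_add, Real.norm_eq_abs, Real.norm_eq_abs, Real.abs_exp, Real.abs_exp]
  refine Real.exp_le_exp.mpr ?_
  nlinarith [sq_nonneg (a - ‖x‖ / 2)]

/-- An `L²` function that is orthogonal to all Hermite functions vanishes. -/
theorem eq_zero_of_forall_orthogonal {d : ℕ} (u : L2 d)
    (hu : ∀ n, ∀ f ∈ hermiteSpace d n, inner ℂ (toL2 d f) u = 0) : u = 0 := by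
  have humem : MemLp u 2 volume := Lp.memLp u
  set G : E d → ℂ := fun x ↦ gaussian d x * u x with hG
  -- Exponential integrability of G justifies expanding the Fourier kernel under the integral;
  -- orthogonality makes all moments of G vanish.
  have hdom : ∀ a : ℝ, Integrable (fun x : E d ↦ Real.exp (a * ‖x‖) * ‖G x‖) volume := by
    intro a
    have h := (memLp_exp_mul_gaussian (d := d) a).integrable_mul humem.norm
    refine h.congr (Filter.Eventually.of_forall fun x ↦ ?_)
    simp only [hG, Pi.mul_apply, norm_mul, gaussian_eq_ofReal, Complex.norm_real, Real.norm_eq_abs,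
      Real.abs_exp]
    ring
  have hGm : AEStronglyMeasurable G volume :=
    (gaussian d).continuous.aestronglyMeasurable.mul humem.1
  have hGint : Integrable G volume := by
    have h := hdom 0
    simp only [zero_mul, Real.exp_zero, one_mul] at h
    exact (integrable_norm_iff hGm).mp h
  have hmom : ∀ (ξ : E d) (k : ℕ), ∫ x, ((inner ℝ x ξ : ℝ) : ℂ) ^ k * G x = 0 := by
    intro ξ k
    have h := hu _ _ (iterate_linearMul_gaussian_mem ξ k)
    rw [inner_toL2_left] at h
    rw [← h]
    congr 1
    funext x
    rw [iterate_linearMul_gaussian_apply, gaussian_eq_ofReal, map_mul, map_pow, Complex.conj_ofReal,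
      Complex.conj_ofReal]
    simp only [hG, gaussian_eq_ofReal]
    ring
  have hF : 𝓕 G = 0 := by
    funext ξ
    rw [Real.fourier_eq, Pi.zero_apply]
    set c : ℂ := -(2 * Real.pi * Complex.I) with hc
    have hcn : ‖c‖ = 2 * Real.pi := by
      rw [hc, norm_neg, norm_mul, Complex.norm_I, mul_one]
      norm_cast
      rw [Real.norm_eq_abs, abs_of_pos (by positivity)]
    have hs := hasSum_integral_of_dominated_convergence (μ := (volume : Measure (E d)))
      (F := fun (k : ℕ) x ↦ c ^ k / k.factorial * (((inner ℝ x ξ : ℝ) : ℂ) ^ k * G x))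
      (f := fun x ↦ Complex.exp (c * (inner ℝ x ξ : ℝ)) * G x)
      (fun k x ↦ (2 * Real.pi * ‖ξ‖ * ‖x‖) ^ k / k.factorial * ‖G x‖) ?_ ?_ ?_ ?_ ?_
    · have h0 : ∀ k : ℕ, ∫ x, c ^ k / k.factorial * (((inner ℝ x ξ : ℝ) : ℂ) ^ k * G x) = 0 := by
        intro k
        rw [integral_const_mul, hmom, mul_zero]
      simp only [h0] at hs
      rw [← hs.unique hasSum_zero]
      congr 1
      funext x
      rw [Circle.smul_def, Real.fourierChar_apply, smul_eq_mul]
      congr 2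
      rw [hc]
      push_cast
      ring
    · intro k
      refine AEStronglyMeasurable.const_mul (AEStronglyMeasurable.mul ?_ hGm) _
      exact (by fun_prop : Continuous fun x : E d ↦ ((inner ℝ x ξ : ℝ) : ℂ) ^ k).aestronglyMeasurable
    · intro k
      refine Filter.Eventually.of_forall fun x ↦ ?_
      rw [norm_mul, norm_div, norm_pow, hcn, norm_mul, norm_pow, Complex.norm_real, Complex.norm_natCast,
        ← mul_assoc, div_mul_eq_mul_div, ← mul_pow]
      have h : 2 * Real.pi * ‖(inner ℝ x ξ : ℝ)‖ ≤ 2 * Real.pi * ‖ξ‖ * ‖x‖ :=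
        calc 2 * Real.pi * ‖(inner ℝ x ξ : ℝ)‖ ≤ 2 * Real.pi * (‖x‖ * ‖ξ‖) :=
              mul_le_mul_of_nonneg_left (norm_inner_le_norm x ξ) (by positivity)
          _ = _ := by ring
      have h2 := pow_le_pow_left₀ (by positivity) h k
      gcongr
    · refine Filter.Eventually.of_forall fun x ↦ ?_
      exact (Real.summable_pow_div_factorial _).mul_right _
    · refine (hdom (2 * Real.pi * ‖ξ‖)).congr (Filter.Eventually.of_forall fun x ↦ ?_)
      change _ = ∑' k : ℕ, (2 * Real.pi * ‖ξ‖ * ‖x‖) ^ k / k.factorial * ‖G x‖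
      rw [tsum_mul_right, Real.exp_eq_exp_ℝ, NormedSpace.exp_eq_tsum_div]
    · refine Filter.Eventually.of_forall fun x ↦ ?_
      have h := (NormedSpace.expSeries_div_hasSum_exp (c * ((inner ℝ x ξ : ℝ) : ℂ))).mul_right (G x)
      rw [← Complex.exp_eq_exp_ℂ] at h
      refine h.congr_fun fun k ↦ ?_
      rw [mul_pow]
      ring
  -- Every Schwartz function is a Fourier transform, so moving the transform onto G, where it
  -- vanishes, shows that G is the zero distribution.
  have hφ : ∀ φ : 𝓢(E d, ℂ), ∫ x, φ x * G x = 0 := by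
    intro φ
    have h := VectorFourier.integral_fourierIntegral_smul_eq_flip (L := innerₗ (E d))
      (μ := volume) (ν := volume) Real.continuous_fourierChar continuous_inner
      ((𝓕⁻ φ : 𝓢(E d, ℂ)).integrable (μ := volume)) hGint
    have h1 : ∀ x, VectorFourier.fourierIntegral Real.fourierChar volume (innerₗ (E d))
        (𝓕⁻ φ : 𝓢(E d, ℂ)) x = φ x := by
      intro x
      have h2 : (𝓕 (𝓕⁻ φ : 𝓢(E d, ℂ)) : 𝓢(E d, ℂ)) = φ := FourierTransform.fourier_fourierInv_eq φ
      conv_rhs => rw [← h2]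
      rfl
    have h3 : VectorFourier.fourierIntegral Real.fourierChar volume (innerₗ (E d)).flip G = 0 := by
      rw [flip_innerₗ (E d)]
      exact hF
    simp only [h1, h3, smul_eq_mul, Pi.zero_apply, mul_zero, integral_zero] at h
    exact h
  have hae : ∀ᵐ x, G x = 0 := by
    refine ae_eq_zero_of_integral_contDiff_smul_eq_zero hGint.locallyIntegrable ?_
    intro g hg hgc
    have hg₁ : HasCompactSupport (Complex.ofRealCLM ∘ g) := hgc.comp_left rfl
    have hg₂ : ContDiff ℝ (⊤ : ℕ∞) (Complex.ofRealCLM ∘ g) := by fun_prop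
    have h := hφ (hg₁.toSchwartzMap hg₂)
    simpa using h
  rw [Lp.eq_zero_iff_ae_eq_zero]
  filter_upwards [hae] with x hx
  have hne : gaussian d x ≠ 0 := Complex.exp_ne_zero _
  exact (mul_eq_zero.mp hx).resolve_left hne

end

/-! ### Diagonal semigroups on a Hilbert sum. -/

section

open Filter Topology

section Diagonal

variable {G : ℕ → Type*} [∀ n, NormedAddCommGroup (G n)] 

theorem lp_norm_sq (f : lp G 2) : ‖f‖ ^ 2 = ∑' n, ‖f n‖ ^ 2 := by
  have h := lp.norm_rpow_eq_tsum (p := 2) (by norm_num) f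
  simpa using h

theorem lp_summable_norm_sq (f : lp G 2) : Summable fun n ↦ ‖f n‖ ^ 2 := by
  have h := (lp.memℓp f).summable (by norm_num)
  simpa using h

theorem lp_norm_sq_le_of_le {f g : lp G 2} {q : ℝ} (h : ∀ n, ‖f n‖ ≤ q * ‖g n‖) :
    ‖f‖ ^ 2 ≤ q ^ 2 * ‖g‖ ^ 2 := by
  rw [lp_norm_sq, lp_norm_sq, ← tsum_mul_left]
  refine Summable.tsum_le_tsum (fun n ↦ ?_) (lp_summable_norm_sq f)
    ((lp_summable_norm_sq g).mul_left _)
  rw [← mul_pow]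
  exact pow_le_pow_left₀ (norm_nonneg _) (h n) 2

theorem lp_norm_le_of_le {f g : lp G 2} {q : ℝ} (hq : 0 ≤ q) (h : ∀ n, ‖f n‖ ≤ q * ‖g n‖) :
    ‖f‖ ≤ q * ‖g‖ := by
  refine (abs_le_of_sq_le_sq' ?_ (by positivity)).2
  rw [mul_pow]
  exact lp_norm_sq_le_of_le h

/-- Dominated convergence for the squared norms of the coordinates. -/
theorem lp_tendsto_zero {ι : Type*} {l : Filter ι} {F : ι → lp G 2} {b : ℕ → ℝ} (hb : Summable b)
    (hF : ∀ᶠ t in l, ∀ n, ‖F t n‖ ^ 2 ≤ b n) (h : ∀ n, Tendsto (fun t ↦ ‖F t n‖ ^ 2) l (𝓝 0)) :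
    Tendsto F l (𝓝 0) := by
  rw [tendsto_zero_iff_norm_tendsto_zero]
  have h1 : Tendsto (fun t ↦ ‖F t‖ ^ 2) l (𝓝 0) := by
    have h2 := tendsto_tsum_of_dominated_convergence (f := fun t n ↦ ‖F t n‖ ^ 2)
      (g := fun _ ↦ (0 : ℝ)) hb h (hF.mono fun t ht n ↦ by
        rw [Real.norm_eq_abs, abs_of_nonneg (by positivity)]; exact ht n)
    simpa [← lp_norm_sq] using h2
  have h3 := h1.sqrt
  simpa [Real.sqrt_sq] using h3

variable [∀ n, InnerProductSpace ℂ (G n)]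

theorem memℓp_smul {c : ℕ → ℝ} (hc : ∀ n, |c n| ≤ 1) (f : lp G 2) :
    Memℓp (fun n ↦ (c n : ℂ) • f n) 2 := by
  refine memℓp_gen ?_
  refine Summable.of_nonneg_of_le (fun n ↦ by positivity) (fun n ↦ ?_)
    ((lp.memℓp f).summable (by norm_num))
  refine Real.rpow_le_rpow (norm_nonneg _) ?_ (by norm_num)
  rw [norm_smul, Complex.norm_real]
  exact mul_le_of_le_one_left (norm_nonneg _) (hc n)

/-- The diagonal operator with coefficients `c n ∈ [-1, 1]`. -/
def diagonal (c : ℕ → ℝ) (hc : ∀ n, |c n| ≤ 1) : lp G 2 →L[ℂ] lp G 2 :=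
  LinearMap.mkContinuous
    { toFun f := ⟨fun n ↦ (c n : ℂ) • f n, memℓp_smul hc f⟩
      map_add' f g := by ext n; exact smul_add _ _ _
      map_smul' a f := by ext n; exact smul_comm _ _ _ }
    1 fun f ↦ lp_norm_le_of_le zero_le_one fun n ↦ by
      simp only [LinearMap.coe_mk, AddHom.coe_mk, norm_smul, Complex.norm_real, one_mul]
      exact mul_le_of_le_one_left (norm_nonneg _) (hc n)

theorem diagonal_apply {c : ℕ → ℝ} (hc : ∀ n, |c n| ≤ 1) (f : lp G 2) (n : ℕ) :
    diagonal c hc f n = (c n : ℂ) • f n := rfl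

/-- The truncation `max t 0` bounds the coefficients for every real t, so contraction and continuity
hold on the whole line without sign conditions. -/
theorem abs_exp_neg_le {μ : ℕ → ℝ} (hμ : ∀ n, 0 ≤ μ n) (t : ℝ) (n : ℕ) :
    |Real.exp (-(max t 0 * μ n))| ≤ 1 := by
  rw [Real.abs_exp, Real.exp_le_one_iff, neg_nonpos]
  exact mul_nonneg (le_max_right _ _) (hμ n)

/-- The diagonal semigroup with rates `μ n`; constant for negative times. -/
def diagonalSemigroup (μ : ℕ → ℝ) (hμ : ∀ n, 0 ≤ μ n) (t : ℝ) : lp G 2 →L[ℂ] lp G 2 :=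
  diagonal (fun n ↦ Real.exp (-(max t 0 * μ n))) (abs_exp_neg_le hμ t)

variable {μ : ℕ → ℝ} (hμ : ∀ n, 0 ≤ μ n)

theorem diagonalSemigroup_apply (t : ℝ) (f : lp G 2) (n : ℕ) :
    diagonalSemigroup μ hμ t f n = ((Real.exp (-(max t 0 * μ n)) : ℝ) : ℂ) • f n := rfl

theorem continuous_diagonalSemigroup (f : lp G 2) : Continuous fun t ↦ diagonalSemigroup μ hμ t f := by
  rw [continuous_iff_continuousAt]
  intro s
  rw [ContinuousAt, ← tendsto_sub_nhds_zero_iff]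
  refine lp_tendsto_zero ((lp_summable_norm_sq f).mul_left (2 ^ 2)) (Eventually.of_forall fun t n ↦ ?_)
    fun n ↦ ?_
  · rw [← mul_pow]
    refine pow_le_pow_left₀ (norm_nonneg _) ?_ 2
    rw [lp.coeFn_sub, Pi.sub_apply, diagonalSemigroup_apply, diagonalSemigroup_apply, ← sub_smul,
      norm_smul, ← Complex.ofReal_sub, Complex.norm_real]
    refine mul_le_mul_of_nonneg_right ((norm_sub_le _ _).trans ?_) (norm_nonneg _)
    have h1 := abs_exp_neg_le hμ t n
    have h2 := abs_exp_neg_le hμ s n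
    rw [Real.norm_eq_abs, Real.norm_eq_abs]
    linarith
  · have h : Continuous fun t : ℝ ↦ ‖((Real.exp (-(max t 0 * μ n)) : ℝ) : ℂ) • f n -
        ((Real.exp (-(max s 0 * μ n)) : ℝ) : ℂ) • f n‖ ^ 2 := by fun_prop
    have h2 := h.tendsto s
    rw [sub_self, norm_zero, zero_pow two_ne_zero] at h2
    exact h2

/-- With s = t μ_n this bounds the error of the difference quotient in coordinate n by ‖g n‖,
uniformly in t: the domination needed to identify the generator. -/
theorem norm_one_sub_slope_le {s : ℝ} (hs : 0 < s) : |1 - (1 - Real.exp (-s)) / s| ≤ 1 := by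
  have h1 : Real.exp (-s) ≤ 1 := Real.exp_le_one_iff.mpr (by linarith)
  have h2 : 1 - s ≤ Real.exp (-s) := by linarith [Real.add_one_le_exp (-s)]
  rw [abs_le]
  constructor
  · have : (1 - Real.exp (-s)) / s ≤ 1 := by rw [div_le_one hs]; linarith
    linarith
  · have : 0 ≤ (1 - Real.exp (-s)) / s := div_nonneg (by linarith) hs.le
    linarith

/-- The generator is multiplication by -μ on its maximal domain. One direction is differentiation of
each coordinate and uniqueness of the derivative, the other dominated convergence of the difference
quotients. -/
theorem hasDerivWithinAt_diagonalSemigroup_iff (f g : lp G 2) :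
    HasDerivWithinAt (fun t ↦ diagonalSemigroup μ hμ t f) (-g) (Ici 0) 0 ↔
      ∀ n, g n = (μ n : ℂ) • f n := by
  have hcoord : ∀ n, HasDerivWithinAt (fun t ↦ diagonalSemigroup μ hμ t f n) (-((μ n : ℂ) • f n))
      (Ici 0) 0 := by
    intro n
    have h1 : HasDerivAt (fun t : ℝ ↦ ((Real.exp (-(t * μ n)) : ℝ) : ℂ) • f n)
        (((Real.exp (-(0 * μ n)) * -(1 * μ n) : ℝ) : ℂ) • f n) 0 :=
      ((((hasDerivAt_id (0 : ℝ)).mul_const (μ n)).neg.exp).ofReal_comp).smul_const (f n)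
    have h2 : ((Real.exp (-(0 * μ n)) * -(1 * μ n) : ℝ) : ℂ) • f n = -((μ n : ℂ) • f n) := by
      simp
    rw [h2] at h1
    refine h1.hasDerivWithinAt.congr (fun t ht ↦ ?_) ?_
    · rw [diagonalSemigroup_apply, max_eq_left ht]
    · rw [diagonalSemigroup_apply, max_eq_left le_rfl]
  constructor
  · intro h n
    have h1 : HasDerivWithinAt (fun t ↦ diagonalSemigroup μ hμ t f n) ((-g) n) (Ici 0) 0 :=
      ((lp.evalCLM ℂ G 2 n).restrictScalars ℝ).hasFDerivAt.comp_hasDerivWithinAt (0 : ℝ) h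
    have h2 := (uniqueDiffOn_Ici (0 : ℝ) 0 self_mem_Ici).eq_deriv _ h1 (hcoord n)
    rw [lp.coeFn_neg, Pi.neg_apply, neg_inj] at h2
    exact h2
  · intro hg
    rw [hasDerivWithinAt_iff_tendsto_slope, ← tendsto_sub_nhds_zero_iff]
    refine lp_tendsto_zero (lp_summable_norm_sq g) ?_ fun n ↦ ?_
    · filter_upwards [self_mem_nhdsWithin] with t ht n
      have ht0 : 0 < t := lt_of_le_of_ne ht.1 (Ne.symm ht.2)
      refine pow_le_pow_left₀ (norm_nonneg _) ?_ 2
      have h1 : (slope (fun t ↦ diagonalSemigroup μ hμ t f) 0 t - -g) n =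
          ((1 - (1 - Real.exp (-(t * μ n))) / (t * μ n) : ℝ) : ℂ) • g n := by
        rw [slope_def_module, sub_zero, lp.coeFn_sub, Pi.sub_apply, lp.coeFn_neg, Pi.neg_apply,
          lp.coeFn_smul, Pi.smul_apply, lp.coeFn_sub, Pi.sub_apply, diagonalSemigroup_apply,
          diagonalSemigroup_apply, max_eq_left ht0.le, max_eq_left le_rfl, hg n]
        rcases eq_or_ne (μ n) 0 with h0 | h0
        · simp [h0]
        · rw [← Complex.coe_smul, zero_mul, neg_zero, Real.exp_zero]
          simp only [smul_smul, ← sub_smul, sub_neg_eq_add, ← add_smul]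
          congr 1
          have h0' : (μ n : ℂ) ≠ 0 := by exact_mod_cast h0
          have ht0' : (t : ℂ) ≠ 0 := by exact_mod_cast ht0.ne'
          push_cast
          field_simp
          ring
      rw [h1, norm_smul, Complex.norm_real]
      rcases eq_or_lt_of_le (hμ n) with h0 | h0
      · rw [hg n, ← h0]
        simp
      · exact mul_le_of_le_one_left (norm_nonneg _) (norm_one_sub_slope_le (by positivity))
    · have h1 := hasDerivWithinAt_iff_tendsto_slope.mp (hcoord n)
      rw [← hg n, ← tendsto_sub_nhds_zero_iff] at h1
      have h2 := h1.norm.pow 2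
      rw [norm_zero, zero_pow two_ne_zero] at h2
      refine h2.congr fun t ↦ ?_
      rw [slope_def_module, slope_def_module]
      rfl

end Diagonal

end

/-! ### Spectral decomposition of the oscillator and its semigroup. -/

section

open Filter Topology

/-- The eigenspace of the harmonic oscillator for the eigenvalue `2 * n + d`. -/
def eigenspace (d n : ℕ) : Submodule ℂ (L2 d) := hermiteL2 d (n + 1) ⊓ (hermiteL2 d n)ᗮ

instance finiteDimensional_eigenspace (d n : ℕ) : FiniteDimensional ℂ (eigenspace d n) :=
  Submodule.finiteDimensional_of_le inf_le_left

theorem eigenspace_le_hermiteL2 {d n m : ℕ} (h : n < m) : eigenspace d n ≤ hermiteL2 d m :=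
  inf_le_left.trans (hermiteL2_mono d h)

theorem orthogonalFamily_eigenspace (d : ℕ) :
    OrthogonalFamily ℂ (fun n ↦ eigenspace d n) fun n ↦ (eigenspace d n).subtypeₗᵢ := by
  refine OrthogonalFamily.of_pairwise fun m n hmn ↦ ?_
  rcases lt_or_gt_of_ne hmn with h | h
  · exact (Submodule.isOrtho_orthogonal_right (hermiteL2 d n)).mono (eigenspace_le_hermiteL2 h)
      inf_le_right
  · exact (Submodule.isOrtho_orthogonal_left (hermiteL2 d m)).mono inf_le_right
      (eigenspace_le_hermiteL2 h)

theorem hermiteL2_le_iSup_eigenspace (d n : ℕ) : hermiteL2 d n ≤ ⨆ k, eigenspace d k := by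
  induction n with
  | zero => simp [hermiteL2, hermiteSpace]
  | succ n ih =>
    rintro _ ⟨f, hf, rfl⟩
    obtain ⟨g, hg, w, hw, rfl, horth, -⟩ := exists_hermite_decomposition hf
    rw [map_add]
    refine add_mem (ih (Submodule.mem_map_of_mem hg)) ?_
    exact Submodule.mem_iSup_of_mem n ⟨Submodule.mem_map_of_mem hw, horth⟩

theorem isHilbertSum_eigenspace (d : ℕ) :
    IsHilbertSum ℂ (fun n ↦ eigenspace d n) fun n ↦ (eigenspace d n).subtypeₗᵢ := by
  refine IsHilbertSum.mkInternal _ (orthogonalFamily_eigenspace d) ?_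
  rw [top_le_iff, Submodule.topologicalClosure_eq_top_iff, Submodule.eq_bot_iff]
  intro u hu
  refine eq_zero_of_forall_orthogonal u fun n f hf ↦ ?_
  exact (Submodule.mem_orthogonal _ _).mp hu _
    (hermiteL2_le_iSup_eigenspace d n (Submodule.mem_map_of_mem hf))

/-- The type of eigenvectors of index `n`. -/
def Eigenvector (d n : ℕ) : Type := eigenspace d n

instance (d n : ℕ) : NormedAddCommGroup (Eigenvector d n) :=
  inferInstanceAs (NormedAddCommGroup (eigenspace d n))

instance (d n : ℕ) : InnerProductSpace ℂ (Eigenvector d n) :=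
  inferInstanceAs (InnerProductSpace ℂ (eigenspace d n))

/-- The inclusion of the eigenvectors in `L²`. -/
def eigenIncl (d n : ℕ) : Eigenvector d n →ₗᵢ[ℂ] L2 d := (eigenspace d n).subtypeₗᵢ

theorem eigenIncl_mem {d n : ℕ} (w : Eigenvector d n) : eigenIncl d n w ∈ eigenspace d n :=
  Subtype.property (p := fun u ↦ u ∈ eigenspace d n) w

theorem isHilbertSum_eigenIncl (d : ℕ) : IsHilbertSum ℂ (Eigenvector d) (eigenIncl d) :=
  isHilbertSum_eigenspace d

/-- The decomposition of `L²` into eigenspaces of the harmonic oscillator. -/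
def spectralIso (d : ℕ) : L2 d ≃ₗᵢ[ℂ] lp (Eigenvector d) 2 :=
  (isHilbertSum_eigenIncl d).linearIsometryEquiv

/-- Coordinates in the Hilbert sum are computed by pairing with eigenvectors; later identities are
checked in this way. -/
theorem inner_eigenIncl {d n : ℕ} (w : Eigenvector d n) (u : L2 d) :
    inner ℂ (eigenIncl d n w) u = inner ℂ w (spectralIso d u n) := by
  classical
  have h1 : (spectralIso d).symm (lp.single 2 n w) = eigenIncl d n w :=
    (isHilbertSum_eigenIncl d).linearIsometryEquiv_symm_apply_single w
  rw [← h1, ← (spectralIso d).inner_map_map, LinearIsometryEquiv.apply_symm_apply,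
    lp.inner_single_left]

/-- The eigenvalues of the harmonic oscillator. -/
def eigenvalue (d n : ℕ) : ℝ := 2 * n + d

theorem exists_eigenfunction {d n : ℕ} (w : Eigenvector d n) :
    ∃ φ : 𝓢(E d, ℂ), toL2 d φ = eigenIncl d n w ∧
      schwartzOscillator d φ = (eigenvalue d n : ℂ) • φ := by
  obtain ⟨⟨φ, hφ, hφw⟩, h2⟩ := eigenIncl_mem w
  refine ⟨φ, hφw, ?_⟩
  rw [schwartzOscillator_eq_of_orthogonal hφ (by rw [hφw]; exact h2), eigenvalue]
  push_cast
  rfl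

theorem eigenvalue_nonneg (d n : ℕ) : 0 ≤ eigenvalue d n := by
  rw [eigenvalue]; positivity

theorem spectralIso_schwartzOscillator {d : ℕ} (φ : 𝓢(E d, ℂ)) (n : ℕ) :
    spectralIso d (toL2 d (schwartzOscillator d φ)) n =
      (eigenvalue d n : ℂ) • spectralIso d (toL2 d φ) n := by
  refine ext_inner_left ℂ fun w ↦ ?_
  obtain ⟨ψ, hψ, hHψ⟩ := exists_eigenfunction w
  rw [inner_smul_right, ← inner_eigenIncl, ← inner_eigenIncl, ← hψ,
    ← inner_schwartzOscillator_left, hHψ, map_smul, inner_smul_left,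
    Complex.conj_ofReal]

/-- Complex conjugation of Schwartz functions. -/
def schwartzConj {d : ℕ} (f : 𝓢(E d, ℂ)) : 𝓢(E d, ℂ) :=
  SchwartzMap.postcompCLM (𝕜 := ℝ) (Complex.conjCLE : ℂ →L[ℝ] ℂ) f

theorem schwartzConj_apply {d : ℕ} (f : 𝓢(E d, ℂ)) (x : E d) :
    schwartzConj f x = (starRingEnd ℂ) (f x) := rfl

theorem schwartzConj_schwartzConj {d : ℕ} (f : 𝓢(E d, ℂ)) : schwartzConj (schwartzConj f) = f := by
  ext x
  simp [schwartzConj_apply]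

theorem partialDeriv_schwartzConj {d : ℕ} (j : Fin d) (f : 𝓢(E d, ℂ)) :
    partialDeriv j (schwartzConj f) = schwartzConj (partialDeriv j f) := by
  ext x
  rw [schwartzConj_apply, partialDeriv, dirDeriv_apply, dirDeriv_apply]
  have h : HasFDerivAt (schwartzConj f) ((Complex.conjCLE : ℂ →L[ℝ] ℂ).comp (fderiv ℝ f x)) x :=
    (Complex.conjCLE : ℂ →L[ℝ] ℂ).hasFDerivAt.comp x f.differentiableAt.hasFDerivAt
  rw [h.fderiv]
  rfl

theorem coordMul_schwartzConj {d : ℕ} (j : Fin d) (f : 𝓢(E d, ℂ)) :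
    coordMul j (schwartzConj f) = schwartzConj (coordMul j f) := by
  ext x
  simp [schwartzConj_apply, coordMul_apply]

theorem schwartzOscillator_schwartzConj {d : ℕ} (f : 𝓢(E d, ℂ)) :
    schwartzOscillator d (schwartzConj f) = schwartzConj (schwartzOscillator d f) := by
  rw [schwartzOscillator_eq_sum, schwartzOscillator_eq_sum]
  conv_rhs => rw [schwartzConj, map_sum]
  refine Finset.sum_congr rfl fun j _ ↦ ?_
  rw [map_sub]
  change coordMul j (coordMul j (schwartzConj f)) - partialDeriv j (partialDeriv j (schwartzConj f)) =
    schwartzConj _ - schwartzConj _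
  rw [coordMul_schwartzConj, coordMul_schwartzConj, partialDeriv_schwartzConj,
    partialDeriv_schwartzConj]

/-- The distributional pairing is bilinear while the inner product is conjugate-linear on the left,
which explains the conjugation. -/
theorem toDistribution_apply {d : ℕ} (u : L2 d) (φ : 𝓢(E d, ℂ)) :
    toDistribution d u φ = inner ℂ (toL2 d (schwartzConj φ)) u := by
  rw [inner_toL2_left]
  simp only [schwartzConj_apply, Complex.conj_conj]
  exact Lp.toTemperedDistribution_apply u φ

theorem oscillatorExpr_apply {d : ℕ} (f : 𝓢'(E d, ℂ)) (φ : 𝓢(E d, ℂ)) :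
    oscillatorExpr d f φ = f (schwartzOscillator d φ) := by
  have h : schwartzOscillator d φ =
    -Δ φ + SchwartzMap.smulLeftCLM ℂ (fun x : E d ↦ ((‖x‖ ^ 2 : ℝ) : ℂ)) φ := rfl
  rw [h, map_add, map_neg, ← TemperedDistribution.laplacian_apply_apply,
    ← TemperedDistribution.smulLeftCLM_apply_apply]
  rfl

/-- In other words, the operator with maximal domain is the adjoint of its restriction to Schwartz
functions. -/
theorem mem_graph_harmonicOscillator_iff {d : ℕ} (u v : L2 d) :
    (u, v) ∈ (harmonicOscillator d).graph ↔
      ∀ φ, inner ℂ (toL2 d (schwartzOscillator d φ)) u = inner ℂ (toL2 d φ) v := by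
  have h1 : (u, v) ∈ (harmonicOscillator d).graph ↔
      oscillatorExpr d (toDistribution d u) = toDistribution d v := by
    rw [LinearPMap.mem_graph_iff]
    have hval : ∀ y : (harmonicOscillator d).domain,
        toDistribution d (harmonicOscillator d y) = oscillatorExpr d (toDistribution d y) :=
      fun y ↦ LinearMap.codRestrictOfInjective_comp_apply _ _ _ _ y
    constructor
    · rintro ⟨y, rfl, hy⟩
      rw [← hval, hy]
    · intro h
      refine ⟨⟨u, ⟨v, h.symm⟩⟩, rfl, toDistribution_injective d ?_⟩
      rw [hval, h]
  rw [h1]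
  constructor
  · intro h φ
    have h2 := congrArg (fun f : 𝓢'(E d, ℂ) ↦ f (schwartzConj φ)) h
    simp only [oscillatorExpr_apply, toDistribution_apply, schwartzOscillator_schwartzConj,
      schwartzConj_schwartzConj] at h2
    exact h2
  · intro h
    ext φ
    rw [oscillatorExpr_apply, toDistribution_apply, toDistribution_apply,
      ← schwartzOscillator_schwartzConj, h]

/-- Eigenfunctions are Schwartz, hence admissible test functions, which gives the coordinates of v;
the converse is Parseval. Thus the maximal domain is the spectral one. -/
theorem mem_graph_iff_spectral {d : ℕ} (u v : L2 d) :
    (u, v) ∈ (harmonicOscillator d).graph ↔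
      ∀ n, spectralIso d v n = (eigenvalue d n : ℂ) • spectralIso d u n := by
  rw [mem_graph_harmonicOscillator_iff]
  constructor
  · intro h n
    refine ext_inner_left ℂ fun w ↦ ?_
    obtain ⟨ψ, hψ, hHψ⟩ := exists_eigenfunction w
    rw [inner_smul_right, ← inner_eigenIncl, ← inner_eigenIncl, ← hψ, ← h, hHψ, map_smul,
      inner_smul_left, Complex.conj_ofReal]
  · intro h φ
    rw [← (spectralIso d).inner_map_map, ← (spectralIso d).inner_map_map, lp.inner_eq_tsum,
      lp.inner_eq_tsum]
    congr 1
    funext n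
    rw [spectralIso_schwartzOscillator, h, inner_smul_left, inner_smul_right, Complex.conj_ofReal]

/-- The semigroup generated by the negative harmonic oscillator; constant for negative times. -/
def oscillatorSemigroup (d : ℕ) (t : ℝ) : L2 d →L[ℂ] L2 d :=
  ((spectralIso d).symm.toContinuousLinearEquiv : lp (Eigenvector d) 2 →L[ℂ] L2 d) ∘L
    diagonalSemigroup (eigenvalue d) (eigenvalue_nonneg d) t ∘L ((spectralIso d).toContinuousLinearEquiv : L2 d →L[ℂ] lp (Eigenvector d) 2)

theorem spectralIso_oscillatorSemigroup {d : ℕ} (t : ℝ) (u : L2 d) :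
    spectralIso d (oscillatorSemigroup d t u) =
      diagonalSemigroup (eigenvalue d) (eigenvalue_nonneg d) t (spectralIso d u) :=
  (spectralIso d).apply_symm_apply _

theorem continuous_oscillatorSemigroup {d : ℕ} (u : L2 d) :
    Continuous fun t ↦ oscillatorSemigroup d t u :=
  (spectralIso d).symm.continuous.comp (continuous_diagonalSemigroup (eigenvalue_nonneg d) _)

theorem oscillatorSemigroup_add {d : ℕ} {s t : ℝ} (hs : 0 ≤ s) (ht : 0 ≤ t) (u : L2 d) :
    oscillatorSemigroup d (s + t) u = oscillatorSemigroup d s (oscillatorSemigroup d t u) := by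
  apply (spectralIso d).injective
  simp only [spectralIso_oscillatorSemigroup]
  ext1
  funext n
  simp only [diagonalSemigroup_apply]
  rw [smul_smul, ← Complex.ofReal_mul, ← Real.exp_add, max_eq_left hs, max_eq_left ht,
    max_eq_left (add_nonneg hs ht)]
  congr 4
  ring

theorem oscillatorSemigroup_zero (d : ℕ) :
    oscillatorSemigroup d 0 = ContinuousLinearMap.id ℂ (L2 d) := by
  ext1 u
  apply (spectralIso d).injective
  rw [spectralIso_oscillatorSemigroup]
  ext1
  funext n
  rw [diagonalSemigroup_apply]
  simp

theorem isSemigroupOf_oscillatorSemigroup (d : ℕ) :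
    IsSemigroupOf (harmonicOscillator d) (oscillatorSemigroup d) where
  zero := oscillatorSemigroup_zero d
  add s t hs ht := by
    ext1 u
    exact oscillatorSemigroup_add hs ht u
  continuousOn u := (continuous_oscillatorSemigroup u).continuousOn
  generator u v := by
    rw [mem_graph_iff_spectral, ← hasDerivWithinAt_diagonalSemigroup_iff (eigenvalue_nonneg d)]
    constructor
    · intro h
      have h1 := (((spectralIso d).symm.toContinuousLinearEquiv : lp (Eigenvector d) 2 →L[ℂ] L2 d).restrictScalars
        ℝ).hasFDerivAt.comp_hasDerivWithinAt (0 : ℝ) h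
      have h2 : (((spectralIso d).symm.toContinuousLinearEquiv : lp (Eigenvector d) 2 →L[ℂ] L2 d).restrictScalars ℝ) (-spectralIso d v) = -v := by
        change (spectralIso d).symm (-spectralIso d v) = -v
        rw [map_neg, LinearIsometryEquiv.symm_apply_apply]
      rw [h2] at h1
      exact h1
    · intro h
      have h1 := (((spectralIso d).toContinuousLinearEquiv : L2 d →L[ℂ] lp (Eigenvector d) 2).restrictScalars
        ℝ).hasFDerivAt.comp_hasDerivWithinAt (0 : ℝ) h
      have h2 : (((spectralIso d).toContinuousLinearEquiv : L2 d →L[ℂ] lp (Eigenvector d) 2).restrictScalars ℝ) (-v) = -spectralIso d v :=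
        map_neg (spectralIso d) v
      rw [h2] at h1
      refine h1.congr (fun t _ ↦ ?_) ?_
      · exact (spectralIso_oscillatorSemigroup t u).symm
      · exact (spectralIso_oscillatorSemigroup 0 u).symm

theorem norm_oscillatorSemigroup_le {d : ℕ} (t : ℝ) (u : L2 d) :
    ‖oscillatorSemigroup d t u‖ ≤ ‖u‖ := by
  rw [← (spectralIso d).norm_map, ← (spectralIso d).norm_map u, spectralIso_oscillatorSemigroup]
  have h := lp_norm_le_of_le (f := diagonalSemigroup (eigenvalue d) (eigenvalue_nonneg d) t
    (spectralIso d u)) (g := spectralIso d u) zero_le_one fun n ↦ by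
      rw [diagonalSemigroup_apply, norm_smul, Complex.norm_real, one_mul]
      exact mul_le_of_le_one_left (norm_nonneg _) (abs_exp_neg_le (eigenvalue_nonneg d) t n)
  rwa [one_mul] at h

theorem abs_indicator_le (N n : ℕ) : |if n < N then (1 : ℝ) else 0| ≤ 1 := by
  split_ifs <;> simp

/-- The spectral projection onto the eigenspaces of index less than `N`. -/
def spectralProjection (d N : ℕ) : L2 d →L[ℂ] L2 d :=
  ((spectralIso d).symm.toContinuousLinearEquiv : lp (Eigenvector d) 2 →L[ℂ] L2 d) ∘L
    diagonal (fun n ↦ if n < N then 1 else 0) (abs_indicator_le N) ∘L ((spectralIso d).toContinuousLinearEquiv : L2 d →L[ℂ] lp (Eigenvector d) 2)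

theorem spectralIso_spectralProjection {d N : ℕ} (u : L2 d) (n : ℕ) :
    spectralIso d (spectralProjection d N u) n = if n < N then spectralIso d u n else 0 := by
  have h : spectralIso d (spectralProjection d N u) =
      diagonal (fun n ↦ if n < N then 1 else 0) (abs_indicator_le N) (spectralIso d u) :=
    (spectralIso d).apply_symm_apply _
  rw [h, diagonal_apply]
  split_ifs <;> simp

theorem spectralProjection_idem {d N : ℕ} (u : L2 d) :
    spectralProjection d N (spectralProjection d N u) = spectralProjection d N u := by
  apply (spectralIso d).injective
  ext1
  funext n
  simp only [spectralIso_spectralProjection]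
  split_ifs <;> rfl

theorem inner_spectralProjection_left {d N : ℕ} (u v : L2 d) :
    inner ℂ (spectralProjection d N u) v = inner ℂ u (spectralProjection d N v) := by
  rw [← (spectralIso d).inner_map_map, ← (spectralIso d).inner_map_map, lp.inner_eq_tsum,
    lp.inner_eq_tsum]
  congr 1
  funext n
  rw [spectralIso_spectralProjection, spectralIso_spectralProjection]
  split_ifs <;> simp

theorem norm_spectralProjection_le {d N : ℕ} (u : L2 d) : ‖spectralProjection d N u‖ ≤ ‖u‖ := by
  rw [← (spectralIso d).norm_map, ← (spectralIso d).norm_map u]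
  have h := lp_norm_le_of_le (f := spectralIso d (spectralProjection d N u))
    (g := spectralIso d u) zero_le_one fun n ↦ by
      rw [spectralIso_spectralProjection, one_mul]
      split_ifs <;> simp
  rwa [one_mul] at h

theorem spectralProjection_oscillatorSemigroup {d N : ℕ} (t : ℝ) (u : L2 d) :
    spectralProjection d N (oscillatorSemigroup d t u) =
      oscillatorSemigroup d t (spectralProjection d N u) := by
  apply (spectralIso d).injective
  ext1
  funext n
  rw [spectralIso_spectralProjection, spectralIso_oscillatorSemigroup,
    spectralIso_oscillatorSemigroup, diagonalSemigroup_apply, diagonalSemigroup_apply,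
    spectralIso_spectralProjection]
  split_ifs <;> simp

theorem spectralProjection_mem_hermiteL2 {d N : ℕ} (u : L2 d) :
    spectralProjection d N u ∈ hermiteL2 d N := by
  have h := (isHilbertSum_eigenIncl d).hasSum_linearIsometryEquiv_symm
    (spectralIso d (spectralProjection d N u))
  have h1 : (isHilbertSum_eigenIncl d).linearIsometryEquiv.symm
      (spectralIso d (spectralProjection d N u)) = spectralProjection d N u :=
    (spectralIso d).symm_apply_apply _
  rw [h1] at h
  have h2 := hasSum_sum_of_ne_finset_zero (L := SummationFilter.unconditional ℕ) (s := Finset.range N)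
    (f := fun n ↦ eigenIncl d n (spectralIso d (spectralProjection d N u) n))
    fun n hn ↦ by
      rw [spectralIso_spectralProjection, if_neg (by simpa using hn), map_zero]
  rw [h.unique h2]
  exact sum_mem fun n hn ↦ eigenspace_le_hermiteL2 (Finset.mem_range.mp hn) (eigenIncl_mem _)

/-- Decay of the high modes. -/
theorem norm_oscillatorSemigroup_le_of_spectralProjection_eq_zero {d N : ℕ} {t : ℝ} (ht : 0 ≤ t)
    {u : L2 d} (hu : spectralProjection d N u = 0) :
    ‖oscillatorSemigroup d t u‖ ≤ Real.exp (-(N * t)) * ‖u‖ := by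
  rw [← (spectralIso d).norm_map, ← (spectralIso d).norm_map u, spectralIso_oscillatorSemigroup]
  refine lp_norm_le_of_le (Real.exp_nonneg _) fun n ↦ ?_
  rw [diagonalSemigroup_apply, norm_smul, Complex.norm_real, Real.norm_eq_abs, Real.abs_exp,
    max_eq_left ht]
  by_cases hn : n < N
  · have h := spectralIso_spectralProjection (N := N) u n
    rw [hu, if_pos hn, map_zero] at h
    rw [← h]
    simp
  · have hn' : (N : ℝ) ≤ n := by exact_mod_cast not_lt.mp hn
    -- The remaining eigenvalues are at least 2 N + d; the rate N suffices.
    have h1 : (N : ℝ) ≤ eigenvalue d n := by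
      rw [eigenvalue]
      have : (0 : ℝ) ≤ d := by positivity
      have : (0 : ℝ) ≤ n := by positivity
      linarith
    gcongr ?_ * _
    refine Real.exp_le_exp.mpr (neg_le_neg ?_)
    rw [mul_comm]
    gcongr

end

/-! ### Sobolev inequality and pointwise derivative bounds. -/

section

open scoped LineDeriv FourierTransform

/-- The operator whose Fourier symbol is `1 + |ξ|²`. -/
def besselOp (d : ℕ) : 𝓢(E d, ℂ) →ₗ[ℂ] 𝓢(E d, ℂ) :=
  LinearMap.id - (((4 * Real.pi ^ 2)⁻¹ : ℝ) : ℂ) • ∑ j, partialDeriv j ∘ₗ partialDeriv j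

theorem besselOp_apply {d : ℕ} (f : 𝓢(E d, ℂ)) :
    besselOp d f = f - (((4 * Real.pi ^ 2)⁻¹ : ℝ) : ℂ) • ∑ j, partialDeriv j (partialDeriv j f) := by
  simp [besselOp]

theorem fourier_partialDeriv {d : ℕ} (j : Fin d) (f : 𝓢(E d, ℂ)) (ξ : E d) :
    𝓕 (partialDeriv j f) ξ = (2 * Real.pi * Complex.I) * (ξ j * 𝓕 f ξ) := by
  have h := congrArg (fun g : 𝓢(E d, ℂ) ↦ g ξ)
    (SchwartzMap.fourier_lineDerivOp_eq f (EuclideanSpace.basisFun (Fin d) ℝ j))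
  have hg : (fun x : E d ↦ (inner ℝ x (EuclideanSpace.basisFun (Fin d) ℝ j) : ℝ)).HasTemperateGrowth := by
    fun_prop
  have h2 : (inner ℝ ξ (EuclideanSpace.basisFun (Fin d) ℝ j) : ℝ) = ξ j := by
    rw [real_inner_comm, ← (EuclideanSpace.basisFun (Fin d) ℝ).repr_apply_apply]
    simp
  simp only [_root_.smul_apply, SchwartzMap.smulLeftCLM_apply_apply hg, h2, smul_eq_mul] at h
  exact h

theorem fourier_besselOp {d : ℕ} (f : 𝓢(E d, ℂ)) (ξ : E d) :
    𝓕 (besselOp d f) ξ = (1 + ‖ξ‖ ^ 2 : ℝ) * 𝓕 f ξ := by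
  have hlin : 𝓕 (besselOp d f) = 𝓕 f -
      (((4 * Real.pi ^ 2)⁻¹ : ℝ) : ℂ) • ∑ j, 𝓕 (partialDeriv j (partialDeriv j f)) := by
    rw [besselOp_apply]
    simp only [← FourierTransform.fourierCLM_apply (R := ℂ), map_sub, map_smul, map_sum]
  rw [hlin, _root_.sub_apply, _root_.smul_apply, _root_.sum_apply]
  simp only [fourier_partialDeriv]
  have hsum : ∑ j, 2 * (Real.pi : ℂ) * Complex.I * ((ξ j : ℂ) * (2 * Real.pi * Complex.I * (ξ j * 𝓕 f ξ))) =
      -(4 * Real.pi ^ 2) * ((‖ξ‖ ^ 2 : ℝ) : ℂ) * 𝓕 f ξ := by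
    rw [EuclideanSpace.norm_sq_eq]
    push_cast
    rw [Finset.mul_sum, Finset.sum_mul]
    refine Finset.sum_congr rfl fun j _ ↦ ?_
    have habs : ((‖ξ j‖ : ℝ) : ℂ) ^ 2 = (ξ j : ℂ) ^ 2 := by
      rw [Real.norm_eq_abs, ← Complex.ofReal_pow, sq_abs, Complex.ofReal_pow]
    rw [habs]
    linear_combination (4 * (Real.pi : ℂ) ^ 2 * (ξ j : ℂ) ^ 2 * 𝓕 f ξ) * Complex.I_sq
  rw [hsum, smul_eq_mul]
  have hpi : (Real.pi : ℂ) ≠ 0 := by exact_mod_cast Real.pi_ne_zero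
  push_cast
  field_simp
  ring

theorem fourier_iterate_besselOp {d : ℕ} (k : ℕ) (f : 𝓢(E d, ℂ)) (ξ : E d) :
    𝓕 ((besselOp d)^[k] f) ξ = ((1 + ‖ξ‖ ^ 2 : ℝ) : ℂ) ^ k * 𝓕 f ξ := by
  induction k with
  | zero => simp
  | succ k ih =>
    rw [Function.iterate_succ_apply', fourier_besselOp, ih]
    ring

theorem norm_sq_toL2 {d : ℕ} (f : 𝓢(E d, ℂ)) : ‖toL2 d f‖ ^ 2 = ∫ x, ‖f x‖ ^ 2 := by
  have h := inner_self_eq_norm_sq_to_K (𝕜 := ℂ) (toL2 d f)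
  rw [inner_toL2] at h
  have h2 : ∀ x, inner ℂ (f x) (f x) = ((‖f x‖ ^ 2 : ℝ) : ℂ) := fun x ↦ by
    rw [inner_self_eq_norm_sq_to_K]
    push_cast
    rfl
  simp only [h2] at h
  rw [integral_complex_ofReal] at h
  have h3 : ((∫ x, ‖f x‖ ^ 2 : ℝ) : ℂ) = ((‖toL2 d f‖ ^ 2 : ℝ) : ℂ) := by
    rw [h]
    push_cast
    rfl
  exact_mod_cast h3.symm

/-- A Sobolev inequality. -/
theorem exists_norm_apply_le (d : ℕ) :
    ∃ C, 0 < C ∧ ∀ (f : 𝓢(E d, ℂ)) (x : E d), ‖f x‖ ≤ C * ‖toL2 d ((besselOp d)^[d + 1] f)‖ := by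
  -- This Fourier weight is square integrable because 4 (d + 1) > d; Cauchy–Schwarz then bounds the
  -- L¹ norm of the transform.
  set w : E d → ℝ := fun ξ ↦ ((1 + ‖ξ‖ ^ 2) ^ (d + 1))⁻¹ with hw
  have hwc : Continuous w := by
    refine Continuous.inv₀ (by fun_prop) fun ξ ↦ by positivity
  have hwmem : MemLp w 2 volume := by
    rw [memLp_two_iff_integrable_sq hwc.aestronglyMeasurable]
    have h := integrable_rpow_neg_one_add_norm_sq (E := E d) (μ := volume) (r := 4 * (d + 1))
      (by rw [finrank_euclideanSpace_fin]; linarith [(Nat.cast_nonneg d : (0 : ℝ) ≤ d)])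
    refine h.congr (Filter.Eventually.of_forall fun ξ ↦ ?_)
    have h1 : -(4 * ((d : ℝ) + 1)) / 2 = -((2 * (d + 1) : ℕ) : ℝ) := by push_cast; ring
    simp only [hw]
    rw [h1, Real.rpow_neg (by positivity), Real.rpow_natCast, inv_pow, ← pow_mul, mul_comm (d + 1)]
  refine ⟨√(∫ ξ, w ξ ^ 2) + 1, by positivity, fun f x ↦ ?_⟩
  set g := (besselOp d)^[d + 1] f with hg
  have h1 : ∀ ξ, ‖𝓕 f ξ‖ = w ξ * ‖𝓕 g ξ‖ := by
    intro ξ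
    have hpos : (0 : ℝ) < (1 + ‖ξ‖ ^ 2) ^ (d + 1) := by positivity
    rw [hg, fourier_iterate_besselOp, norm_mul, norm_pow, Complex.norm_real, Real.norm_eq_abs,
      abs_of_pos (by positivity), ← mul_assoc, inv_mul_cancel₀ hpos.ne', one_mul]
  have hgmem : MemLp (𝓕 g : 𝓢(E d, ℂ)) 2 volume := (𝓕 g : 𝓢(E d, ℂ)).memLp 2 volume
  have h2 : ‖f x‖ ≤ ∫ ξ, ‖𝓕 f ξ‖ := by
    have h3 : f x = 𝓕⁻ (𝓕 f : 𝓢(E d, ℂ)) x := by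
      rw [FourierTransform.fourierInv_fourier_eq]
    rw [h3, SchwartzMap.fourierInv_coe, Real.fourierInv_eq]
    refine (norm_integral_le_integral_norm _).trans (le_of_eq ?_)
    congr 1
    funext ξ
    rw [Circle.norm_smul]
  have h4 : ‖toL2 d g‖ = √(∫ ξ, ‖𝓕 g ξ‖ ^ 2) := by
    rw [SchwartzMap.integral_norm_sq_fourier, ← norm_sq_toL2, Real.sqrt_sq (norm_nonneg _)]
  have h5 := integral_mul_le_Lp_mul_Lq_of_nonneg (μ := (volume : Measure (E d))) (p := 2) (q := 2)
    (f := w) (g := fun ξ ↦ ‖𝓕 g ξ‖) Real.HolderConjugate.two_two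
    (Filter.Eventually.of_forall fun ξ ↦ by
      simp only [hw, Pi.zero_apply]
      positivity)
    (Filter.Eventually.of_forall fun ξ ↦ norm_nonneg _) (by simpa using hwmem)
    (by simpa using hgmem.norm)
  calc ‖f x‖ ≤ ∫ ξ, w ξ * ‖𝓕 g ξ‖ := by simpa only [← h1] using h2
    _ ≤ √(∫ ξ, w ξ ^ 2) * ‖toL2 d g‖ := by
      rw [h4, Real.sqrt_eq_rpow, Real.sqrt_eq_rpow]
      simpa using h5
    _ ≤ _ := by
      gcongr
      linarith

theorem besselOp_mem_hermiteSpace {d n : ℕ} {f : 𝓢(E d, ℂ)} (hf : f ∈ hermiteSpace d n) :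
    besselOp d f ∈ hermiteSpace d (n + 2) := by
  rw [besselOp_apply]
  refine sub_mem (hermiteSpace_mono d (by omega) hf) (Submodule.smul_mem _ _ (sum_mem fun j _ ↦ ?_))
  exact partialDeriv_mem_hermiteSpace j (partialDeriv_mem_hermiteSpace j hf)

theorem norm_besselOp_le {d n : ℕ} {f : 𝓢(E d, ℂ)} (hf : f ∈ hermiteSpace d (n + 1)) :
    ‖toL2 d (besselOp d f)‖ ≤ (1 + d * (2 * (n + 1) + d)) * ‖toL2 d f‖ := by
  have h1 : ∀ j ∈ Finset.univ, ‖toL2 d (partialDeriv j (partialDeriv j f))‖ ≤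
      (2 * (n + 1) + d) * ‖toL2 d f‖ := by
    intro j _
    calc ‖toL2 d (partialDeriv j (partialDeriv j f))‖
        ≤ √(2 * (n + 1 : ℕ) + d) * ‖toL2 d (partialDeriv j f)‖ :=
          norm_partialDeriv_le (partialDeriv_mem_hermiteSpace j hf) j
      _ ≤ √(2 * (n + 1 : ℕ) + d) * (√(2 * (n + 1 : ℕ) + d) * ‖toL2 d f‖) := by
          gcongr
          refine (norm_partialDeriv_le hf j).trans ?_
          gcongr
          omega
      _ = _ := by
          rw [← mul_assoc, Real.mul_self_sqrt (by positivity)]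
          push_cast
          rfl
  have h2 : ‖(((4 * Real.pi ^ 2)⁻¹ : ℝ) : ℂ)‖ ≤ 1 := by
    rw [Complex.norm_real, Real.norm_eq_abs, abs_of_pos (by positivity)]
    refine inv_le_one_of_one_le₀ ?_
    nlinarith [Real.pi_gt_three]
  rw [besselOp_apply, map_sub, map_smul, map_sum]
  calc _ ≤ ‖toL2 d f‖ + ‖(((4 * Real.pi ^ 2)⁻¹ : ℝ) : ℂ) •
        ∑ j, toL2 d (partialDeriv j (partialDeriv j f))‖ := norm_sub_le _ _
    _ ≤ ‖toL2 d f‖ + 1 * (d * ((2 * (n + 1) + d) * ‖toL2 d f‖)) := by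
        rw [norm_smul]
        gcongr
        refine (norm_sum_le _ _).trans ((Finset.sum_le_sum h1).trans (le_of_eq ?_))
        simp
    _ = _ := by ring

theorem norm_iterate_besselOp_le {d n : ℕ} {f : 𝓢(E d, ℂ)} (hf : f ∈ hermiteSpace d (n + 1)) (m : ℕ) :
    ‖toL2 d ((besselOp d)^[m] f)‖ ≤ (1 + d * (2 * (n + 2 * m) + d)) ^ m * ‖toL2 d f‖ := by
  have key : ∀ k ≤ m, (besselOp d)^[k] f ∈ hermiteSpace d (n + 2 * k + 1) ∧
      ‖toL2 d ((besselOp d)^[k] f)‖ ≤ (1 + d * (2 * (n + 2 * m) + d)) ^ k * ‖toL2 d f‖ := by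
    intro k
    induction k with
    | zero => intro _; simpa using hf
    | succ k ih =>
      intro hk
      obtain ⟨h1, h2⟩ := ih (by omega)
      rw [Function.iterate_succ_apply']
      refine ⟨besselOp_mem_hermiteSpace h1, (norm_besselOp_le h1).trans ?_⟩
      have hk' : (k : ℝ) + 1 ≤ m := by exact_mod_cast hk
      rw [pow_succ', mul_assoc]
      have h3 : (1 + d * (2 * ((n + 2 * k : ℕ) + 1) + d) : ℝ) ≤ 1 + d * (2 * (n + 2 * m) + d) := by
        have h4 : ((n + 2 * k : ℕ) + 1 : ℝ) ≤ n + 2 * m := by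
          push_cast
          linarith
        gcongr
      exact mul_le_mul h3 h2 (norm_nonneg _) (by positivity)
  exact (key m le_rfl).2

/-- Pointwise bounds for the directional derivatives of Hermite functions. -/
theorem exists_norm_iterate_dirDeriv_apply_le (d : ℕ) :
    ∃ C, 0 < C ∧ ∀ (n m : ℕ) (f : 𝓢(E d, ℂ)), f ∈ hermiteSpace d (n + 1) → ∀ v : E d, ‖v‖ ≤ 1 →
      ∀ x, ‖(dirDeriv v)^[m] f x‖ ≤ C * (1 + d * (2 * (n + m + 2 * (d + 1)) + d)) ^ (d + 1) *
        (d * √(2 * (n + m) + d)) ^ m * ‖toL2 d f‖ := by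
  obtain ⟨C, hC, h⟩ := exists_norm_apply_le d
  refine ⟨C, hC, fun n m f hf v hv x ↦ ?_⟩
  obtain ⟨h1, h2⟩ := norm_iterate_dirDeriv_le hf hv m
  refine (h _ x).trans ?_
  have h3 := norm_iterate_besselOp_le h1 (d + 1)
  push_cast at h3
  rw [mul_assoc, mul_assoc]
  gcongr
  refine h3.trans ?_
  gcongr

end

/-! ### Concentration in a ball and lower bounds for the mass on ω. -/

/-- The volume of the unit ball. -/
def ballVolume (d : ℕ) : ℝ := (volume : Measure (E d)).real (Metric.ball 0 1)

theorem ballVolume_pos (d : ℕ) : 0 < ballVolume d :=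
  ENNReal.toReal_pos (Metric.measure_ball_pos _ _ one_pos).ne' measure_ball_lt_top.ne

theorem volume_real_ball {d : ℕ} (x : E d) {r : ℝ} (hr : 0 < r) :
    (volume : Measure (E d)).real (Metric.ball x r) = r ^ d * ballVolume d := by
  rw [Measure.real, Measure.addHaar_ball_of_pos _ _ hr, ENNReal.toReal_mul,
    ENNReal.toReal_ofReal (by positivity), finrank_euclideanSpace_fin]
  rfl

theorem integrable_norm_sq {d : ℕ} (f : 𝓢(E d, ℂ)) : Integrable (fun x ↦ ‖f x‖ ^ 2) :=
  (memLp_two_iff_integrable_sq_norm f.continuous.aestronglyMeasurable).1 (f.memLp 2 volume)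

theorem integral_norm_sq_mul_le {d n : ℕ} {f : 𝓢(E d, ℂ)} (hf : f ∈ hermiteSpace d (n + 1)) :
    Integrable (fun x ↦ ‖x‖ ^ 2 * ‖f x‖ ^ 2) ∧
      ∫ x, ‖x‖ ^ 2 * ‖f x‖ ^ 2 ≤ (2 * n + d) * ‖toL2 d f‖ ^ 2 := by
  have h1 : (fun x : E d ↦ ‖x‖ ^ 2 * ‖f x‖ ^ 2) = fun x ↦ ∑ j, ‖coordMul j f x‖ ^ 2 := by
    funext x
    rw [EuclideanSpace.norm_sq_eq, Finset.sum_mul]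
    refine Finset.sum_congr rfl fun j _ ↦ ?_
    rw [coordMul_apply, norm_mul, mul_pow, Complex.norm_real]
  rw [h1]
  refine ⟨integrable_finsetSum _ fun j _ ↦ integrable_norm_sq _, ?_⟩
  rw [integral_finsetSum _ fun j _ ↦ integrable_norm_sq _]
  refine le_trans (Finset.sum_le_sum fun j _ ↦ ?_) (sum_norm_sq_le hf)
  rw [← norm_sq_toL2]
  linarith [sq_nonneg ‖toL2 d (partialDeriv j f)‖]

/-- A Hermite function is large somewhere in the classically allowed region. -/
theorem exists_norm_sq_le_mul_norm_apply {d n : ℕ} {f : 𝓢(E d, ℂ)} (hf : f ∈ hermiteSpace d (n + 1))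
    {R : ℝ} (hR : 0 < R) (hnR : 4 * (2 * n + d) ≤ R ^ 2) :
    ∃ x ∈ Metric.ball (0 : E d) R, ‖toL2 d f‖ ^ 2 ≤ 2 * (R ^ d * ballVolume d) * ‖f x‖ ^ 2 := by
  by_contra! hcon
  obtain ⟨hint, hle⟩ := integral_norm_sq_mul_le hf
  have hV : 0 < R ^ d * ballVolume d := mul_pos (by positivity) (ballVolume_pos d)
  set V := R ^ d * ballVolume d with hVdef
  have hpos : 0 < ‖toL2 d f‖ ^ 2 :=
    lt_of_le_of_lt (by positivity) (hcon 0 (Metric.mem_ball_self hR))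
  -- Outside the ball the left side is nonpositive, inside it is below the assumed bound.
  -- Integrated, this gives (3/4) ‖f‖² ≤ ‖f‖²/2, since the potential energy is at most R² ‖f‖²/4.
  have hpt : ∀ x, ‖f x‖ ^ 2 - (R ^ 2)⁻¹ * (‖x‖ ^ 2 * ‖f x‖ ^ 2) ≤
      (Metric.ball (0 : E d) R).indicator (fun _ ↦ ‖toL2 d f‖ ^ 2 / (2 * V)) x := by
    intro x
    by_cases hx : x ∈ Metric.ball (0 : E d) R
    · rw [indicator_of_mem hx, le_div_iff₀ (by positivity)]
      have h1 : 0 ≤ (R ^ 2)⁻¹ * (‖x‖ ^ 2 * ‖f x‖ ^ 2) := by positivity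
      nlinarith [hcon x hx]
    · rw [indicator_of_notMem hx]
      have h2 : R ≤ ‖x‖ := by simpa using hx
      have h3 : 1 ≤ (R ^ 2)⁻¹ * ‖x‖ ^ 2 := by
        rw [inv_mul_eq_div, one_le_div (by positivity)]
        gcongr
      nlinarith [sq_nonneg ‖f x‖]
  have hball : IntegrableOn (fun _ : E d ↦ ‖toL2 d f‖ ^ 2 / (2 * V)) (Metric.ball 0 R) :=
    integrableOn_const measure_ball_lt_top.ne
  have h4 := integral_mono ((integrable_norm_sq f).sub (hint.const_mul (R ^ 2)⁻¹))
    (hball.integrable_indicator measurableSet_ball) hpt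
  have h5 : ∫ x, (Metric.ball (0 : E d) R).indicator (fun _ ↦ ‖toL2 d f‖ ^ 2 / (2 * V)) x =
      ‖toL2 d f‖ ^ 2 / 2 := by
    rw [integral_indicator measurableSet_ball, setIntegral_const, volume_real_ball _ hR, ← hVdef,
      smul_eq_mul]
    field_simp
  have h6 : (R ^ 2)⁻¹ * ∫ x, ‖x‖ ^ 2 * ‖f x‖ ^ 2 ≤ ‖toL2 d f‖ ^ 2 / 4 := by
    rw [inv_mul_le_iff₀ (by positivity)]
    nlinarith
  rw [h5] at h4
  simp only [Pi.sub_apply] at h4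
  rw [integral_sub (integrable_norm_sq f) (hint.const_mul _), integral_const_mul,
    ← norm_sq_toL2] at h4
  linarith

theorem iteratedDeriv_line {d : ℕ} (f : 𝓢(E d, ℂ)) (x v : E d) (k : ℕ) (t : ℝ) :
    iteratedDeriv k (fun s : ℝ ↦ f (x + s • v)) t = (dirDeriv v)^[k] f (x + t • v) := by
  induction k generalizing t with
  | zero => simp
  | succ k ih =>
    rw [iteratedDeriv_succ, funext ih, Function.iterate_succ_apply', dirDeriv_apply]
    have h1 : HasDerivAt (fun s : ℝ ↦ x + s • v) v t := by
      simpa using ((hasDerivAt_id t).smul_const v).const_add x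
    exact ((SchwartzMap.hasFDerivAt _ _).comp_hasDerivAt t h1).deriv

theorem contDiff_line {d : ℕ} (f : 𝓢(E d, ℂ)) (x v : E d) (k : ℕ) :
    ContDiff ℝ k (fun s : ℝ ↦ f (x + s • v)) :=
  (f.smooth k).comp (by fun_prop)

/-- A function with controlled directional derivatives cannot be small on most of a ball that
carries a definite portion of `ω`. -/
theorem norm_sq_apply_le_setIntegral {d : ℕ} (hd : 1 ≤ d) {ω : Set (E d)} (hω : MeasurableSet ω)
    (f : 𝓢(E d, ℂ)) {x₀ : E d} {l γ M : ℝ} (hl : 0 < l) (hγ : 0 < γ) {n : ℕ} (hn : 1 ≤ n)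
    (hvol : ENNReal.ofReal γ * volume (Metric.ball x₀ l) ≤ volume (ω ∩ Metric.ball x₀ l))
    (hM : ∀ v : E d, ‖v‖ ≤ 1 → ∀ x, ‖(dirDeriv v)^[n + 1] f x‖ ≤ M)
    (hsmall : (8 * d * Real.exp 1 / γ) ^ n * (M * l ^ (n + 1) / n.factorial) ≤ ‖f x₀‖ / 2) :
    ‖f x₀‖ ^ 2 * (γ * (l ^ d * ballVolume d)) ≤
      32 * ((8 * d * Real.exp 1 / γ) ^ n) ^ 2 * ∫ x in ω, ‖f x‖ ^ 2 := by
  have hd0 : (0 : ℝ) < d := by exact_mod_cast hd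
  set q := (8 * d * Real.exp 1 / γ) ^ n with hq
  have hq0 : 0 < q := by positivity
  rcases (norm_nonneg (f x₀)).eq_or_lt with h0 | h0
  · rw [← h0]
    have : 0 ≤ ∫ x in ω, ‖f x‖ ^ 2 := integral_nonneg fun x ↦ by positivity
    simp only [ne_eq, OfNat.ofNat_ne_zero, not_false_eq_true, zero_pow, zero_mul]
    positivity
  set ε := ‖f x₀‖ / (4 * q) with hε
  have hε0 : 0 < ε := by positivity
  set A : Set (E d) := (ω ∩ Metric.ball x₀ l) ∩ {x | ‖f x‖ ≤ ε} with hA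
  have hlev : MeasurableSet {x | ‖f x‖ ≤ ε} :=
    measurableSet_le f.continuous.norm.measurable measurable_const
  have hωB : MeasurableSet (ω ∩ Metric.ball x₀ l) := hω.inter measurableSet_ball
  have hAm : MeasurableSet A := hωB.inter hlev
  -- If the sublevel set had density γ / 2, a radius would meet it in a proportion γ / (4 d), and
  -- propagation along this radius would give |f x₀| ≤ |f x₀| / 4 + |f x₀| / 2. The base 8 d e / γ
  -- is 2 e divided by γ / (4 d).
  have hAvol : volume A < ENNReal.ofReal (γ / 2) * volume (Metric.ball x₀ l) := by
    by_contra! hcon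
    obtain ⟨θ, hθ, hslice⟩ := exists_large_radial_slice hd hl (by positivity) hAm
      (fun x hx ↦ hx.1.2) hcon
    have h1 := norm_apply_zero_le_of_small_on (g := fun s : ℝ ↦ f (x₀ + s • θ))
      (contDiff_line f x₀ θ) hn (l := l) (γ := γ / 2 / (2 * d)) (ε := ε) (M := M) hl (by positivity)
      (fun t _ ↦ by rw [iteratedDeriv_line]; exact hM θ hθ.le _)
      (fun t ht ↦ Ioo_subset_Icc_self ht.1) hslice (fun t ht ↦ ht.2.2)
    have h2 : 2 * Real.exp 1 / (γ / 2 / (2 * d)) = 8 * d * Real.exp 1 / γ := by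
      field_simp
      ring
    rw [h2, ← hq, mul_add] at h1
    have h3 : q * ε = ‖f x₀‖ / 4 := by
      rw [hε]
      field_simp
    simp only [zero_smul, add_zero] at h1
    linarith
  have hB : volume (Metric.ball x₀ l) ≠ ⊤ := measure_ball_lt_top.ne
  have hreal := volume_real_ball x₀ hl
  set V := l ^ d * ballVolume d with hV
  have hV0 : 0 < V := mul_pos (by positivity) (ballVolume_pos d)
  have hA' : volume.real A ≤ γ / 2 * V := by
    have h := ENNReal.toReal_mono (by finiteness) hAvol.le
    rwa [ENNReal.toReal_mul, ENNReal.toReal_ofReal (by positivity), ← Measure.real, ← Measure.real,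
      hreal] at h
  have hω' : γ * V ≤ volume.real (ω ∩ Metric.ball x₀ l) := by
    have h := ENNReal.toReal_mono (measure_ne_top_of_subset inter_subset_right hB) hvol
    rwa [ENNReal.toReal_mul, ENNReal.toReal_ofReal (by positivity), ← Measure.real, ← Measure.real,
      hreal] at h
  have hsplit : volume.real A + volume.real ((ω ∩ Metric.ball x₀ l) \ {x | ‖f x‖ ≤ ε}) =
      volume.real (ω ∩ Metric.ball x₀ l) :=
    measureReal_inter_add_sdiff hlev (measure_ne_top_of_subset inter_subset_right hB)
  set D := (ω ∩ Metric.ball x₀ l) \ {x | ‖f x‖ ≤ ε} with hD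
  -- So |f| exceeds ε on at least half of the guaranteed portion of ω; the final constant 32 is 2 ·
  -- 4².
  have hDvol : γ / 2 * V ≤ volume.real D := by linarith
  have h5 : ε ^ 2 * volume.real D ≤ ∫ x in ω, ‖f x‖ ^ 2 := by
    calc ε ^ 2 * volume.real D = ∫ x in D, ε ^ 2 := by simp [mul_comm]
      _ ≤ ∫ x in D, ‖f x‖ ^ 2 := by
        refine setIntegral_mono_on ?_ (integrable_norm_sq f).integrableOn (hωB.diff hlev) ?_
        · exact integrableOn_const (measure_ne_top_of_subset
            (sdiff_subset.trans inter_subset_right) hB)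
        · intro x hx
          have : ε ≤ ‖f x‖ := (not_le.1 hx.2).le
          gcongr
      _ ≤ ∫ x in ω, ‖f x‖ ^ 2 :=
        setIntegral_mono_set (integrable_norm_sq f).integrableOn
          (Filter.Eventually.of_forall fun x ↦ by positivity)
          (Filter.Eventually.of_forall fun x hx ↦ hx.1.1)
  have h6 : ‖f x₀‖ = 4 * q * ε := by
    rw [hε]
    field_simp
  have h7 : ε ^ 2 * (γ / 2 * V) ≤ ∫ x in ω, ‖f x‖ ^ 2 := le_trans (by gcongr) h5
  rw [h6]
  nlinarith [mul_le_mul_of_nonneg_left h7 (by positivity : 0 ≤ 32 * q ^ 2)]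

/-! ### The dyadic weight and the growth condition on ρ. -/

section

open Filter Topology

/-- The summable sequence `1 / ((k + 1) (1 + log (k + 1))²)`. -/
def weight (k : ℕ) : ℝ := (((k : ℝ) + 1) * (1 + Real.log (k + 1)) ^ 2)⁻¹

theorem log_succ_nonneg (k : ℕ) : 0 ≤ Real.log ((k : ℝ) + 1) :=
  Real.log_nonneg (by linarith [(Nat.cast_nonneg k : (0 : ℝ) ≤ k)])

theorem weight_pos (k : ℕ) : 0 < weight k := by
  have := log_succ_nonneg k
  rw [weight]
  positivity

theorem inv_weight_le (k : ℕ) : (weight k)⁻¹ ≤ ((k : ℝ) + 1) ^ 3 := by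
  have h0 := log_succ_nonneg k
  have h1 : Real.log ((k : ℝ) + 1) ≤ (k + 1) - 1 := Real.log_le_sub_one_of_pos (by positivity)
  have h2 : (1 + Real.log ((k : ℝ) + 1)) ^ 2 ≤ (k + 1) ^ 2 :=
    pow_le_pow_left₀ (by linarith) (by linarith) 2
  rw [weight, inv_inv, pow_succ' _ 2]
  gcongr

theorem weight_le (k : ℕ) : weight k ≤ ((k : ℝ) + 1)⁻¹ := by
  have h0 := log_succ_nonneg k
  rw [weight]
  gcongr
  exact le_mul_of_one_le_right (by positivity) (one_le_pow₀ (by linarith))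

theorem tendsto_weight : Tendsto weight atTop (𝓝 0) := by
  refine squeeze_zero (fun k ↦ (weight_pos k).le) weight_le ?_
  simpa using tendsto_one_div_add_atTop_nhds_zero_nat (𝕜 := ℝ)

theorem weight_antitone : Antitone weight := by
  intro j k hjk
  have h0 := log_succ_nonneg j
  have h : (j : ℝ) ≤ k := by exact_mod_cast hjk
  rw [weight, weight]
  gcongr

/-- Cauchy condensation turns the series into one dominated by a multiple of ∑ 1 / (k + 1)². -/
theorem summable_weight : Summable weight := by
  rw [← summable_condensed_iff_of_nonneg (fun k ↦ (weight_pos k).le)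
    fun j k _ h ↦ weight_antitone h]
  have hs : Summable fun k : ℕ ↦ 4 * (1 / ((k + 1 : ℕ) : ℝ) ^ 2) :=
    ((summable_nat_add_iff 1).2 (Real.summable_one_div_nat_pow.2 one_lt_two)).mul_left 4
  refine hs.of_nonneg_of_le (fun k ↦ mul_nonneg (by positivity) (weight_pos _).le) fun k ↦ ?_
  have h1 : ((k : ℝ) + 1) / 2 ≤ 1 + Real.log ((2 ^ k : ℕ) + 1) := by
    have h2 : k * Real.log 2 ≤ Real.log ((2 ^ k : ℕ) + 1) := by
      rw [← Real.log_pow]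
      push_cast
      gcongr
      linarith
    nlinarith [Real.log_two_gt_d9, (Nat.cast_nonneg k : (0 : ℝ) ≤ k)]
  have h3 : (((2 ^ k : ℕ) : ℝ)) * (((k : ℝ) + 1) / 2) ^ 2 ≤ (weight (2 ^ k))⁻¹ := by
    rw [weight, inv_inv]
    gcongr
    linarith
  calc 2 ^ k * weight (2 ^ k) ≤ 2 ^ k * ((((2 ^ k : ℕ) : ℝ)) * (((k : ℝ) + 1) / 2) ^ 2)⁻¹ := by
        gcongr
        exact (le_inv_comm₀ (weight_pos _) (by positivity)).2 h3
    _ = _ := by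
        push_cast
        field_simp
        norm_num

/-- Makes the exponent 16 ^ k * weight k dominate k, so that factors B ^ k and powers of k are
absorbed by exponentials of it. -/
theorem succ_le_pow_mul_weight (k : ℕ) : (k : ℝ) + 1 ≤ 16 ^ k * weight k := by
  have h1 : (k : ℝ) + 1 ≤ 2 ^ k := by exact_mod_cast Nat.lt_two_pow_self (n := k)
  have h2 : ((k : ℝ) + 1) ^ 4 ≤ 16 ^ k := by
    calc ((k : ℝ) + 1) ^ 4 ≤ (2 ^ k) ^ 4 := by gcongr
      _ = 16 ^ k := by rw [← pow_mul, mul_comm, pow_mul]; norm_num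
  have h3 := inv_weight_le k
  rw [← div_le_iff₀ (weight_pos k), div_eq_mul_inv]
  calc ((k : ℝ) + 1) * (weight k)⁻¹ ≤ (k + 1) * (k + 1) ^ 3 := by gcongr
    _ = ((k : ℝ) + 1) ^ 4 := by ring
    _ ≤ _ := h2

/-- Covers the region |x| ≤ 2 ^ k, where the logarithms may be bounded but the bracket ⟨x⟩ is only
of order 2 ^ k. -/
theorem two_pow_le_mul_weight (k : ℕ) : (2 : ℝ) ^ k ≤ 8 * (4 ^ k * weight k) := by
  have h1 : ((k : ℝ) + 1) ^ 3 ≤ 8 * 2 ^ k := by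
    have h : (k + 1) ^ 3 ≤ 8 * 2 ^ k := by
      rcases lt_or_ge k 3 with hk | hk
      · interval_cases k <;> norm_num
      · induction k, hk using Nat.le_induction with
        | base => norm_num
        | succ k hk ih =>
          rw [pow_succ 2 k]
          nlinarith [mul_le_mul hk hk (by norm_num) (by omega), sq_nonneg (k - 3 : ℤ)]
    exact_mod_cast h
  have h2 : (weight k)⁻¹ ≤ 8 * 2 ^ k := (inv_weight_le k).trans h1
  have h3 : 1 ≤ 8 * 2 ^ k * weight k := by
    have := weight_pos k
    rwa [inv_le_iff_one_le_mul₀ this] at h2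
  have h4 : (4 : ℝ) ^ k = 2 ^ k * 2 ^ k := by rw [← mul_pow]; norm_num
  rw [h4]
  nlinarith [pow_pos (zero_lt_two (α := ℝ)) k]

theorem one_le_logScale {r : ℝ} (hr : 0 ≤ r) : 1 ≤ logScale r := by
  rw [logScale, Real.le_log_iff_exp_le (by positivity)]
  linarith

theorem logScale_mono {r s : ℝ} (hr : 0 ≤ r) (h : r ≤ s) : logScale r ≤ logScale s := by
  rw [logScale, logScale]
  gcongr

theorem le_logScale_two_pow (k : ℕ) : ((k : ℝ) + 1) / 4 ≤ logScale (2 ^ k) := by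
  have h1 : 1 ≤ logScale (2 ^ k) := one_le_logScale (by positivity)
  have h2 : k * Real.log 2 ≤ logScale (2 ^ k) := by
    rw [← Real.log_pow, logScale]
    gcongr
    linarith [Real.exp_pos 1]
  have := Real.log_two_gt_d9
  nlinarith [(Nat.cast_nonneg k : (0 : ℝ) ≤ k)]

/-- By the arithmetic–geometric mean inequality e y ≤ (e + y / 4)²; take logarithms. It is used with
y = k + 1. -/
theorem le_logScale_div_four {y : ℝ} (hy : 0 < y) : (1 + Real.log y) / 2 ≤ logScale (y / 4) := by
  have h1 : Real.exp 1 * y ≤ (Real.exp 1 + y / 4) ^ 2 := by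
    nlinarith [sq_nonneg (Real.exp 1 - y / 4)]
  have h2 := Real.log_le_log (by positivity) h1
  rw [Real.log_mul (by positivity) hy.ne', Real.log_exp, Real.log_pow] at h2
  rw [logScale]
  push_cast at h2
  linarith

theorem japaneseBracket_le {d : ℕ} (x : E d) : japaneseBracket x ≤ 1 + ‖x‖ := by
  rw [japaneseBracket]
  refine Real.sqrt_le_iff.2 ⟨by positivity, ?_⟩
  nlinarith [norm_nonneg x]

/-- The growth condition on the scale, in dyadic form. -/
theorem exists_le_mul_weight {d : ℕ} {ρ : E d → ℝ} {L α : ℝ} (hL : 0 < L) (hα : 2 < α)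
    (hρ : ∀ x, ρ x ≤ L * japaneseBracket x / (logScale (logScale ‖x‖) ^ α * logScale ‖x‖))
    {c : ℝ} (hc : 1 ≤ c) :
    ∃ D, 0 < D ∧ ∀ (k : ℕ) (x : E d), ‖x‖ ≤ c * 4 ^ k → ρ x ≤ D * (4 ^ k * weight k) := by
  refine ⟨32 * L * c + 16 * L, by positivity, fun k x hx ↦ (hρ x).trans ?_⟩
  have hw := weight_pos k
  have hg1 : 1 ≤ logScale ‖x‖ := one_le_logScale (norm_nonneg x)
  have hgg1 : 1 ≤ logScale (logScale ‖x‖) := one_le_logScale (by linarith)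
  -- Lower the exponent from α to 2, the exponent in `weight`.
  have hpow : logScale (logScale ‖x‖) ^ 2 ≤ logScale (logScale ‖x‖) ^ α := by
    rw [← Real.rpow_two]
    exact Real.rpow_le_rpow_of_exponent_le hgg1 hα.le
  have h4 : (1 : ℝ) ≤ 4 ^ k := one_le_pow₀ (by norm_num)
  have hJ := japaneseBracket_le x
  -- For small x the bracket alone suffices; for |x| ≥ 2 ^ k the single and iterated logarithms are
  -- bounded below by multiples of k + 1 and 1 + log (k + 1).
  rcases le_total ‖x‖ (2 ^ k) with h | h
  · have h2 : (1 : ℝ) ≤ 2 ^ k := one_le_pow₀ (by norm_num)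
    have hden : 1 ≤ logScale (logScale ‖x‖) ^ α * logScale ‖x‖ := by nlinarith
    have hnum : 0 ≤ L * japaneseBracket x := mul_nonneg hL.le (Real.sqrt_nonneg _)
    calc _ ≤ L * japaneseBracket x := div_le_self hnum hden
      _ ≤ L * (2 * 2 ^ k) := by gcongr; linarith
      _ ≤ L * (2 * (8 * (4 ^ k * weight k))) := by gcongr; exact two_pow_le_mul_weight k
      _ = 16 * L * (4 ^ k * weight k) := by ring
      _ ≤ _ := by
        gcongr
        nlinarith
  · have hg : ((k : ℝ) + 1) / 4 ≤ logScale ‖x‖ :=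
      (le_logScale_two_pow k).trans (logScale_mono (by positivity) h)
    have hgg : (1 + Real.log ((k : ℝ) + 1)) / 2 ≤ logScale (logScale ‖x‖) :=
      (le_logScale_div_four (by positivity)).trans (logScale_mono (by positivity) hg)
    have hlog := log_succ_nonneg k
    have hden : (weight k)⁻¹ / 16 ≤ logScale (logScale ‖x‖) ^ α * logScale ‖x‖ := by
      calc (weight k)⁻¹ / 16 = ((1 + Real.log ((k : ℝ) + 1)) / 2) ^ 2 * (((k : ℝ) + 1) / 4) := by
            rw [weight, inv_inv]; ring
        _ ≤ _ := by
          refine mul_le_mul (le_trans ?_ hpow) hg (by positivity) (by positivity)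
          gcongr
    calc _ ≤ L * (2 * c * 4 ^ k) / ((weight k)⁻¹ / 16) := by
          gcongr
          nlinarith
      _ = 32 * L * c * (4 ^ k * weight k) := by
          field_simp
          ring
      _ ≤ _ := by
          gcongr
          linarith

end

/-! ### The spectral inequality. -/

section

open Filter Topology

/-- Since n ^ n / n! ≤ e ^ n, the quotient is at most (e y / n) ^ n, and e y / n ≤ 1 / e by
hypothesis. -/
theorem mul_pow_div_factorial_le {y : ℝ} (hy : 0 ≤ y) {n : ℕ} (hn : 1 ≤ n)
    (h : Real.exp 1 ^ 2 * y ≤ n) : y ^ n / n.factorial ≤ Real.exp (-n) := by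
  have hn0 : (0 : ℝ) < n := by exact_mod_cast hn
  have h1 := Real.pow_div_factorial_le_exp n hn0.le n
  have h2 : y / n ≤ Real.exp (-2) := by
    rw [div_le_iff₀ hn0, Real.exp_neg, inv_mul_eq_div, le_div_iff₀ (Real.exp_pos _),
      show (2 : ℝ) = (2 : ℕ) * 1 by norm_num, Real.exp_nat_mul]
    linarith
  calc y ^ n / n.factorial = (y / n) ^ n * (n ^ n / n.factorial) := by
        rw [div_pow]
        field_simp
    _ ≤ Real.exp (-2) ^ n * Real.exp n := by gcongr
    _ = Real.exp (-n) := by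
        rw [← Real.exp_nat_mul, ← Real.exp_add]
        congr 1
        ring

/-- A constant times a geometric prefactor is absorbed by a large exponential. -/
theorem exists_mul_pow_mul_exp_neg_le (A : ℝ) {B : ℝ} (hB : 1 ≤ B) :
    ∃ K, 0 < K ∧ ∀ (k : ℕ) (X s : ℝ), 1 ≤ X → k ≤ X → K * X ≤ s →
      A * B ^ k * Real.exp (-s) ≤ 1 / 2 := by
  refine ⟨|A| + Real.log B + 1, ?_, fun k X s hX hk hs ↦ ?_⟩
  · have := Real.log_nonneg hB
    positivity
  have hlog := Real.log_nonneg hB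
  have h1 : A ≤ Real.exp (|A| * X) := by
    have := Real.add_one_le_exp (|A| * X)
    nlinarith [le_abs_self A, abs_nonneg A]
  have h2 : B ^ k ≤ Real.exp (Real.log B * X) := by
    rw [← Real.exp_log (lt_of_lt_of_le one_pos hB), ← Real.exp_nat_mul, Real.log_exp, mul_comm]
    gcongr
  have h3 : (2 : ℝ) ≤ Real.exp X := by linarith [Real.add_one_le_exp X]
  calc A * B ^ k * Real.exp (-s)
      ≤ Real.exp (|A| * X) * Real.exp (Real.log B * X) * Real.exp (-s) := by gcongr
    _ ≤ Real.exp (-X) := by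
        rw [← Real.exp_add, ← Real.exp_add]
        gcongr
        linarith
    _ ≤ 1 / 2 := by
        rw [Real.exp_neg, one_div]
        gcongr

/-- The pointwise derivative bounds at the spectral scale `16 ^ k`. -/
theorem exists_norm_iterate_dirDeriv_apply_le_pow (d : ℕ) :
    ∃ C, 0 < C ∧ ∀ (k n : ℕ), n + 1 ≤ 16 ^ k → ∀ f ∈ hermiteSpace d (16 ^ k + 1),
      ∀ v : E d, ‖v‖ ≤ 1 → ∀ x, ‖(dirDeriv v)^[n + 1] f x‖ ≤
        C * (16 ^ (d + 1)) ^ k * (d * (4 + d) * 4 ^ k) ^ (n + 1) * ‖toL2 d f‖ := by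
  obtain ⟨C, hC, h⟩ := exists_norm_iterate_dirDeriv_apply_le d
  refine ⟨C * (1 + d * (4 + 4 * (d + 1) + d)) ^ (d + 1), by positivity, ?_⟩
  intro k n hn f hf v hv x
  refine (h _ _ f hf v hv x).trans ?_
  -- With at most 16 ^ k derivatives the degree stays O(16 ^ k), so each derivative costs O(4 ^ k).
  have hn' : (n : ℝ) + 1 ≤ 16 ^ k := by exact_mod_cast hn
  have h1 : (1 : ℝ) ≤ 16 ^ k := one_le_pow₀ (by norm_num)
  have hd : (0 : ℝ) ≤ d := Nat.cast_nonneg d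
  have e1 : (1 + d * (2 * ((16 ^ k : ℕ) + (n + 1 : ℕ) + 2 * (d + 1)) + d) : ℝ) ≤
      (1 + d * (4 + 4 * (d + 1) + d)) * 16 ^ k := by
    push_cast
    have e2 : (2 * ((16 : ℝ) ^ k + (n + 1) + 2 * (d + 1)) + d : ℝ) ≤
        (4 + 4 * (d + 1) + d) * 16 ^ k := by nlinarith
    nlinarith [mul_le_mul_of_nonneg_left e2 hd]
  have e3 : √(2 * ((16 ^ k : ℕ) + (n + 1 : ℕ)) + d) ≤ (4 + d) * 4 ^ k := by
    refine Real.sqrt_le_iff.2 ⟨by positivity, ?_⟩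
    have e4 : ((4 : ℝ) ^ k) ^ 2 = 16 ^ k := by rw [← pow_mul, mul_comm, pow_mul]; norm_num
    push_cast
    rw [mul_pow, e4]
    nlinarith
  calc _ ≤ C * ((1 + d * (4 + 4 * (d + 1) + d)) * 16 ^ k) ^ (d + 1) *
        (d * ((4 + d) * 4 ^ k)) ^ (n + 1) * ‖toL2 d f‖ := by gcongr
    _ = _ := by
      rw [mul_pow _ ((16 : ℝ) ^ k), ← pow_mul 16 k, mul_comm k, pow_mul 16 (d + 1)]
      ring

set_option maxHeartbeats 1000000 in
/-- The spectral inequality for the harmonic oscillator. -/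
theorem exists_spectral_inequality {d : ℕ} (hd : 1 ≤ d) {ω : Set (E d)} (hω : MeasurableSet ω)
    {ρ : E d → ℝ} {σ : ℝ} (hσ : 0 < σ) (hσ1 : σ ≤ 1) (hρ0 : ∀ x, 0 < ρ x)
    (hgeom : ∀ x, ENNReal.ofReal σ * volume (Metric.ball x (ρ x)) ≤
      volume (ω ∩ Metric.ball x (ρ x)))
    (hρ : ∀ c : ℝ, 1 ≤ c → ∃ D, 0 < D ∧ ∀ (k : ℕ) (x : E d), ‖x‖ ≤ c * 4 ^ k →
      ρ x ≤ D * (4 ^ k * weight k)) :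
    ∃ C, 0 < C ∧ ∀ᶠ k in atTop, ∀ f ∈ hermiteSpace d (16 ^ k + 1),
      ‖toL2 d f‖ ^ 2 ≤ Real.exp (C * (16 ^ k * weight k)) * ∫ x in ω, ‖f x‖ ^ 2 := by
  have hd1 : (1 : ℝ) ≤ d := by exact_mod_cast hd
  -- Chosen so that the radius R = c * 4 ^ k satisfies 4 (2 · 16 ^ k + d) ≤ R ^ 2. The growth bound
  -- is taken with 2 * c because a ball about a point of the R-ball is used, of radius less than R.
  set c : ℝ := 2 * (d + 2) with hc
  obtain ⟨D, hD, hρD⟩ := hρ (2 * c) (by linarith)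
  obtain ⟨C₀, hC₀, hder⟩ := exists_norm_iterate_dirDeriv_apply_le_pow d
  set γ : ℝ := σ / 10 ^ d with hγdef
  have hγ : 0 < γ := by positivity
  have hγ1 : γ ≤ 1 := by
    rw [hγdef, div_le_one (by positivity)]
    exact hσ1.trans (one_le_pow₀ (by norm_num))
  set a : ℝ := 8 * d * Real.exp 1 / γ with ha
  have ha1 : 1 ≤ a := by
    rw [ha, one_le_div hγ]
    have := Real.add_one_le_exp (1 : ℝ)
    nlinarith
  have ha0 : 0 < a := by linarith
  set v := ballVolume d with hv
  have hv0 : 0 < v := ballVolume_pos d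
  set b : ℝ := d * (4 + d) * (2 * D) with hb
  have hb0 : 0 < b := by positivity
  set A : ℝ := C₀ * (1 + 2 * (c ^ d * v)) * b with hA
  set B : ℝ := 16 ^ (d + 1) * 4 ^ d * 16 with hB
  have hB1 : 1 ≤ B := by
    have h1 : (1 : ℝ) ≤ 16 ^ (d + 1) := one_le_pow₀ (by norm_num)
    have h2 : (1 : ℝ) ≤ 4 ^ d := one_le_pow₀ (by norm_num)
    nlinarith
  obtain ⟨K₀, hK₀, hK⟩ := exists_mul_pow_mul_exp_neg_le A hB1
  -- K₀ absorbs the prefactor A * B ^ k; the second term makes the Taylor error beat the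
  -- interpolation factor a ^ n, leaving e^{-n}.
  set K : ℝ := K₀ + Real.exp 1 ^ 2 * (a * b) with hKdef
  have hKpos : 0 < K := by positivity
  obtain ⟨C₁, hC₁, hC₁b⟩ : ∃ C₁, 0 < C₁ ∧ ∀ (k : ℕ) (X : ℝ), 1 ≤ X → (k : ℝ) + 1 ≤ X →
      64 / γ * (c / (2 * D) * ((k : ℝ) + 1) ^ 3) ^ d ≤ Real.exp (C₁ * X) := by
    refine ⟨|64 / γ * (c / (2 * D)) ^ d| + 3 * d, by positivity, fun k X hX hk ↦ ?_⟩
    have h1 : 64 / γ * (c / (2 * D)) ^ d ≤ Real.exp (|64 / γ * (c / (2 * D)) ^ d| * X) := by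
      have := Real.add_one_le_exp (|64 / γ * (c / (2 * D)) ^ d| * X)
      nlinarith [le_abs_self (64 / γ * (c / (2 * D)) ^ d), abs_nonneg (64 / γ * (c / (2 * D)) ^ d)]
    have h2 : ((k : ℝ) + 1) ^ (3 * d) ≤ Real.exp (3 * d * X) := by
      have h3 : (k : ℝ) + 1 ≤ Real.exp X := by linarith [Real.add_one_le_exp X]
      calc ((k : ℝ) + 1) ^ (3 * d) ≤ Real.exp X ^ (3 * d) := by gcongr
        _ = _ := by
          rw [← Real.exp_nat_mul]
          push_cast
          rfl
    rw [mul_pow, ← pow_mul, ← mul_assoc, add_mul, Real.exp_add]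
    exact mul_le_mul h1 h2 (by positivity) (Real.exp_pos _).le
  refine ⟨C₁ + 2 * Real.log a * (K + 1), by have := Real.log_nonneg ha1; positivity, ?_⟩
  clear_value a A B K v
  have hev1 : ∀ᶠ k in atTop, D * weight k < c := by
    have := tendsto_weight.const_mul D
    rw [mul_zero] at this
    exact this.eventually_lt_const (by positivity)
  -- Keeps the Taylor degree n, about K * weight k * 16 ^ k, within the range n + 1 ≤ 16 ^ k of the
  -- derivative bounds.
  have hev2 : ∀ᶠ k in atTop, K * weight k < 1 / 2 := by
    have := tendsto_weight.const_mul K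
    rw [mul_zero] at this
    exact this.eventually_lt_const (by positivity)
  filter_upwards [hev1, hev2, eventually_ge_atTop 1] with k hk1 hk2 hk3 f hf
  have hw := weight_pos k
  set X : ℝ := 16 ^ k * weight k with hX
  have hkX : (k : ℝ) + 1 ≤ X := succ_le_pow_mul_weight k
  have hX1 : 1 ≤ X := by linarith [(Nat.cast_nonneg k : (0 : ℝ) ≤ k)]
  set r : ℝ := D * (4 ^ k * weight k) with hr
  have hr0 : 0 < r := by positivity
  set R : ℝ := c * 4 ^ k with hR
  have hR0 : 0 < R := by positivity
  have h16 : ((4 : ℝ) ^ k) ^ 2 = 16 ^ k := by rw [← pow_mul, mul_comm, pow_mul]; norm_num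
  have h1le : (1 : ℝ) ≤ 16 ^ k := one_le_pow₀ (by norm_num)
  obtain ⟨x₀, hx₀, hfx₀⟩ := exists_norm_sq_le_mul_norm_apply hf hR0 (by
    rw [hR, mul_pow, h16, hc]
    push_cast
    nlinarith [mul_le_mul_of_nonneg_left h1le (zero_le_one.trans hd1), mul_nonneg (sq_nonneg (d : ℝ))
      (zero_le_one.trans h1le)])
  rw [← hv] at hfx₀
  have hrR : r < R := by
    rw [hr, hR]
    have h4 : (0 : ℝ) < 4 ^ k := by positivity
    calc D * (4 ^ k * weight k) = D * weight k * 4 ^ k := by ring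
      _ < c * 4 ^ k := mul_lt_mul_of_pos_right hk1 h4
  have hthick := thick_at_larger_scale hω.nullMeasurableSet (ρ := ρ) hσ (x₀ := x₀) (r := r)
    (fun x hx ↦ ⟨hρ0 x, hρD k x (by
      rw [mem_ball_zero_iff] at hx₀
      rw [mem_ball_iff_norm] at hx
      have : ‖x‖ ≤ ‖x - x₀‖ + ‖x₀‖ := by simpa using norm_add_le (x - x₀) x₀
      linarith)⟩) (fun x _ ↦ hgeom x)
  set n : ℕ := ⌈K * X⌉₊ with hn
  have hKX : 0 < K * X := by positivity
  have hn1 : 1 ≤ n := Nat.one_le_iff_ne_zero.2 (Nat.ceil_pos.2 hKX).ne'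
  have hnle : K * X ≤ n := Nat.le_ceil _
  have hnlt : (n : ℝ) < K * X + 1 := Nat.ceil_lt_add_one hKX.le
  have hnN : n + 1 ≤ 16 ^ k := by
    have h2 : (16 : ℝ) ≤ 16 ^ k := le_self_pow₀ (by norm_num) (by omega)
    have : (n : ℝ) + 1 ≤ 16 ^ k := by
      have h3 : K * X = K * weight k * 16 ^ k := by rw [hX]; ring
      have h4 := mul_le_mul_of_nonneg_right hk2.le (zero_le_one.trans h1le)
      linarith
    exact_mod_cast this
  -- The choice of x₀ controls the full norm by |f x₀| at the price of a volume factor geometric in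
  -- k. Global derivative bounds thus become relative to |f x₀|.
  have hfle : ‖toL2 d f‖ ≤ (1 + 2 * (c ^ d * v)) * (4 ^ d) ^ k * ‖f x₀‖ := by
    have h4 : (1 : ℝ) ≤ (4 ^ d) ^ k := one_le_pow₀ (one_le_pow₀ (by norm_num))
    have hcv : 0 < c ^ d * v := by positivity
    refine abs_le_of_sq_le_sq' ?_ (by positivity) |>.2
    refine hfx₀.trans ?_
    rw [mul_pow _ ‖f x₀‖]
    gcongr
    rw [hR, mul_pow, ← pow_mul, mul_comm k, pow_mul]
    set y : ℝ := (4 ^ d) ^ k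
    set z : ℝ := c ^ d * v
    have : 2 * (c ^ d * y * v) = 2 * z * y := by ring
    rw [this, mul_pow]
    nlinarith [mul_nonneg hcv.le (sub_nonneg.2 h4), mul_pos hcv hcv]
  have hsmall : a ^ n * (C₀ * (16 ^ (d + 1)) ^ k * (d * (4 + d) * 4 ^ k) ^ (n + 1) * ‖toL2 d f‖ *
      (2 * r) ^ (n + 1) / n.factorial) ≤ ‖f x₀‖ / 2 := by
    have e1 : (d * (4 + d) * 4 ^ k : ℝ) ^ (n + 1) * (2 * r) ^ (n + 1) = (b * X) ^ (n + 1) := by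
      rw [← mul_pow, hr, hb, hX, ← h16]
      ring
    have e2 : (a * b * X) ^ n / n.factorial ≤ Real.exp (-n) := by
      refine mul_pow_div_factorial_le (by positivity) hn1 (le_trans ?_ hnle)
      rw [hKdef]
      nlinarith
    have e3 : X ≤ 16 ^ k := by
      have : weight k ≤ 1 := (weight_le k).trans (inv_le_one_of_one_le₀ (by linarith))
      rw [hX]
      exact mul_le_of_le_one_right (by positivity) this
    have e4 := hK k X n hX1 (by linarith) (by
      refine le_trans ?_ hnle
      gcongr
      rw [hKdef]
      have : 0 < Real.exp 1 ^ 2 * (a * b) := by positivity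
      linarith)
    calc _ = C₀ * (16 ^ (d + 1)) ^ k * (b * X) * ((a * b * X) ^ n / n.factorial) * ‖toL2 d f‖ := by
          rw [mul_pow (a * b) X, mul_pow a b]
          rw [pow_succ (b * X), mul_pow b X] at e1
          linear_combination (a ^ n * C₀ * (16 ^ (d + 1)) ^ k * ‖toL2 d f‖ / n.factorial) * e1
      _ ≤ C₀ * (16 ^ (d + 1)) ^ k * (b * 16 ^ k) * Real.exp (-n) *
          ((1 + 2 * (c ^ d * v)) * (4 ^ d) ^ k * ‖f x₀‖) := by gcongr
      _ = A * B ^ k * Real.exp (-n) * ‖f x₀‖ := by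
          rw [hA, hB, mul_pow, mul_pow]
          ring
      _ ≤ 1 / 2 * ‖f x₀‖ := by gcongr
      _ = _ := by ring
  have hmain := norm_sq_apply_le_setIntegral hd hω f (x₀ := x₀) (l := 2 * r) (γ := γ)
    (by positivity) hγ hn1 hthick (fun w hw x ↦ hder k n hnN f hf w hw x)
    (by rw [← ha]; exact hsmall)
  rw [← ha, ← hv] at hmain
  set I := ∫ x in ω, ‖f x‖ ^ 2 with hI
  have hI0 : 0 ≤ I := integral_nonneg fun x ↦ by positivity
  -- The ratio of the two radii is a multiple of the inverse weight, hence at most polynomial in k.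
  have hRr : R = c / (2 * D) * (weight k)⁻¹ * (2 * r) := by
    rw [hR, hr]
    field_simp
  have hlog : (a ^ n) ^ 2 ≤ Real.exp (2 * Real.log a * (K + 1) * X) := by
    have hla := Real.log_nonneg ha1
    rw [← pow_mul]
    calc a ^ (n * 2) = Real.exp ((n * 2 : ℕ) * Real.log a) := by
          rw [Real.exp_nat_mul, Real.exp_log ha0]
      _ ≤ _ := by
        refine Real.exp_le_exp.2 ?_
        push_cast
        have : (n : ℝ) ≤ (K + 1) * X := by nlinarith
        nlinarith
  calc ‖toL2 d f‖ ^ 2 ≤ 2 * (R ^ d * v) * ‖f x₀‖ ^ 2 := hfx₀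
    _ = 2 / γ * (c / (2 * D) * (weight k)⁻¹) ^ d * (‖f x₀‖ ^ 2 * (γ * ((2 * r) ^ d * v))) := by
        rw [hRr, mul_pow _ (2 * r)]
        field_simp
    _ ≤ 2 / γ * (c / (2 * D) * ((k : ℝ) + 1) ^ 3) ^ d * (32 * (a ^ n) ^ 2 * I) := by
        gcongr
        exact inv_weight_le k
    _ = 64 / γ * (c / (2 * D) * ((k : ℝ) + 1) ^ 3) ^ d * (a ^ n) ^ 2 * I := by ring
    _ ≤ Real.exp (C₁ * X) * Real.exp (2 * Real.log a * (K + 1) * X) * I := by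
        gcongr
        exact hC₁b k X hX1 hkX
    _ = _ := by
        rw [← Real.exp_add]
        ring_nf

end

/-! ### Steering the low modes on one time interval. -/

section

open Filter Topology

/-- Multiplication by the indicator function of `ω` on `L²`. -/
def restrictionLinear {d : ℕ} {ω : Set (E d)} (hω : MeasurableSet ω) : L2 d →ₗ[ℂ] L2 d where
  toFun u := ((Lp.memLp u).indicator hω).toLp
  map_add' u v := by
    rw [← MemLp.toLp_add]
    refine MemLp.toLp_congr _ _ ?_
    filter_upwards [Lp.coeFn_add u v] with x hx
    by_cases h : x ∈ ω
    · simpa only [indicator_of_mem h, Pi.add_apply] using hx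
    · simp only [indicator_of_notMem h, Pi.add_apply, add_zero]
  map_smul' c u := by
    rw [RingHom.id_apply, ← MemLp.toLp_const_smul]
    refine MemLp.toLp_congr _ _ ?_
    filter_upwards [Lp.coeFn_smul c u] with x hx
    by_cases h : x ∈ ω
    · simpa only [indicator_of_mem h, Pi.smul_apply] using hx
    · simp only [indicator_of_notMem h, Pi.smul_apply, smul_zero]

theorem restrictionLinear_apply {d : ℕ} {ω : Set (E d)} (hω : MeasurableSet ω) (u : L2 d) :
    restrictionLinear hω u = ((Lp.memLp u).indicator hω).toLp := rfl

theorem restrictionLinear_ae {d : ℕ} {ω : Set (E d)} (hω : MeasurableSet ω) (u : L2 d) :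
    restrictionLinear hω u =ᵐ[volume] ω.indicator u := by
  rw [restrictionLinear_apply]
  exact MemLp.coeFn_toLp _

/-- Multiplication by the indicator function of `ω` on `L²`, as a bounded operator. -/
def restriction {d : ℕ} {ω : Set (E d)} (hω : MeasurableSet ω) : L2 d →L[ℂ] L2 d :=
  (restrictionLinear hω).mkContinuous 1 fun u ↦ by
    rw [one_mul]
    refine Lp.norm_le_norm_of_ae_le ?_
    filter_upwards [restrictionLinear_ae hω u] with x hx
    rw [hx]
    exact norm_indicator_le_norm_self _ _

theorem restriction_ae {d : ℕ} {ω : Set (E d)} (hω : MeasurableSet ω) (u : L2 d) :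
    restriction hω u =ᵐ[volume] ω.indicator u :=
  restrictionLinear_ae hω u

theorem norm_restriction_le {d : ℕ} {ω : Set (E d)} (hω : MeasurableSet ω) (u : L2 d) :
    ‖restriction hω u‖ ≤ ‖u‖ := by
  refine Lp.norm_le_norm_of_ae_le ?_
  filter_upwards [restriction_ae hω u] with x hx
  rw [hx]
  exact norm_indicator_le_norm_self _ _

theorem inner_restriction {d : ℕ} {ω : Set (E d)} (hω : MeasurableSet ω) (u : L2 d) :
    inner ℂ u (restriction hω u) = inner ℂ (restriction hω u) (restriction hω u) := by
  rw [L2.inner_def, L2.inner_def]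
  refine integral_congr_ae ?_
  filter_upwards [restriction_ae hω u] with x hx
  rw [hx]
  by_cases h : x ∈ ω <;> simp [h]

theorem norm_sq_restriction_toL2 {d : ℕ} {ω : Set (E d)} (hω : MeasurableSet ω) (f : 𝓢(E d, ℂ)) :
    ‖restriction hω (toL2 d f)‖ ^ 2 = ∫ x in ω, ‖f x‖ ^ 2 := by
  have h := inner_self_eq_norm_sq_to_K (𝕜 := ℂ) (restriction hω (toL2 d f))
  rw [← inner_restriction, inner_toL2_left] at h
  have h2 : ∫ x, (starRingEnd ℂ) (f x) * restriction hω (toL2 d f) x =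
      ((∫ x in ω, ‖f x‖ ^ 2 : ℝ) : ℂ) := by
    rw [← integral_complex_ofReal, ← integral_indicator hω]
    refine integral_congr_ae ?_
    have h3 : toL2 d f =ᵐ[volume] f := by
      rw [toL2_eq]
      exact f.coeFn_toLp 2 volume
    filter_upwards [restriction_ae hω (toL2 d f), h3] with x hx hx'
    rw [hx]
    by_cases hxω : x ∈ ω
    · simp [hxω, hx', Complex.conj_mul']
    · simp [hxω]
  rw [h2] at h
  have h4 : ((∫ x in ω, ‖f x‖ ^ 2 : ℝ) : ℂ) = ((‖restriction hω (toL2 d f)‖ ^ 2 : ℝ) : ℂ) := by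
    rw [h]
    push_cast
    rfl
  exact_mod_cast h4.symm

/-- The range of the spectral projection. -/
def spectralRange (d N : ℕ) : Submodule ℂ (L2 d) := LinearMap.range (spectralProjection d N).toLinearMap

theorem spectralRange_le (d N : ℕ) : spectralRange d N ≤ hermiteL2 d N := by
  rintro _ ⟨u, rfl⟩
  exact spectralProjection_mem_hermiteL2 u

instance finiteDimensional_spectralRange (d N : ℕ) : FiniteDimensional ℂ (spectralRange d N) :=
  Submodule.finiteDimensional_of_le (spectralRange_le d N)

theorem spectralProjection_mem {d N : ℕ} (u : L2 d) : spectralProjection d N u ∈ spectralRange d N :=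
  ⟨u, rfl⟩

theorem spectralProjection_eq_self {d N : ℕ} {u : L2 d} (hu : u ∈ spectralRange d N) :
    spectralProjection d N u = u := by
  obtain ⟨v, rfl⟩ := hu
  exact spectralProjection_idem v

/-- A right inverse of the observation from `ω` on the low modes. -/
theorem exists_observation_inverse {d N : ℕ} {ω : Set (E d)} (hω : MeasurableSet ω) {κ : ℝ}
    (hκ : ∀ u ∈ hermiteL2 d N, ‖u‖ ≤ κ * ‖restriction hω u‖) :
    ∃ J : L2 d →ₗ[ℂ] L2 d, ∀ u, J u ∈ spectralRange d N ∧
      spectralProjection d N (restriction hω (J u)) = spectralProjection d N u ∧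
      ‖J u‖ ≤ κ ^ 2 * ‖u‖ := by
  set P := spectralProjection d N
  set χ := restriction hω
  -- The compression of the indicator to the low modes is coercive: ‖u‖² ≤ κ² ‖χ u‖² = κ² ⟨u, P χ
  -- u⟩. It is therefore injective, and bijective by finite dimension.
  have hcoer : ∀ u ∈ spectralRange d N, ‖u‖ ≤ κ ^ 2 * ‖P (χ u)‖ := by
    intro u hu
    have h1 := hκ u (spectralRange_le d N hu)
    have h2 : ‖χ u‖ ^ 2 ≤ ‖u‖ * ‖P (χ u)‖ := by
      have h3 : inner ℂ u (P (χ u)) = inner ℂ (χ u) (χ u) := by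
        rw [← inner_spectralProjection_left, spectralProjection_eq_self hu, inner_restriction]
      have h4 := norm_inner_le_norm (𝕜 := ℂ) u (P (χ u))
      rw [h3, inner_self_eq_norm_sq_to_K] at h4
      simpa using h4
    rcases (norm_nonneg u).eq_or_lt with h0 | h0
    · rw [← h0]
      positivity
    · have h5 : ‖u‖ ^ 2 ≤ κ ^ 2 * ‖χ u‖ ^ 2 := by
        rw [← mul_pow]
        gcongr
      have h6 : ‖u‖ * ‖u‖ ≤ ‖u‖ * (κ ^ 2 * ‖P (χ u)‖) := by nlinarith [sq_nonneg κ]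
      exact le_of_mul_le_mul_left h6 h0
  let G : spectralRange d N →ₗ[ℂ] spectralRange d N :=
    (P.toLinearMap ∘ₗ χ.toLinearMap ∘ₗ (spectralRange d N).subtype).codRestrict _
      fun u ↦ spectralProjection_mem _
  have hG : ∀ u, (G u : L2 d) = P (χ u) := fun u ↦ rfl
  have hinj : Function.Injective G := by
    rw [injective_iff_map_eq_zero]
    intro u hu
    have h1 := hcoer u u.2
    rw [← hG, hu] at h1
    simpa using h1
  let e := LinearEquiv.ofInjectiveEndo G hinj
  let Q : L2 d →ₗ[ℂ] spectralRange d N := P.toLinearMap.codRestrict _ fun u ↦ spectralProjection_mem _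
  refine ⟨(spectralRange d N).subtype ∘ₗ e.symm.toLinearMap ∘ₗ Q, fun u ↦ ?_⟩
  have h1 : P (χ (e.symm (Q u) : L2 d)) = P u := by
    rw [← hG]
    exact congrArg Subtype.val (e.apply_symm_apply (Q u))
  refine ⟨(e.symm (Q u)).2, h1, ?_⟩
  have h2 := hcoer _ (e.symm (Q u)).2
  rw [h1] at h2
  exact h2.trans (by gcongr; exact norm_spectralProjection_le u)

theorem continuous_oscillatorSemigroup_uncurry (d : ℕ) :
    Continuous fun p : ℝ × L2 d ↦ oscillatorSemigroup d p.1 p.2 := by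
  refine continuous_iff_continuousAt.2 fun ⟨t₀, u₀⟩ ↦ ?_
  have h1 : Tendsto (fun p : ℝ × L2 d ↦ oscillatorSemigroup d p.1 (p.2 - u₀)) (𝓝 (t₀, u₀)) (𝓝 0) := by
    refine squeeze_zero_norm (fun p ↦ norm_oscillatorSemigroup_le _ _) ?_
    have h : Continuous fun p : ℝ × L2 d ↦ ‖p.2 - u₀‖ := by fun_prop
    simpa using h.tendsto (t₀, u₀)
  have h2 : Tendsto (fun p : ℝ × L2 d ↦ oscillatorSemigroup d p.1 u₀) (𝓝 (t₀, u₀))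
      (𝓝 (oscillatorSemigroup d t₀ u₀)) :=
    ((continuous_oscillatorSemigroup u₀).comp continuous_fst).tendsto _
  have h3 := h1.add h2
  simp only [map_sub, sub_add_cancel, zero_add] at h3
  exact h3

/-- A continuous curve in a finite-dimensional subspace of `L²` is given by a jointly measurable
function. -/
theorem exists_jointly_measurable {d : ℕ} (V : Submodule ℂ (L2 d)) [FiniteDimensional ℂ V]
    {w : ℝ → L2 d} (hwc : Continuous w) (hwmem : ∀ s, w s ∈ V) :
    ∃ h : ℝ × E d → ℂ, StronglyMeasurable h ∧ ∀ s, (fun x ↦ h (s, x)) =ᵐ[volume] w s := by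
  let b := stdOrthonormalBasis ℂ V
  let W : ℝ → V := fun s ↦ ⟨w s, hwmem s⟩
  have hWc : Continuous W := hwc.subtype_mk _
  let h : ℝ × E d → ℂ := fun p ↦ ∑ i, inner ℂ (b i) (W p.1) * (b i : L2 d) p.2
  have hhm : StronglyMeasurable h := by
    refine Finset.stronglyMeasurable_fun_sum _ fun i _ ↦ ?_
    refine StronglyMeasurable.mul ?_ ?_
    · exact (Continuous.inner continuous_const (hWc.comp continuous_fst)).stronglyMeasurable
    · exact (Lp.stronglyMeasurable (b i : L2 d)).comp_measurable measurable_snd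
  have hhw : ∀ s, (fun x ↦ h (s, x)) =ᵐ[volume] w s := by
    intro s
    have h1 : w s = ∑ i, inner ℂ (b i) (W s) • (b i : L2 d) := by
      have := congrArg Subtype.val (b.sum_repr' (W s))
      simpa only [Submodule.coe_sum, Submodule.coe_smul] using this.symm
    have h2 := Lp.coeFn_finsetSum Finset.univ (fun i ↦ inner ℂ (b i) (W s) • (b i : L2 d))
    have h3 : ∀ᵐ x, ∀ i, (inner ℂ (b i) (W s) • (b i : L2 d) : L2 d) x =
        inner ℂ (b i) (W s) * (b i : L2 d) x := by
      rw [ae_all_iff]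
      intro i
      filter_upwards [Lp.coeFn_smul (inner ℂ (b i) (W s)) (b i : L2 d)] with x hx
      exact hx
    rw [h1]
    filter_upwards [h2, h3] with x hx hx'
    rw [hx, Finset.sum_apply]
    exact Finset.sum_congr rfl fun i _ ↦ (hx' i).symm
  exact ⟨h, hhm, hhw⟩

/-- The low modes are steered to zero in time `τ`. -/
theorem exists_low_mode_control {d N : ℕ} {ω : Set (E d)} (hω : MeasurableSet ω) {κ τ : ℝ}
    (hτ : 0 < τ) (hκ : ∀ u ∈ hermiteL2 d N, ‖u‖ ≤ κ * ‖restriction hω u‖) (y : L2 d) :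
    ∃ w : ℝ → L2 d, Continuous w ∧ (∀ s, w s ∈ spectralRange d N) ∧
      (∀ s, ‖w s‖ ≤ κ ^ 2 / τ * ‖y‖) ∧
      ∀ s ∈ Icc 0 τ, spectralProjection d N (oscillatorSemigroup d (τ - s) (restriction hω (w s))) =
        (-(τ⁻¹ : ℝ) : ℂ) • spectralProjection d N (oscillatorSemigroup d τ y) := by
  obtain ⟨J, hJ⟩ := exists_observation_inverse hω hκ
  have hJc : Continuous J := (J.mkContinuous (κ ^ 2) fun u ↦ (hJ u).2.2).continuous
  -- The control inverts the observation along the free trajectory. As P commutes with the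
  -- semigroup, its contribution at time τ is independent of s, and integration cancels the low
  -- modes exactly.
  refine ⟨fun s ↦ (-(τ⁻¹ : ℝ) : ℂ) • J (oscillatorSemigroup d s y), ?_, fun s ↦ ?_, fun s ↦ ?_,
    fun s hs ↦ ?_⟩
  · have h1 : Continuous fun s ↦ J (oscillatorSemigroup d s y) :=
      hJc.comp (continuous_oscillatorSemigroup y)
    exact h1.const_smul (-(τ⁻¹ : ℝ) : ℂ)
  · exact Submodule.smul_mem _ _ (hJ _).1
  · have h1 : ‖J (oscillatorSemigroup d s y)‖ ≤ κ ^ 2 * ‖y‖ :=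
      (hJ _).2.2.trans (mul_le_mul_of_nonneg_left (norm_oscillatorSemigroup_le s y) (sq_nonneg κ))
    have h2 : ‖(-(τ⁻¹ : ℝ) : ℂ)‖ = τ⁻¹ := by
      rw [norm_neg, Complex.norm_real, Real.norm_eq_abs, abs_of_pos (by positivity)]
    rw [norm_smul, h2, div_mul_eq_mul_div, div_eq_inv_mul]
    exact mul_le_mul_of_nonneg_left h1 (by positivity)
  · rw [map_smul, map_smul, map_smul]
    congr 1
    rw [spectralProjection_oscillatorSemigroup, (hJ _).2.1, ← spectralProjection_oscillatorSemigroup,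
      ← oscillatorSemigroup_add (by linarith [hs.2]) hs.1, sub_add_cancel]

theorem continuous_oscillatorSemigroup_restriction {d : ℕ} {ω : Set (E d)} (hω : MeasurableSet ω)
    {w : ℝ → L2 d} (hw : Continuous w) (t : ℝ) :
    Continuous fun s ↦ oscillatorSemigroup d (t - s) (restriction hω (w s)) := by
  have h1 : Continuous fun s ↦ restriction hω (w s) := (restriction hω).continuous.comp hw
  have h2 : Continuous fun s : ℝ ↦ ((t - s, restriction hω (w s)) : ℝ × L2 d) :=
    (continuous_const.sub continuous_id).prodMk h1
  have h3 := (continuous_oscillatorSemigroup_uncurry d).comp' h2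
  exact h3

theorem norm_oscillatorSemigroup_restriction_le {d : ℕ} {ω : Set (E d)} (hω : MeasurableSet ω)
    (t : ℝ) (u : L2 d) : ‖oscillatorSemigroup d t (restriction hω u)‖ ≤ ‖u‖ :=
  (norm_oscillatorSemigroup_le _ _).trans (norm_restriction_le hω _)

/-- A control on a time interval of length `τ`, followed by free evolution of the same length. -/
theorem exists_step_control {d N : ℕ} {ω : Set (E d)} (hω : MeasurableSet ω) {κ τ : ℝ}
    (hτ : 0 < τ) (hκ : ∀ u ∈ hermiteL2 d N, ‖u‖ ≤ κ * ‖restriction hω u‖) (y : L2 d) :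
    ∃ (w : ℝ → L2 d) (h : ℝ × E d → ℂ), Continuous w ∧ StronglyMeasurable h ∧
      (∀ s, (fun x ↦ h (s, x)) =ᵐ[volume] w s) ∧ (∀ s, ‖w s‖ ≤ κ ^ 2 / τ * ‖y‖) ∧
      ‖oscillatorSemigroup d τ (oscillatorSemigroup d τ y +
        ∫ s in (0 : ℝ)..τ, oscillatorSemigroup d (τ - s) (restriction hω (w s)))‖ ≤
        (1 + κ ^ 2) * Real.exp (-(N * τ)) * ‖y‖ := by
  obtain ⟨w, hwc, hwmem, hwle, hw⟩ := exists_low_mode_control hω hτ hκ y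
  obtain ⟨h, hhm, hhw⟩ := exists_jointly_measurable _ hwc hwmem
  refine ⟨w, h, hwc, hhm, hhw, hwle, ?_⟩
  have hcont := continuous_oscillatorSemigroup_restriction hω hwc τ
  have hI : spectralProjection d N
      (∫ s in (0 : ℝ)..τ, oscillatorSemigroup d (τ - s) (restriction hω (w s))) =
      -spectralProjection d N (oscillatorSemigroup d τ y) := by
    rw [← (spectralProjection d N).intervalIntegral_comp_comm (hcont.intervalIntegrable 0 τ)]
    rw [← uIcc_of_le hτ.le] at hw
    rw [intervalIntegral.integral_congr hw, intervalIntegral.integral_const, sub_zero,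
      ← algebraMap_smul ℂ τ, smul_smul, Complex.coe_algebraMap, ← Complex.ofReal_neg,
      ← Complex.ofReal_mul, mul_neg, mul_inv_cancel₀ hτ.ne', Complex.ofReal_neg, Complex.ofReal_one, neg_smul, one_smul]
  have hIle : ‖∫ s in (0 : ℝ)..τ, oscillatorSemigroup d (τ - s) (restriction hω (w s))‖ ≤
      κ ^ 2 * ‖y‖ := by
    have h1 := intervalIntegral.norm_integral_le_of_norm_le_const (a := 0) (b := τ)
      (f := fun s ↦ oscillatorSemigroup d (τ - s) (restriction hω (w s)))
      fun s _ ↦ (norm_oscillatorSemigroup_restriction_le hω _ _).trans (hwle s)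
    rw [sub_zero, abs_of_pos hτ] at h1
    have h2 : κ ^ 2 / τ * ‖y‖ * τ = κ ^ 2 * ‖y‖ := by field_simp
    rwa [h2] at h1
  generalize (∫ s in (0 : ℝ)..τ, oscillatorSemigroup d (τ - s) (restriction hω (w s))) = I at hI hIle ⊢
  have hPz : spectralProjection d N (oscillatorSemigroup d τ y + I) = 0 := by
    rw [map_add, hI, add_neg_cancel]
  have hzle : ‖oscillatorSemigroup d τ y + I‖ ≤ (1 + κ ^ 2) * ‖y‖ := by
    have h1 := norm_add_le (oscillatorSemigroup d τ y) I
    have h2 := norm_oscillatorSemigroup_le τ y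
    linarith
  -- Only high modes are left, so the free evolution contracts by exp(-N τ).
  refine (norm_oscillatorSemigroup_le_of_spectralProjection_eq_zero hτ.le hPz).trans ?_
  have h3 := mul_le_mul_of_nonneg_left hzle (Real.exp_nonneg (-(N * τ)))
  linarith

end

/-! ### Gluing the steps: Duhamel's formula and the infinite iteration. -/

section

open Filter Topology
open scoped Function

open Classical in
/-- The function that equals `W k` on `A k` for every `k`, and `0` elsewhere. -/
def glue {α X : Type*} [Zero X] (A : ℕ → Set α) (W : ℕ → α → X) (a : α) : X :=
  if h : ∃ k, a ∈ A k then W h.choose a else 0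

theorem glue_of_mem {α X : Type*} [Zero X] {A : ℕ → Set α} (hA : Pairwise (Disjoint on A))
    (W : ℕ → α → X) {a : α} {k : ℕ} (h : a ∈ A k) : glue A W a = W k a := by
  have h1 : ∃ k, a ∈ A k := ⟨k, h⟩
  have h2 : h1.choose = k := by
    by_contra hne
    exact (Set.disjoint_left.1 (hA hne)) h1.choose_spec h
  rw [glue, dif_pos h1, h2]

theorem glue_of_forall_notMem {α X : Type*} [Zero X] {A : ℕ → Set α} (W : ℕ → α → X) {a : α}
    (h : ∀ k, a ∉ A k) : glue A W a = 0 :=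
  dif_neg (by simpa using h)

theorem glue_induction {α X : Type*} [Zero X] {A : ℕ → Set α} {W : ℕ → α → X} {p : α → X → Prop}
    (h0 : ∀ a, p a 0) (h : ∀ k a, p a (W k a)) (a : α) : p a (glue A W a) := by
  rw [glue]
  split_ifs
  · exact h _ a
  · exact h0 a

theorem aestronglyMeasurable_glue {α X : Type*} [Zero X] [TopologicalSpace X]
    [TopologicalSpace.PseudoMetrizableSpace X] {_ : MeasurableSpace α} {μ : Measure α}
    {A : ℕ → Set α} (hA : Pairwise (Disjoint on A)) (hAm : ∀ k, MeasurableSet (A k))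
    {W : ℕ → α → X} (hW : ∀ k, AEStronglyMeasurable (W k) μ) :
    AEStronglyMeasurable (glue A W) μ := by
  rw [← Measure.restrict_univ (μ := μ), ← union_compl_self (⋃ k, A k),
    aestronglyMeasurable_union_iff, aestronglyMeasurable_iUnion_iff]
  refine ⟨fun k ↦ (hW k).restrict.congr ?_, (aestronglyMeasurable_const (b := (0 : X))).congr ?_⟩
  · filter_upwards [ae_restrict_mem (hAm k)] with a ha
    exact (glue_of_mem hA W ha).symm
  · filter_upwards [ae_restrict_mem (MeasurableSet.iUnion hAm).compl] with a ha
    exact (glue_of_forall_notMem W (by simpa using ha)).symm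

theorem aestronglyMeasurable_oscillatorSemigroup {d : ℕ} {F : ℝ → L2 d}
    (hF : AEStronglyMeasurable F volume) (t : ℝ) :
    AEStronglyMeasurable (fun s ↦ oscillatorSemigroup d (t - s) (F s)) volume := by
  have h1 : AEStronglyMeasurable (fun s : ℝ ↦ ((t - s, F s) : ℝ × L2 d)) volume :=
    (continuous_const.sub continuous_id).aestronglyMeasurable.prodMk hF
  have h2 := (continuous_oscillatorSemigroup_uncurry d).comp_aestronglyMeasurable h1
  exact h2

theorem intervalIntegrable_oscillatorSemigroup {d : ℕ} {F : ℝ → L2 d}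
    (hF : AEStronglyMeasurable F volume) {b : ℝ} (hb : ∀ s, ‖F s‖ ≤ b) (t x y : ℝ) :
    IntervalIntegrable (fun s ↦ oscillatorSemigroup d (t - s) (F s)) volume x y := by
  refine (intervalIntegrable_const (c := b)).mono_fun
    (aestronglyMeasurable_oscillatorSemigroup hF t).restrict (Eventually.of_forall fun s ↦ ?_)
  exact (norm_oscillatorSemigroup_le _ _).trans ((hb s).trans (le_abs_self b))

/-- Duhamel's formula for the solution with source `F`. -/
def mildSolution {d : ℕ} (f₀ : L2 d) (F : ℝ → L2 d) (t : ℝ) : L2 d :=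
  oscillatorSemigroup d t f₀ + ∫ s in (0 : ℝ)..t, oscillatorSemigroup d (t - s) (F s)

/-- Duhamel's formula can be restarted at any intermediate time, by the semigroup law under the
integral. -/
theorem mildSolution_eq {d : ℕ} {F : ℝ → L2 d} (hF : AEStronglyMeasurable F volume) {b : ℝ}
    (hb : ∀ s, ‖F s‖ ≤ b) (f₀ : L2 d) {x y : ℝ} (hx : 0 ≤ x) (hxy : x ≤ y) :
    mildSolution f₀ F y = oscillatorSemigroup d (y - x) (mildSolution f₀ F x) +
      ∫ s in x..y, oscillatorSemigroup d (y - s) (F s) := by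
  have hint := intervalIntegrable_oscillatorSemigroup hF hb
  have h1 : oscillatorSemigroup d (y - x) (∫ s in (0 : ℝ)..x, oscillatorSemigroup d (x - s) (F s)) =
      ∫ s in (0 : ℝ)..x, oscillatorSemigroup d (y - s) (F s) := by
    rw [← ContinuousLinearMap.intervalIntegral_comp_comm _ (hint x 0 x)]
    refine intervalIntegral.integral_congr fun s hs ↦ ?_
    rw [uIcc_of_le hx] at hs
    rw [← oscillatorSemigroup_add (by linarith) (by linarith [hs.2]), sub_add_sub_cancel]
  rw [mildSolution, mildSolution, map_add, h1, ← oscillatorSemigroup_add (by linarith) hx,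
    sub_add_cancel, add_assoc, intervalIntegral.integral_add_adjacent_intervals (hint y 0 x) (hint y x y)]

/-- The control acts on the first half of each [t k, t (k + 1)] and is zero on the second. `hdecay`
halves the state at each step; `hcost` says that the cost of a step is paid by the decay of the
previous one, so the controls stay bounded up to T. -/
theorem exists_null_control {d : ℕ} {ω : Set (E d)} (hω : MeasurableSet ω) {t τ κ : ℕ → ℝ}
    {N : ℕ → ℕ} {T : ℝ} (ht0 : 0 ≤ t 0) (hτ : ∀ k, 0 < τ k) (ht : ∀ k, t (k + 1) = t k + 2 * τ k)
    (hT : Tendsto t atTop (𝓝 T))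
    (hκ : ∀ k, ∀ u ∈ hermiteL2 d (N k), ‖u‖ ≤ κ k * ‖restriction hω u‖)
    (hdecay : ∀ k, (1 + κ k ^ 2) * Real.exp (-(N k * τ k)) ≤ 1 / 2)
    (hcost : ∀ k, κ (k + 1) ^ 2 / τ (k + 1) * ((1 + κ k ^ 2) * Real.exp (-(N k * τ k))) ≤ 1)
    (f₀ : L2 d) :
    ∃ (w : ℝ → L2 d) (h : ℝ × E d → ℂ) (b : ℝ), AEStronglyMeasurable w volume ∧
      AEStronglyMeasurable h (volume.prod volume) ∧
      (∀ s, (fun x ↦ h (s, x)) =ᵐ[volume] w s) ∧ (∀ s, ‖w s‖ ≤ b) ∧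
      mildSolution f₀ (fun s ↦ restriction hω (w s)) T = 0 := by
  choose W H hWc hHm hHW hWle hstep using
    fun (k : ℕ) (y : L2 d) ↦ exists_step_control hω (hτ k) (hκ k) y
  let y : ℕ → L2 d := fun n ↦ Nat.rec (oscillatorSemigroup d (t 0) f₀) (fun k y ↦
    oscillatorSemigroup d (τ k) (oscillatorSemigroup d (τ k) y +
      ∫ s in (0 : ℝ)..τ k, oscillatorSemigroup d (τ k - s) (restriction hω (W k y s)))) n
  have hy0 : y 0 = oscillatorSemigroup d (t 0) f₀ := rfl
  have hysucc : ∀ k, y (k + 1) = oscillatorSemigroup d (τ k) (oscillatorSemigroup d (τ k) (y k) +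
      ∫ s in (0 : ℝ)..τ k, oscillatorSemigroup d (τ k - s) (restriction hω (W k (y k) s))) :=
    fun k ↦ rfl
  have hyle : ∀ k, ‖y (k + 1)‖ ≤ (1 + κ k ^ 2) * Real.exp (-(N k * τ k)) * ‖y k‖ := fun k ↦ by
    rw [hysucc]
    exact hstep k (y k)
  clear_value y
  have hyhalf : ∀ k, ‖y k‖ ≤ (1 / 2) ^ k * ‖y 0‖ := by
    intro k
    induction k with
    | zero => simp
    | succ k ih =>
      calc ‖y (k + 1)‖ ≤ 1 / 2 * ‖y k‖ :=
            (hyle k).trans (mul_le_mul_of_nonneg_right (hdecay k) (norm_nonneg _))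
        _ ≤ 1 / 2 * ((1 / 2) ^ k * ‖y 0‖) := by gcongr
        _ = _ := by ring
  have hylezero : ∀ k, ‖y k‖ ≤ ‖y 0‖ := fun k ↦ (hyhalf k).trans
    (mul_le_of_le_one_left (norm_nonneg _) (pow_le_one₀ (by norm_num) (by norm_num)))
  -- The first summand bounds the control of step 0, the second all later ones through `hcost`.
  set b : ℝ := (κ 0 ^ 2 / τ 0 + 1) * ‖y 0‖ with hb
  have hκτ : 0 ≤ κ 0 ^ 2 / τ 0 := div_nonneg (sq_nonneg _) (hτ 0).le
  have hb0 : 0 ≤ b := by positivity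
  have hWb : ∀ k s, ‖W k (y k) s‖ ≤ b := by
    intro k s
    refine (hWle k (y k) s).trans ?_
    cases k with
    | zero =>
      rw [hb]
      gcongr
      linarith
    | succ k =>
      have h1 : κ (k + 1) ^ 2 / τ (k + 1) * ‖y (k + 1)‖ ≤ 1 * ‖y k‖ := by
        refine le_trans (mul_le_mul_of_nonneg_left (hyle k)
          (div_nonneg (sq_nonneg _) (hτ _).le)) ?_
        rw [← mul_assoc]
        exact mul_le_mul_of_nonneg_right (hcost k) (norm_nonneg _)
      refine h1.trans ?_
      rw [hb]
      exact mul_le_mul (by linarith) (hylezero k) (norm_nonneg _) (by linarith)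
  have htmono : StrictMono t := strictMono_nat_of_lt_succ fun k ↦ by
    rw [ht]
    linarith [hτ k]
  have htT : ∀ k, t k ≤ T := fun k ↦ htmono.monotone.ge_of_tendsto hT k
  have htpos : ∀ k, 0 ≤ t k := fun k ↦ ht0.trans (htmono.monotone (Nat.zero_le k))
  have hsep : ∀ j k, j < k → t j + 2 * τ j ≤ t k := fun j k h ↦ by
    rw [← ht]
    exact htmono.monotone h
  set A : ℕ → Set ℝ := fun k ↦ Ioc (t k) (t k + τ k) with hA
  have hAd : Pairwise (Disjoint on A) := by
    rw [pairwise_disjoint_on]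
    intro j k hjk
    refine Set.disjoint_left.2 fun s hs hs' ↦ ?_
    have h1 := hsep j k hjk
    have h2 := hτ j
    linarith [hs.2, hs'.1]
  have hAd' : Pairwise (Disjoint on fun k ↦ A k ×ˢ (univ : Set (E d))) := fun j k hjk ↦
    Set.disjoint_prod.2 (Or.inl (hAd hjk))
  set w : ℝ → L2 d := glue A fun k s ↦ W k (y k) (s - t k) with hw
  set h : ℝ × E d → ℂ := glue (fun k ↦ A k ×ˢ univ) fun k p ↦ H k (y k) (p.1 - t k, p.2) with hh
  have hwm : AEStronglyMeasurable w volume :=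
    aestronglyMeasurable_glue hAd (fun k ↦ measurableSet_Ioc) fun k ↦
      ((hWc k (y k)).comp (continuous_id.sub continuous_const)).aestronglyMeasurable
  have hhm : AEStronglyMeasurable h (volume.prod volume) := by
    refine aestronglyMeasurable_glue hAd' (fun k ↦ measurableSet_Ioc.prod MeasurableSet.univ)
      fun k ↦ ?_
    exact ((hHm k (y k)).comp_measurable
      ((measurable_fst.sub measurable_const).prodMk measurable_snd)).aestronglyMeasurable
  have hhw : ∀ s, (fun x ↦ h (s, x)) =ᵐ[volume] w s := by
    intro s
    by_cases hs : ∃ k, s ∈ A k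
    · obtain ⟨k, hk⟩ := hs
      rw [hw, glue_of_mem hAd _ hk]
      filter_upwards [hHW k (y k) (s - t k)] with x hx
      rw [hh, glue_of_mem hAd' _ (k := k) ⟨hk, mem_univ _⟩]
      exact hx
    · push Not at hs
      rw [hw, glue_of_forall_notMem _ hs]
      filter_upwards [Lp.coeFn_zero ℂ 2 (volume : Measure (E d))] with x hx
      rw [hx, hh, glue_of_forall_notMem _ fun k hk ↦ hs k hk.1]
      rfl
  have hwb : ∀ s, ‖w s‖ ≤ b := glue_induction (p := fun _ u ↦ ‖u‖ ≤ b) (by simpa using hb0)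
    fun k s ↦ hWb k _
  refine ⟨w, h, b, hwm, hhm, hhw, hwb, ?_⟩
  have hFm : AEStronglyMeasurable (fun s ↦ restriction hω (w s)) volume :=
    (restriction hω).continuous.comp_aestronglyMeasurable hwm
  have hFb : ∀ s, ‖restriction hω (w s)‖ ≤ b := fun s ↦ (norm_restriction_le hω _).trans (hwb s)
  have hduh := fun {x z : ℝ} (hx : 0 ≤ x) (hxz : x ≤ z) ↦ mildSolution_eq hFm hFb f₀ hx hxz
  set f := mildSolution f₀ fun s ↦ restriction hω (w s) with hf
  -- The solution driven by the glued control passes through the states prescribed by the recursion.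
  have hft : ∀ k, f (t k) = y k := by
    intro k
    induction k with
    | zero =>
      rw [hy0, hf, mildSolution, intervalIntegral.integral_zero_ae, add_zero]
      refine Eventually.of_forall fun s hs ↦ ?_
      rw [uIoc_of_le ht0] at hs
      rw [hw, glue_of_forall_notMem, map_zero, map_zero]
      intro k hk
      linarith [htmono.monotone (Nat.zero_le k), hk.1, hs.2]
    | succ k ih =>
      have hτk := hτ k
      have h1 : ∫ s in t k..t k + τ k, oscillatorSemigroup d (t k + τ k - s) (restriction hω (w s)) =
          ∫ s in (0 : ℝ)..τ k, oscillatorSemigroup d (τ k - s) (restriction hω (W k (y k) s)) := by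
        have h2 := intervalIntegral.integral_comp_sub_right (a := t k) (b := t k + τ k)
          (fun s ↦ oscillatorSemigroup d (τ k - s) (restriction hω (W k (y k) s))) (t k)
        rw [sub_self, add_sub_cancel_left] at h2
        rw [← h2]
        refine intervalIntegral.integral_congr_ae (Eventually.of_forall fun s hs ↦ ?_)
        rw [uIoc_of_le (by linarith)] at hs
        rw [hw, glue_of_mem hAd _ (k := k) hs]
        congr 2
        ring
      have h3 : ∫ s in t k + τ k..t (k + 1),
          oscillatorSemigroup d (t (k + 1) - s) (restriction hω (w s)) = 0 := by
        refine intervalIntegral.integral_zero_ae (Eventually.of_forall fun s hs ↦ ?_)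
        rw [uIoc_of_le (by rw [ht]; linarith)] at hs
        rw [hw, glue_of_forall_notMem, map_zero, map_zero]
        intro j hj
        rcases lt_trichotomy j k with hjk | rfl | hjk
        · have := hsep j k hjk
          linarith [hτ j, hj.2, hs.1]
        · linarith [hj.2, hs.1]
        · have := htmono.monotone (Nat.succ_le_of_lt hjk)
          have h5 := hs.2
          have h6 := hj.1
          simp only [Nat.succ_eq_add_one] at this
          linarith
      have h4 : t (k + 1) - (t k + τ k) = τ k := by rw [ht]; ring
      rw [hduh (x := t k + τ k) (by linarith [htpos k]) (by rw [ht]; linarith), h3, add_zero, h4,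
        hduh (x := t k) (htpos k) (by linarith), h1, ih, add_sub_cancel_left, hysucc]
  -- Restart at t k and ignore all further cancellation: the state there and the remaining time both
  -- tend to 0, while the source is bounded.
  have hlim : ∀ k, ‖f T‖ ≤ (1 / 2) ^ k * ‖y 0‖ + b * (T - t k) := by
    intro k
    rw [hduh (htpos k) (htT k), hft]
    refine (norm_add_le _ _).trans (add_le_add ((norm_oscillatorSemigroup_le _ _).trans (hyhalf k)) ?_)
    have h1 := intervalIntegral.norm_integral_le_of_norm_le_const (a := t k) (b := T)
      (f := fun s ↦ oscillatorSemigroup d (T - s) (restriction hω (w s)))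
      fun s _ ↦ (norm_oscillatorSemigroup_le _ _).trans (hFb s)
    rwa [abs_of_nonneg (by linarith [htT k])] at h1
  have hzero : Tendsto (fun k ↦ (1 / 2 : ℝ) ^ k * ‖y 0‖ + b * (T - t k)) atTop (𝓝 0) := by
    have h1 := (tendsto_pow_atTop_nhds_zero_of_lt_one (r := (1 / 2 : ℝ)) (by norm_num)
      (by norm_num)).mul_const ‖y 0‖
    have h2 := (hT.const_sub T).const_mul b
    simpa using h1.add h2
  exact norm_le_zero_iff.1 (ge_of_tendsto' hzero hlim)

end

/-! ### Choice of the time steps and conclusion. -/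

section

open Filter Topology

theorem memLp_of_slices {d : ℕ} {w : ℝ → L2 d} {h : ℝ × E d → ℂ} {b T : ℝ}
    (hh : AEStronglyMeasurable h (volume.prod volume))
    (hhw : ∀ s, (fun x ↦ h (s, x)) =ᵐ[volume] w s) (hb : ∀ s, ‖w s‖ ≤ b) :
    MemLp h 2 ((volume.restrict (Ioo 0 T)).prod (volume : Measure (E d))) := by
  have hm : AEStronglyMeasurable h ((volume.restrict (Ioo 0 T)).prod (volume : Measure (E d))) :=
    hh.mono_ac (Measure.absolutelyContinuous_of_le Measure.restrict_le_self |>.prod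
      Measure.AbsolutelyContinuous.rfl)
  refine ⟨hm, ?_⟩
  rw [eLpNorm_lt_top_iff_lintegral_rpow_enorm_lt_top two_ne_zero ENNReal.ofNat_ne_top,
    ENNReal.toReal_ofNat, lintegral_prod _ (hm.enorm.pow_const _)]
  have h1 : ∀ s, ∫⁻ x, ‖h (s, x)‖ₑ ^ (2 : ℝ) ≤ ENNReal.ofReal b ^ (2 : ℝ) := by
    intro s
    calc ∫⁻ x, ‖h (s, x)‖ₑ ^ (2 : ℝ) = ∫⁻ x, ‖w s x‖ₑ ^ (2 : ℝ) := by
          refine lintegral_congr_ae ?_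
          filter_upwards [hhw s] with x hx
          rw [hx]
      _ = ‖w s‖ₑ ^ (2 : ℝ) := by
          rw [Lp.enorm_def, eLpNorm_eq_eLpNorm' two_ne_zero ENNReal.ofNat_ne_top, ENNReal.toReal_ofNat,
            lintegral_rpow_enorm_eq_rpow_eLpNorm' two_pos]
      _ ≤ _ := by
          gcongr
          rw [← ofReal_norm]
          exact ENNReal.ofReal_le_ofReal (hb s)
  refine (lintegral_mono h1).trans_lt ?_
  rw [lintegral_const]
  finiteness

/-- Allows ω to be merely null-measurable: a measurable set equal to it almost everywhere defines
the same source, and the default value 0 is never taken. -/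
theorem controlSource_eq_restriction {d : ℕ} {ω ω' : Set (E d)} (hω' : MeasurableSet ω')
    (hωω' : ω' =ᵐ[volume] ω) {h : ℝ × E d → ℂ} {s : ℝ} {u : L2 d}
    (hu : (fun x ↦ h (s, x)) =ᵐ[volume] u) : controlSource ω h s = restriction hω' u := by
  have h1 : restriction hω' u =ᵐ[volume] ω.indicator fun x ↦ h (s, x) := by
    refine (restriction_ae hω' u).trans ((indicator_ae_eq_of_ae_eq_set hωω').trans ?_)
    exact hu.symm.indicator
  have h2 : MemLp (ω.indicator fun x ↦ h (s, x)) 2 (volume : Measure (E d)) :=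
    (memLp_congr_ae h1).1 (Lp.memLp _)
  rw [controlSource, dif_pos h2]
  exact Lp.ext (h2.coeFn_toLp.trans h1.symm)

/-- A spectral inequality with sublinear cost implies null-controllability. -/
theorem exactlyNullControllable_of_spectral_inequality {d : ℕ} {ω ω' : Set (E d)}
    (hω' : MeasurableSet ω') (hωω' : ω' =ᵐ[volume] ω) {C : ℝ} (hC : 0 < C)
    (hspec : ∀ᶠ k in atTop, ∀ u ∈ hermiteL2 d (16 ^ k),
      ‖u‖ ≤ Real.exp (C * (16 ^ k * weight k)) * ‖restriction hω' u‖) {T : ℝ} (hT : 0 < T) :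
    ExactlyNullControllable (harmonicOscillator d) ω T := by
  intro f₀
  -- In the cost condition the exponents in units of X are 32 C from the next step, 48 from its
  -- inverse weight and 2 C - B from the decay; this B makes their sum -2.
  set B : ℝ := 34 * C + 50 with hB
  have hB0 : 0 < B := by positivity
  have hsum : Summable fun k ↦ 2 * (B * weight k) := (summable_weight.mul_left B).mul_left 2
  -- Start at a level beyond which the spectral inequality holds and the total duration of the
  -- remaining steps is less than T.
  obtain ⟨k₀, hk₀, hk₀T⟩ := ((eventually_forall_ge_atTop.2 hspec).and
    ((tendsto_sum_nat_add fun k ↦ 2 * (B * weight k)).eventually_lt_const hT)).exists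
  set a : ℕ → ℝ := fun k ↦ 2 * (B * weight (k + k₀)) with ha
  have hasum : Summable a := (summable_nat_add_iff k₀).2 hsum
  -- The steps are placed so as to end exactly at T; before t 0 the equation runs freely.
  set t : ℕ → ℝ := fun k ↦ T - ∑' j, a j + ∑ j ∈ Finset.range k, a j with ht
  have htT : Tendsto t atTop (𝓝 T) := by
    have := hasum.hasSum.tendsto_sum_nat.const_add (T - ∑' j, a j)
    rwa [sub_add_cancel] at this
  have hX : ∀ k : ℕ, (k : ℝ) + 1 ≤ 16 ^ k * weight k := succ_le_pow_mul_weight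
  have hX1 : ∀ k, 1 ≤ 16 ^ k * weight k := fun k ↦ by
    linarith [hX k, (Nat.cast_nonneg k : (0 : ℝ) ≤ k)]
  have hXs : ∀ k, 16 ^ (k + 1) * weight (k + 1) ≤ 16 * (16 ^ k * weight k) := fun k ↦ by
    rw [pow_succ', mul_assoc]
    gcongr
    exact weight_antitone (Nat.le_succ k)
  have hfac : ∀ k, (1 + Real.exp (C * (16 ^ k * weight k)) ^ 2) *
      Real.exp (-(((16 ^ k : ℕ) : ℝ) * (B * weight k))) ≤
      2 * Real.exp ((2 * C - B) * (16 ^ k * weight k)) := by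
    intro k
    set X : ℝ := 16 ^ k * weight k with hXdef
    have hX0 : 0 < X := by linarith [hX1 k]
    have h1 : 1 ≤ Real.exp (C * X) := Real.one_le_exp (by positivity)
    have h2 : ((16 ^ k : ℕ) : ℝ) * (B * weight k) = B * X := by
      rw [hXdef]
      push_cast
      ring
    calc _ ≤ (2 * Real.exp (C * X) ^ 2) * Real.exp (-(B * X)) := by
          rw [h2]
          gcongr
          nlinarith
      _ = _ := by
          rw [← Real.exp_nat_mul, mul_assoc, ← Real.exp_add]
          push_cast
          ring_nf
  obtain ⟨w, h, b, hwm, hhm, hhw, hwb, hfin⟩ := exists_null_control hω' (t := t)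
    (τ := fun k ↦ B * weight (k + k₀))
    (κ := fun k ↦ Real.exp (C * (16 ^ (k + k₀) * weight (k + k₀)))) (N := fun k ↦ 16 ^ (k + k₀))
    (T := T) (by simp only [ht, Finset.range_zero, Finset.sum_empty, ha]; linarith)
    (fun k ↦ mul_pos hB0 (weight_pos _))
    (fun k ↦ by simp only [ht, Finset.sum_range_succ, ha]; ring) htT
    (fun k ↦ hk₀ (k + k₀) (Nat.le_add_left _ _))
    (fun k ↦ by
      refine (hfac _).trans ?_
      have h1 : (2 * C - B) * (16 ^ (k + k₀) * weight (k + k₀)) ≤ -2 := by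
        nlinarith [hX1 (k + k₀)]
      have h2 : Real.exp (-2) ≤ 1 / 4 := by
        rw [Real.exp_neg, one_div]
        gcongr
        have h3 := Real.add_one_le_exp (1 : ℝ)
        rw [show (2 : ℝ) = 1 + 1 by norm_num, Real.exp_add]
        nlinarith
      linarith [Real.exp_le_exp.2 h1])
    (fun k ↦ by
      have hk : k + 1 + k₀ = k + k₀ + 1 := by ring
      rw [hk]
      set j := k + k₀
      set X : ℝ := 16 ^ j * weight j with hXdef
      have hX0 : 0 < X := by linarith [hX1 j]
      have h1 : Real.exp (C * (16 ^ (j + 1) * weight (j + 1))) ^ 2 ≤ Real.exp (32 * C * X) := by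
        rw [← Real.exp_nat_mul]
        refine Real.exp_le_exp.2 ?_
        push_cast
        nlinarith [hXs j]
      have h2 : (B * weight (j + 1))⁻¹ ≤ B⁻¹ * Real.exp (48 * X) := by
        rw [mul_inv]
        gcongr
        refine (inv_weight_le (j + 1)).trans ?_
        have h3 : ((j + 1 : ℕ) : ℝ) + 1 ≤ Real.exp (16 * X) := by
          linarith [hX (j + 1), hXs j, Real.add_one_le_exp (16 * X)]
        calc _ ≤ Real.exp (16 * X) ^ 3 := by gcongr
          _ = _ := by
            rw [← Real.exp_nat_mul]
            push_cast
            ring_nf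
      calc _ ≤ Real.exp (32 * C * X) * (B⁻¹ * Real.exp (48 * X)) *
            (2 * Real.exp ((2 * C - B) * X)) := by
            rw [div_eq_mul_inv]
            refine mul_le_mul (mul_le_mul h1 h2 ?_ (by positivity)) (hfac j) (by positivity)
              (by positivity)
            exact inv_nonneg.2 (mul_nonneg hB0.le (weight_pos _).le)
        _ = 2 / B * Real.exp (-(2 * X)) := by
            rw [show -(2 * X) = 32 * C * X + 48 * X + (2 * C - B) * X by rw [hB]; ring,
              Real.exp_add, Real.exp_add]
            ring
        _ ≤ 1 * 1 := by
            gcongr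
            · rw [div_le_one hB0]
              linarith
            · rw [Real.exp_le_one_iff]
              linarith
        _ = 1 := one_mul 1) f₀
  have hsrc : controlSource ω h = fun s ↦ restriction hω' (w s) :=
    funext fun s ↦ controlSource_eq_restriction hω' hωω' (hhw s)
  have hFm : AEStronglyMeasurable (fun s ↦ restriction hω' (w s)) volume :=
    (restriction hω').continuous.comp_aestronglyMeasurable hwm
  refine ⟨h, memLp_of_slices hhm hhw hwb, mildSolution f₀ fun s ↦ restriction hω' (w s),
    ⟨oscillatorSemigroup d, isSemigroupOf_oscillatorSemigroup d, fun r _ ↦ ?_⟩, hfin⟩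
  rw [hsrc]
  exact ⟨intervalIntegrable_oscillatorSemigroup hFm
    (fun s ↦ (norm_restriction_le hω' _).trans (hwb s)) r 0 r, rfl⟩

theorem exists_L2_spectral_inequality {d : ℕ} {ω : Set (E d)} (hω : MeasurableSet ω)
    {ρ : E d → ℝ} {σ : ℝ} (hσ : 0 < σ) (hσ1 : σ ≤ 1) (hρ0 : ∀ x, 0 < ρ x)
    (hgeom : ∀ x, ENNReal.ofReal σ * volume (Metric.ball x (ρ x)) ≤
      volume (ω ∩ Metric.ball x (ρ x)))
    (hρ : ∀ c : ℝ, 1 ≤ c → ∃ D, 0 < D ∧ ∀ (k : ℕ) (x : E d), ‖x‖ ≤ c * 4 ^ k →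
      ρ x ≤ D * (4 ^ k * weight k)) :
    ∃ C, 0 < C ∧ ∀ᶠ k in atTop, ∀ u ∈ hermiteL2 d (16 ^ k),
      ‖u‖ ≤ Real.exp (C * (16 ^ k * weight k)) * ‖restriction hω u‖ := by
  rcases Nat.eq_zero_or_pos d with rfl | hd
  -- In dimension 0 there are no radii to slice along, but the space is a point and ω, having
  -- positive measure, is everything.
  · have hne : (ω ∩ Metric.ball (0 : E 0) (ρ 0)).Nonempty := by
      refine nonempty_of_measure_ne_zero (μ := volume) (lt_of_lt_of_le ?_ (hgeom 0)).ne'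
      exact ENNReal.mul_pos (by simpa using hσ) (Metric.measure_ball_pos _ _ (hρ0 0)).ne'
    have huniv : ω = univ := Subsingleton.eq_univ_of_nonempty (hne.mono inter_subset_left)
    subst huniv
    refine ⟨1, one_pos, Eventually.of_forall fun k u _ ↦ ?_⟩
    have h1 : restriction hω u = u := Lp.ext (by simpa using restriction_ae hω u)
    rw [h1]
    refine le_mul_of_one_le_left (norm_nonneg _) (Real.one_le_exp ?_)
    have := weight_pos k
    positivity
  · obtain ⟨C, hC, h⟩ := exists_spectral_inequality hd hω hσ hσ1 hρ0 hgeom hρ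
    refine ⟨C, hC, h.mono fun k hk u hu ↦ ?_⟩
    obtain ⟨f, hf, rfl⟩ := hu
    have h1 := hk f (hermiteSpace_mono d (Nat.le_succ _) hf)
    rw [← norm_sq_restriction_toL2 hω] at h1
    have hw := weight_pos k
    have h2 : 1 ≤ Real.exp (C * (16 ^ k * weight k)) := Real.one_le_exp (by positivity)
    refine abs_le_of_sq_le_sq' ?_ (by positivity) |>.2
    refine h1.trans ?_
    rw [mul_pow]
    gcongr
    nlinarith

end

end HarmonicControl

end

theorem corollary2p9 (d : ℕ) (ω : Set (HarmonicControl.E d))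
    (hω : NullMeasurableSet ω (volume : Measure (HarmonicControl.E d)))
    (σ ρ : HarmonicControl.E d → ℝ)
    (hσ : ∀ x, 0 < σ x ∧ σ x ≤ 1) (hρ : ∀ x, 0 < ρ x)
    (hgeom : HarmonicControl.GeometricCondition ω σ ρ)
    (hσconst : ∀ x y, σ x = σ y)
    (L α : ℝ) (hL : 0 < L) (hα : 2 < α)
    (hρ_le : ∀ x, ρ x ≤ L * HarmonicControl.japaneseBracket x /
      (HarmonicControl.logScale (HarmonicControl.logScale ‖x‖) ^ α *
        HarmonicControl.logScale ‖x‖))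
    (T : ℝ) (hT : 0 < T) :
    HarmonicControl.ExactlyNullControllable (HarmonicControl.harmonicOscillator d) ω T := by
  -- Passing to an almost everywhere equal measurable set changes neither the densities nor the
  -- source term.
  obtain ⟨ω', -, hω', hωω'⟩ := hω.exists_measurable_subset_ae_eq
  obtain ⟨C, hC, hspec⟩ := HarmonicControl.exists_L2_spectral_inequality hω' (hσ 0).1 (hσ 0).2 hρ
    (fun x ↦ by
      have h : volume (ω' ∩ Metric.ball x (ρ x)) = volume (ω ∩ Metric.ball x (ρ x)) :=
        measure_congr (ae_eq_set_inter hωω' (Filter.EventuallyEq.refl _ _))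
      rw [hσconst 0 x, h]
      exact hgeom x)
    (fun c hc ↦ HarmonicControl.exists_le_mul_weight hL hα hρ_le hc)
  exact HarmonicControl.exactlyNullControllable_of_spectral_inequality hω' hωω' hC hspec hT
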